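/- Let $d>0$, $d\equiv 0,1 \pmod 4$, let $D>0$ be a fundamental discriminant ($D=1$ allowed), and suppose that $\Delta:=dD$ is a square. Let $\mathcal{Q}_{\Delta}$ be the set of integral binary quadratic forms $Q=[a,b,c]=ax^2+bxy+cy^2$ with $b^2-4ac=\Delta$, on which $\Gamma=\mathrm{PSL}_2(\mathbb{Z})$ acts by $\gamma Q=Q\circ\gamma^{-1}$, and let $\Gamma_\infty\subset\Gamma$ be the stabilizer of $\infty$. Put $e(x)=e^{2\pi i x}$. For $Q=[a,b,c]\in\mathcal Q_\Delta$ let $\chi_D(Q)=\left(\frac{D}{r}\right)$ (Kronecker symbol) if $\gcd(a,b,c,D)=1$, where $r$ is any integer represented by $Q$ with $\gcd(r,D)=1$, and $\chi_D(Q)=0$ if $\gcd(a,b,c,D)>1$. Let $C_Q$ be the geodesic $a|\tau|^2+b\,\mathrm{Re}\,\tau+c=0$ in the upper half-plane, oriented counterclockwise if $a>0$, clockwise if $a<0$, and, if $a=0$, upward for $b>0$ and downward for $b<0$; put $d\tau_Q=\sqrt{\Delta}\,d\tau/Q(\tau,1)$. For an integer $m\ge 0$ and $\mathrm{Re}\,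 s>1$ let $$G_{m,Q}(\tau,s)=\sum_{\substack{\gamma\in\Gamma_\infty\backslash\Gamma\\ \gamma\ne\gamma_\alpha}} e(-m\,\mathrm{Re}\,\gamma\tau)\,\phi_{m,s}(\mathrm{Im}\,\gamma\tau),\qquad \phi_{m,s}(y)=\begin{cases} y^s & (m=0),\\ 2\pi m^{1/2}y^{1/2}I_{s-\frac12}(2\pi m y)& (m>0),\end{cases}$$ where the cosets of the two elements $\gamma_\alpha\in\Gamma$ sending a root $\alpha\in\mathbb P^1(\mathbb Q)$ of $Q$ to $\infty$ are omitted and $I_\nu$, $J_\nu$ are the Bessel functions. For $c\geq 1$ let $$S_m(d,D;4c)=\sum_{\substack{b \bmod 4c\\ b^2\equiv dD \bmod 4c}}\chi_D\!\left(\left[c,b,\tfrac{b^2-dD}{4c}\right]\right)e\!\left(\frac{mb}{2c}\right),\qquad B(s)=\frac{2^s\,\Gamma(s/2)^2}{\Gamma(s)}.$$ Then $\Gamma\backslash\mathcal Q_{dD}$ is finite; for every $Q\in\mathcal Q_{dD}$ the series $G_{m,Q}(\tau,s)$ converges absolutely for each $\tau$ in the upper half-plane and is absolutely integrable along $C_Q$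 with respect to $d\tau_Q$; the series over $c$ below converge absolutely; and, for any choice of representatives $Q$ of the classes, $$\sum_{Q\in\Gamma\backslash\mathcal Q_{dD}}\frac{\chi_D(Q)}{B(s)}\int_{C_Q}G_{m,Q}(\tau,s)\,d\tau_Q=\begin{cases}\dfrac{\pi}{\sqrt2}\,m^{\frac12}(dD)^{\frac14}\displaystyle\sum_{c=1}^\infty\frac{S_m(d,D;4c)}{c^{1/2}}\,J_{s-\frac12}\!\left(\frac{\pi m\sqrt{dD}}{c}\right)& \text{if } m>0,\\[2ex] 2^{-s-1}(dD)^{\frac s2}\displaystyle\sum_{c=1}^\infty\frac{S_0(d,D;4c)}{c^s}&\text{if } m=0.\end{cases}$$ -/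

import Mathlib

namespace SquareTrace

open scoped MatrixGroups
open UpperHalfPlane

noncomputable section

/-- An integral binary quadratic form `[a, b, c] = a x² + b x y + c y²`. -/
@[ext]
structure BinForm where
  a : ℤ
  b : ℤ
  c : ℤ

namespace BinForm

/-- The value `Q(x, y)`. -/
def eval (Q : BinForm) (x y : ℤ) : ℤ := Q.a * x ^ 2 + Q.b * x * y + Q.c * y ^ 2

/-- The discriminant `b² - 4ac`. -/
def disc (Q : BinForm) : ℤ := Q.b ^ 2 - 4 * Q.a * Q.c

/-- The complex value `Q(τ, 1)`. -/
def evalC (Q : BinForm) (z : ℂ) : ℂ := (Q.a : ℂ) * z ^ 2 + (Q.b : ℂ) * z + (Q.c : ℂ)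

/-- The form `γQ = Qγ⁻¹ = Q(Dx - By, -Cx + Ay)` for `γ = (A B; C D)`, written out in coefficients. -/
def act (γ : SL(2, ℤ)) (Q : BinForm) : BinForm where
  a := Q.a * γ 1 1 ^ 2 - Q.b * γ 1 1 * γ 1 0 + Q.c * γ 1 0 ^ 2
  b := -2 * Q.a * γ 1 1 * γ 0 1 + Q.b * (γ 0 0 * γ 1 1 + γ 0 1 * γ 1 0)
    - 2 * Q.c * γ 1 0 * γ 0 0
  c := Q.a * γ 0 1 ^ 2 - Q.b * γ 0 1 * γ 0 0 + Q.c * γ 0 0 ^ 2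

theorem eval_act (γ : SL(2, ℤ)) (Q : BinForm) (x y : ℤ) :
    (act γ Q).eval x y = Q.eval (γ 1 1 * x - γ 0 1 * y) (-(γ 1 0) * x + γ 0 0 * y) := by
  simp only [act, eval]; ring

theorem disc_act (γ : SL(2, ℤ)) (Q : BinForm) : (act γ Q).disc = Q.disc := by
  have h : γ 0 0 * γ 1 1 - γ 0 1 * γ 1 0 = 1 := by
    have := γ.det_coe; rwa [Matrix.det_fin_two] at this
  have h2 : (act γ Q).disc = (γ 0 0 * γ 1 1 - γ 0 1 * γ 1 0) ^ 2 * Q.disc := by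
    simp only [act, disc]; ring
  rw [h2, h]; ring

end BinForm

/-- The set `𝒬_Δ` of integral binary quadratic forms of discriminant `Δ`
(for `Δ > 0` no definiteness condition is imposed). -/
def FormsOfDisc (Δ : ℤ) : Type := {Q : BinForm // Q.disc = Δ}

/-- The left action of the modular group on `𝒬_Δ`.
Since `-1` acts trivially it is an action of `PSL₂(ℤ)`. -/
instance formsAction (Δ : ℤ) : MulAction SL(2, ℤ) (FormsOfDisc Δ) where
  smul γ Q := ⟨BinForm.act γ Q.1, (BinForm.disc_act γ Q.1).trans Q.2⟩
  one_smul Q := by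
    apply Subtype.ext
    change BinForm.act 1 Q.1 = Q.1
    ext <;> simp [BinForm.act]
  mul_smul γ δ Q := by
    apply Subtype.ext
    change BinForm.act (γ * δ) Q.1 = BinForm.act γ (BinForm.act δ Q.1)
    ext <;> simp [BinForm.act, Matrix.mul_apply, Fin.sum_univ_two] <;> ring

/-- The set of classes `Γ \ 𝒬_Δ`. -/
abbrev FormClass (Δ : ℤ) : Type := MulAction.orbitRel.Quotient SL(2, ℤ) (FormsOfDisc Δ)

/-- `1` and the discriminants of quadratic fields. -/
def IsFundamentalDiscriminant (D : ℤ) : Prop :=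
  (D % 4 = 1 ∧ Squarefree D) ∨
    ∃ k : ℤ, D = 4 * k ∧ Squarefree k ∧ (k % 4 = 2 ∨ k % 4 = 3)

/-- The Kronecker symbol `(a / n)`. The symbol `(a / 2)` is `χ₈(a)`; the odd part of `|n|`
is handled by the Jacobi symbol. -/
def kroneckerSymbol (a n : ℤ) : ℤ :=
  if n = 0 then (if a.natAbs = 1 then 1 else 0)
  else (if a < 0 ∧ n < 0 then -1 else 1) *
    ZMod.χ₈ (a : ZMod 8) ^ (n.natAbs.factorization 2) *
    jacobiSym a (n.natAbs / 2 ^ n.natAbs.factorization 2)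

/-- The integers `r` prime to `D` which are represented by `Q`. -/
def coprimeValues (D : ℤ) (Q : BinForm) : Set ℤ :=
  {r : ℤ | Int.gcd r D = 1 ∧ ∃ x y : ℤ, Q.eval x y = r}

open Classical in
/-- The generalized genus character: `χ_D(Q) = (D / r)` for any `r` prime to `D` represented by `Q`
if `gcd(a, b, c, D) = 1`, and `χ_D(Q) = 0` otherwise. -/
def chi (D : ℤ) (Q : BinForm) : ℤ :=
  if h : Int.gcd Q.a (Int.gcd Q.b (Int.gcd Q.c D)) = 1 ∧ (coprimeValues D Q).Nonempty then
    kroneckerSymbol D h.2.some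
  else 0

/-- `e(x) = exp(2πix)`. -/
def expTwoPiI (x : ℝ) : ℂ := Complex.exp (2 * Real.pi * Complex.I * x)

/-- The Bessel function of the first kind `J_ν(z)`. -/
def besselJ (ν z : ℂ) : ℂ :=
  (z / 2) ^ ν * ∑' k : ℕ, (-1) ^ k / ((k.factorial : ℂ) * Complex.Gamma (ν + k + 1)) *
    (z / 2) ^ (2 * k)

/-- The modified Bessel function of the first kind `I_ν(z)`. -/
def besselI (ν z : ℂ) : ℂ :=
  (z / 2) ^ ν * ∑' k : ℕ, 1 / ((k.factorial : ℂ) * Complex.Gamma (ν + k + 1)) *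
    (z / 2) ^ (2 * k)

/-- `φ_{m,s}(y)`, equal to `y^s` if `m = 0` and to `2π m^{1/2} y^{1/2} I_{s-1/2}(2πmy)` if
`m > 0`. -/
def phi (m : ℕ) (s : ℂ) (y : ℝ) : ℂ :=
  if m = 0 then (y : ℂ) ^ s
  else 2 * Real.pi * (Real.sqrt m : ℂ) * (Real.sqrt y : ℂ) *
    besselI (s - 1 / 2) ((2 * Real.pi * m * y : ℝ) : ℂ)

/-- The stabilizer `Γ_∞ = {± (1 n; 0 1)}` of the cusp `∞`. -/
def gammaInf : Subgroup SL(2, ℤ) where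
  carrier := {γ | γ 1 0 = 0}
  one_mem' := by simp
  mul_mem' := by
    intro a b ha hb
    simp only [Set.mem_ofPred_eq] at ha hb ⊢
    simp [Matrix.mul_apply, Fin.sum_univ_two, ha, hb]
  inv_mem' := by
    intro a ha
    simp only [Set.mem_ofPred_eq] at ha ⊢
    simp [Matrix.SpecialLinearGroup.SL2_inv_expl, ha]

/-- The coset space `Γ_∞ \ Γ`. -/
abbrev CuspCosets : Type := Quotient (QuotientGroup.rightRel gammaInf)

theorem gammaInf_cases (h : SL(2, ℤ)) (hh : h ∈ gammaInf) :
    ∃ ε n : ℤ, (ε = 1 ∨ ε = -1) ∧ h 0 0 = ε ∧ h 0 1 = ε * n ∧ h 1 0 = 0 ∧ h 1 1 = ε := by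
  have h10 : h 1 0 = 0 := hh
  have hdet : h 0 0 * h 1 1 - h 0 1 * h 1 0 = 1 := by
    have := h.det_coe; rwa [Matrix.det_fin_two] at this
  rw [h10, mul_zero, sub_zero] at hdet
  rcases Int.mul_eq_one_iff_eq_one_or_neg_one.mp hdet with ⟨h0, h1⟩ | ⟨h0, h1⟩
  · exact ⟨1, h 0 1, Or.inl rfl, h0, by ring, h10, h1⟩
  · exact ⟨-1, -h 0 1, Or.inr rfl, h0, by ring, h10, h1⟩

theorem gammaInf_smul (h : SL(2, ℤ)) (hh : h ∈ gammaInf) (z : ℍ) :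
    ∃ n : ℤ, ((h • z : ℍ) : ℂ) = (z : ℂ) + n := by
  obtain ⟨ε, n, hε, h00, h01, h10, h11⟩ := gammaInf_cases h hh
  refine ⟨n, ?_⟩
  rw [UpperHalfPlane.specialLinearGroup_apply]
  rcases hε with rfl | rfl
  · simp [h00, h01, h10, h11]
  · simp [h00, h01, h10, h11, div_neg, add_comm]

/-- The summand `e(-m Re γτ) φ(Im γτ)`. -/
def poincareSummand (m : ℕ) (φ : ℝ → ℂ) (τ : ℍ) (γ : SL(2, ℤ)) : ℂ :=
  expTwoPiI (-(m : ℝ) * (γ • τ).re) * φ (γ • τ).im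

theorem poincareSummand_mul (m : ℕ) (φ : ℝ → ℂ) (τ : ℍ) (h γ : SL(2, ℤ)) (hh : h ∈ gammaInf) :
    poincareSummand m φ τ (h * γ) = poincareSummand m φ τ γ := by
  obtain ⟨n, hn⟩ := gammaInf_smul h hh (γ • τ)
  have hre : (h • γ • τ).re = (γ • τ).re + n := by
    have := congrArg Complex.re hn; simpa using this
  have him : (h • γ • τ).im = (γ • τ).im := by
    have := congrArg Complex.im hn; simpa using this
  simp only [poincareSummand, mul_smul, hre, him, expTwoPiI]
  congr 1
  rw [Complex.exp_eq_exp_iff_exists_int]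
  refine ⟨-(m : ℤ) * n, ?_⟩
  push_cast
  ring

/-- The summand as a function on `Γ_∞ \ Γ`. -/
def cosetSummand (m : ℕ) (φ : ℝ → ℂ) (τ : ℍ) : CuspCosets → ℂ :=
  Quotient.lift (poincareSummand m φ τ) (by
    intro γ δ hγδ
    have h : δ * γ⁻¹ ∈ gammaInf := QuotientGroup.rightRel_apply.mp hγδ
    have := poincareSummand_mul m φ τ (δ * γ⁻¹) γ h
    rw [inv_mul_cancel_right] at this
    exact this.symm)

/-- `γ` is a matrix `γ_α = (* *; s -r)` for a root `α = r/s ∈ ℙ¹(ℚ)`, `(r, s) = 1`, of `Q`. -/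
def IsRootMatrix (Q : BinForm) (γ : SL(2, ℤ)) : Prop :=
  ∃ r s : ℤ, IsCoprime r s ∧ Q.eval r s = 0 ∧ γ 1 0 = s ∧ γ 1 1 = -r

/-- The elements of `Γ_∞ \ Γ` other than the cosets of `γ_α`, `α` a root of `Q`. -/
def nonRootCosets (Q : BinForm) : Set CuspCosets :=
  {q | ∀ γ : SL(2, ℤ), (Quotient.mk _ γ : CuspCosets) = q → ¬ IsRootMatrix Q γ}

/-- The modified Poincaré series `G_{m,Q}(τ, s)`. -/
def modifiedPoincare (m : ℕ) (Q : BinForm) (s : ℂ) (τ : ℍ) : ℂ :=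
  ∑' q : nonRootCosets Q, cosetSummand m (phi m s) τ q

/-- Absolute convergence of the series `G_{m,Q}(τ, s)`. -/
def PoincareConverges (m : ℕ) (Q : BinForm) (s : ℂ) (τ : ℍ) : Prop :=
  Summable fun q : nonRootCosets Q => cosetSummand m (phi m s) τ q

/-- A parametrization of the geodesic `a|τ|² + b Re τ + c = 0`. It is a semicircle if `a ≠ 0`,
traversed counterclockwise if `a > 0` and clockwise if `a < 0`; if `a = 0` it is the vertical
line `Re τ = -c/b`, traversed upwards if `b > 0` and downwards if `b < 0`. -/
def cycleParam (Q : BinForm) (t : ℝ) : ℂ :=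
  if 0 < Q.a then
    -(Q.b : ℂ) / (2 * Q.a) +
      ((Real.sqrt Q.disc / (2 * |(Q.a : ℝ)|) : ℝ) : ℂ) * Complex.exp (Complex.I * t)
  else if Q.a < 0 then
    -(Q.b : ℂ) / (2 * Q.a) -
      ((Real.sqrt Q.disc / (2 * |(Q.a : ℝ)|) : ℝ) : ℂ) * Complex.exp (-(Complex.I * t))
  else if 0 < Q.b then -(Q.c : ℂ) / Q.b + Complex.I * t
  else -(Q.c : ℂ) / Q.b + Complex.I * (t : ℂ)⁻¹

/-- The parameter interval of `cycleParam Q`. -/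
def cycleDomain (Q : BinForm) : Set ℝ :=
  if Q.a = 0 then Set.Ioi 0 else Set.Ioo 0 Real.pi

/-- The pullback of `f(τ) dτ_Q`, where `dτ_Q = √Δ dτ / Q(τ, 1)`, under `cycleParam Q`. -/
def cycleIntegrand (Q : BinForm) (f : ℍ → ℂ) (t : ℝ) : ℂ :=
  f (UpperHalfPlane.ofComplex (cycleParam Q t)) *
    ((Real.sqrt Q.disc : ℂ) * deriv (cycleParam Q) t / Q.evalC (cycleParam Q t))

/-- Absolute convergence of `∫_{C_Q} f dτ_Q`. -/
def CycleIntegrable (Q : BinForm) (f : ℍ → ℂ) : Prop :=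
  MeasureTheory.IntegrableOn (cycleIntegrand Q f) (cycleDomain Q)

/-- The cycle integral `∫_{C_Q} f(τ) dτ_Q` for `Q` of positive square discriminant. The
stabilizer of `Q` in `PSL₂(ℤ)` is then trivial, so that `C_Q` is the full geodesic. -/
def cycleIntegral (Q : BinForm) (f : ℍ → ℂ) : ℂ :=
  ∫ t in cycleDomain Q, cycleIntegrand Q f t

/-- `B(s) = 2^s Γ(s/2)² / Γ(s)`. -/
def B (s : ℂ) : ℂ := (2 : ℂ) ^ s * Complex.Gamma (s / 2) ^ 2 / Complex.Gamma s

/-- The exponential sum `S_m(d, D; 4c)`, a sum over residues `b` modulo `4c` with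
`b² ≡ dD` modulo `4c`. -/
def S (m : ℕ) (d D : ℤ) (c : ℕ+) : ℂ :=
  ∑ b ∈ (Finset.Ico (0 : ℤ) (4 * (c : ℤ))).filter (fun b => b ^ 2 ≡ d * D [ZMOD 4 * (c : ℤ)]),
    (chi D ⟨(c : ℤ), b, (b ^ 2 - d * D) / (4 * (c : ℤ))⟩ : ℂ) *
      expTwoPiI ((m : ℝ) * b / (2 * (c : ℕ)))

/-- The twisted trace `∑_{Q ∈ Γ\𝒬_Δ} (χ_D(Q) / B(s)) ∫_{C_Q} G_{m,Q}(τ, s) dτ_Q`, computed with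
a system `rep` of representatives of the classes. -/
def twistedTrace (D : ℤ) {Δ : ℤ} (m : ℕ) (s : ℂ) (rep : FormClass Δ → FormsOfDisc Δ) : ℂ :=
  ∑ᶠ q : FormClass Δ, (chi D (rep q).1 : ℂ) / B s *
    cycleIntegral (rep q).1 (modifiedPoincare m (rep q).1 s)

/-- `rep` picks a representative of each class in `Γ \ 𝒬_Δ`. -/
def IsRepSystem {Δ : ℤ} (rep : FormClass Δ → FormsOfDisc Δ) : Prop :=
  ∀ q : FormClass Δ, (Quotient.mk _ (rep q) : FormClass Δ) = q

end

end SquareTrace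

/-! The identity is an instance of the unfolding method, in which the square discriminant makes every
cycle a full geodesic between two rational cusps.

*Unfolding.* A form `Q` of discriminant `n² > 0` has two rational roots and a trivial stabilizer in
`PSL₂(ℤ)` (`BinForm.eq_one_or_neg_one_of_act_eq`). Hence `(Q, Γ_∞ γ) ↦ Γ_∞ γQ` is a bijection from
the pairs of a class and a coset onto the forms of discriminant `n²` modulo translations, and the
omitted cosets correspond exactly to the forms with `a = 0` (`mk_mem_nonRootCosets_iff`,
`exists_unfold_equiv`). The forms with `a ≠ 0` modulo translations are the `± [c, b, *]` with
`c ≥ 1` and `b` modulo `2c` a square root of `n²` modulo `4c`.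

*One summand.* The cycle integral is invariant: integrating `f(γτ)` along `C_Q` amounts to
integrating `f` along `C_{γQ}` (`cycle_comp_smul`). This is proved through frames, real matrices
carrying the imaginary axis with the measure `du / u` to `C_Q`, which are unique up to scaling `u`.
The summand of the coset of `γ` therefore contributes the integral of `e(-m Re τ) φ_{m,s}(Im τ)`
over a semicircle with centre `-b/2c` and radius `n/2c`. The centre gives the exponential
`e(mb/2c)`; the integral over the semicircle about the origin is expanded in a double power series
whose entries are Beta integrals, and the Chu–Vandermonde identity sums the terms of equal degree to
`B(s)/2` times a power of the radius (`m = 0`) or times a `J`-Bessel function (`m > 0`), see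
`angularIntegral_zero` and `angularIntegral_pos`.

*The character.* `χ_D` is invariant under `SL₂(ℤ)` by its definition and under `Q ↦ -Q` because
`(D / r)` does not depend on the represented value `r` (`kroneckerSymbol_eq_of_mem`, a consequence
of quadratic reciprocity) and is even in `r` for `D > 0`. So the forms `[c, b, *]` and
`-[c, b, *]` contribute equally. The resulting factor `2` is matched by `S_m`, in which `b` runs
modulo `4c` (`S_eq_two_mul`).

*Convergence.* The `L¹`-norm of the summand of `γ` along `C_Q` is `O(|a(γQ)|^{-Re s})`, where
`a(γQ)` is a value of `Q`. A form of square discriminant is, up to a constant, a product of two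
independent integral linear forms, so that the sum of these bounds is at most the square of
`∑ |k|^{-Re s}` up to a constant (`summable_abs_eval_rpow`). This justifies all interchanges and also
yields the absolute convergence of the series over `c`.
-/

namespace SquareTrace

open scoped MatrixGroups
open UpperHalfPlane

noncomputable section

/-! ### Forms of square discriminant: rational roots, stabilizers, classes -/

theorem det_eq_one (γ : SL(2, ℤ)) : γ 0 0 * γ 1 1 - γ 0 1 * γ 1 0 = 1 := by
  have := γ.det_coe; rwa [Matrix.det_fin_two] at this

namespace BinForm

theorem act_mul (γ δ : SL(2, ℤ)) (Q : BinForm) : act (γ * δ) Q = act γ (act δ Q) :=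
  congrArg Subtype.val ((formsAction Q.disc).mul_smul γ δ ⟨Q, rfl⟩)

theorem act_one (Q : BinForm) : act 1 Q = Q :=
  congrArg Subtype.val ((formsAction Q.disc).one_smul ⟨Q, rfl⟩)

theorem act_inv_act (γ : SL(2, ℤ)) (Q : BinForm) : act γ⁻¹ (act γ Q) = Q := by
  rw [← act_mul, inv_mul_cancel, act_one]

theorem act_a (γ : SL(2, ℤ)) (Q : BinForm) : (act γ Q).a = Q.eval (γ 1 1) (-γ 1 0) := by
  simp only [act, eval]; ring

/-- A form of square discriminant has a primitive integral zero. -/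
theorem exists_isCoprime_eval_eq_zero {Q : BinForm} {n : ℤ} (hQ : Q.disc = n ^ 2) :
    ∃ r s : ℤ, IsCoprime r s ∧ Q.eval r s = 0 := by
  unfold disc at hQ
  by_cases ha : Q.a = 0
  · exact ⟨1, 0, isCoprime_one_left, by simp [eval, ha]⟩
  · have hne : 2 * Q.a ≠ 0 := by omega
    -- the root `(-b + n) / 2a` in lowest terms
    have hg : 0 < Int.gcd (-Q.b + n) (2 * Q.a) := Int.gcd_pos_of_ne_zero_right _ hne
    obtain ⟨r, s, hrs, hr, hs⟩ := Int.exists_gcd_one hg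
    refine ⟨r, s, Int.isCoprime_iff_gcd_eq_one.mpr hrs, ?_⟩
    set g : ℤ := (Int.gcd (-Q.b + n) (2 * Q.a) : ℤ) with hgdef
    have hg0 : g ≠ 0 := by
      rw [hgdef]; exact_mod_cast hg.ne'
    have h1 : Q.eval (-Q.b + n) (2 * Q.a) = 0 := by
      simp only [eval]; linear_combination (-Q.a) * hQ
    have h2 : Q.eval (-Q.b + n) (2 * Q.a) = g ^ 2 * Q.eval r s := by
      rw [hr, hs]; simp only [eval]; ring
    rw [h1] at h2
    rcases mul_eq_zero.mp h2.symm with h | h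
    · exact absurd (pow_eq_zero_iff (two_ne_zero)|>.mp h) hg0
    · exact h

theorem exists_act_a_eq_zero {Q : BinForm} {n : ℤ} (hQ : Q.disc = n ^ 2) :
    ∃ δ : SL(2, ℤ), (act δ Q).a = 0 := by
  obtain ⟨r, s, hrs, h⟩ := exists_isCoprime_eval_eq_zero hQ
  obtain ⟨δ, h0, h1⟩ := (hrs.symm.neg_left).exists_SL2_row 1
  refine ⟨δ, ?_⟩
  rw [act_a]
  rw [h0, h1, neg_neg, h]

theorem eq_one_or_neg_one_of_act_eq_of_a_eq_zero {Q : BinForm} {n : ℤ} (hn : 0 < n)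
    (hQ : Q.disc = n ^ 2) (ha : Q.a = 0) {γ : SL(2, ℤ)} (hγ : act γ Q = Q) :
    γ = 1 ∨ γ = -1 := by
  have hdet := det_eq_one γ
  have hb : Q.b ≠ 0 := by
    intro hb
    simp only [disc, ha, hb] at hQ
    nlinarith
  have e1 := congrArg BinForm.a hγ
  have e2 := congrArg BinForm.b hγ
  have e3 := congrArg BinForm.c hγ
  simp only [act, ha] at e1 e2 e3
  -- the inverse of `γ` maps the root `∞` of `[0, b, c]` either to itself or to the other root; the
  -- second case would give `γQ` the middle coefficient `-b`
  have h1 : γ 1 0 * (Q.c * γ 1 0 - Q.b * γ 1 1) = 0 := by linear_combination e1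
  rcases mul_eq_zero.mp h1 with h | h
  · rw [h, mul_zero, sub_zero] at hdet
    have h01 : γ 0 0 = γ 1 1 ∧ (γ 0 0 = 1 ∨ γ 0 0 = -1) := by
      rcases Int.mul_eq_one_iff_eq_one_or_neg_one.mp hdet with ⟨h0, h1⟩ | ⟨h0, h1⟩ <;> simp [h0, h1]
    have hsq : γ 0 0 ^ 2 = 1 := by rcases h01.2 with h | h <;> simp [h]
    have hz : γ 0 1 = 0 := by
      have : Q.b * (γ 0 1 * γ 0 0) = 0 := by linear_combination (-1 : ℤ) * e3 + Q.c * hsq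
      have h2 := (mul_eq_zero.mp this).resolve_left hb
      rcases mul_eq_zero.mp h2 with h3 | h3
      · exact h3
      · rw [h3] at hsq; norm_num at hsq
    rcases h01.2 with h0 | h0
    · left
      ext i j; fin_cases i <;> fin_cases j <;> simp [h, hz, h0, ← h01.1]
    · right
      ext i j; fin_cases i <;> fin_cases j <;> simp [h, hz, h0, ← h01.1]
  · exfalso
    have : 2 * Q.b = 0 := by
      linear_combination (-1 : ℤ) * e2 - Q.b * hdet - 2 * γ 0 0 * h
    omega

/-- The stabilizer in `PSL₂(ℤ)` of a form of positive square discriminant is trivial. -/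
theorem eq_one_or_neg_one_of_act_eq {Q : BinForm} {n : ℤ} (hn : 0 < n)
    (hQ : Q.disc = n ^ 2) {γ : SL(2, ℤ)} (hγ : act γ Q = Q) : γ = 1 ∨ γ = -1 := by
  obtain ⟨δ, hδ⟩ := exists_act_a_eq_zero hQ
  have h := eq_one_or_neg_one_of_act_eq_of_a_eq_zero hn ((disc_act δ Q).trans hQ) hδ
    (γ := δ * γ * δ⁻¹) (by rw [act_mul, act_mul, act_inv_act, hγ])
  have e : γ = δ⁻¹ * (δ * γ * δ⁻¹) * δ := by group
  rcases h with h | h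
  · left; rw [e, h]; group
  · right; rw [e, h]; simp

/-- The elements of `Γ_∞` act as translations on the first two coefficients. -/
theorem act_translation {h : SL(2, ℤ)} (hh : h ∈ gammaInf) (Q : BinForm) :
    ∃ k : ℤ, (act h Q).a = Q.a ∧ (act h Q).b = Q.b - 2 * Q.a * k := by
  obtain ⟨ε, k, hε, h00, h01, h10, h11⟩ := gammaInf_cases h hh
  refine ⟨k, ?_⟩
  simp only [act, h00, h01, h10, h11]
  rcases hε with rfl | rfl <;> constructor <;> ring

/-- The translation `(1 k; 0 1)`. -/
def translation (k : ℤ) : SL(2, ℤ) := ⟨!![1, k; 0, 1], by simp⟩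

theorem translation_mem (k : ℤ) : translation k ∈ gammaInf := by
  change translation k 1 0 = 0
  simp [translation]

theorem act_translation_eq (k : ℤ) (Q : BinForm) :
    act (translation k) Q = ⟨Q.a, Q.b - 2 * Q.a * k, Q.a * k ^ 2 - Q.b * k + Q.c⟩ := by
  simp only [act, translation, Matrix.of_apply, Matrix.cons_val', Matrix.cons_val_zero,
    Matrix.cons_val_one, Matrix.cons_val_fin_one]
  ext <;> simp
  ring

theorem ext_of_disc_eq {Q R : BinForm} (ha : Q.a ≠ 0) (h1 : Q.a = R.a) (h2 : Q.b = R.b)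
    (h : Q.disc = R.disc) : Q = R := by
  ext
  · exact h1
  · exact h2
  · simp only [disc, ← h1, ← h2] at h
    have : 4 * Q.a * (Q.c - R.c) = 0 := by linear_combination -h
    have := (mul_eq_zero.mp this).resolve_left (by omega)
    omega

end BinForm

theorem finite_formClass {n : ℤ} (hn : 0 < n) {Δ : ℤ} (hΔ : Δ = n ^ 2) :
    Finite (FormClass Δ) := by
  -- every class contains a form `[0, ± n, c]` with `0 ≤ c < n`
  let F : (({n, -n} : Finset ℤ) ×ˢ Finset.Ico 0 n : Finset (ℤ × ℤ)) → FormClass Δ := fun p =>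
    Quotient.mk _ (⟨⟨0, p.1.1, p.1.2⟩, by
      have := (Finset.mem_product.mp p.2).1
      simp only [Finset.mem_insert, Finset.mem_singleton] at this
      simp only [BinForm.disc, hΔ]
      rcases this with h | h <;> rw [h] <;> ring⟩ : FormsOfDisc Δ)
  refine Finite.of_surjective F ?_
  intro q
  induction q using Quotient.inductionOn with
  | h Q =>
    obtain ⟨δ, hδ⟩ := BinForm.exists_act_a_eq_zero (Q.2.trans hΔ)
    have hd : (BinForm.act δ Q.1).disc = n ^ 2 := (BinForm.disc_act δ Q.1).trans (Q.2.trans hΔ)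
    set R := BinForm.act δ Q.1 with hR
    have hb2 : R.b = n ∨ R.b = -n := by
      apply sq_eq_sq_iff_eq_or_eq_neg.mp
      simpa [BinForm.disc, hδ] using hd
    obtain ⟨k, hk⟩ : ∃ k : ℤ, R.c - R.b * k = R.c % n := by
      have := Int.emod_add_mul_ediv R.c n
      rcases hb2 with h | h
      · exact ⟨R.c / n, by rw [h]; linarith⟩
      · exact ⟨-(R.c / n), by rw [h]; linarith⟩
    refine ⟨⟨(R.b, R.c % n), ?_⟩, ?_⟩
    · simp only [Finset.mem_product, Finset.mem_insert, Finset.mem_singleton, Finset.mem_Ico]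
      exact ⟨hb2, Int.emod_nonneg _ hn.ne', Int.emod_lt_of_pos _ hn⟩
    · apply Quotient.sound
      change _ ∈ MulAction.orbit _ _
      refine ⟨BinForm.translation k * δ, ?_⟩
      apply Subtype.ext
      change BinForm.act _ _ = _
      rw [BinForm.act_mul, ← hR, BinForm.act_translation_eq]
      ext
      · simp [hδ]
      · simp [hδ]
      · simp only [hδ, ← hk]; ring

/-- The values of a form of square discriminant factor, up to a constant, as products of two
independent linear forms, so that the sum of `|Q(x, y)|^{-σ}` over all non-zero values is
dominated by the square of `∑ |n|^{-σ}`. Zero values contribute `0 ^ (-σ) = 0`. -/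
theorem summable_abs_eval_rpow {Q : BinForm} {n : ℤ} (hn : 0 < n) (hQ : Q.disc = n ^ 2)
    {σ : ℝ} (hσ : 1 < σ) :
    Summable fun v : ℤ × ℤ => |(Q.eval v.1 v.2 : ℝ)| ^ (-σ) := by
  obtain ⟨k, hk, L, hL, hQL⟩ : ∃ k : ℤ, k ≠ 0 ∧ ∃ L : ℤ × ℤ → ℤ × ℤ, Function.Injective L ∧
      ∀ v : ℤ × ℤ, k * Q.eval v.1 v.2 = (L v).1 * (L v).2 := by
    unfold BinForm.disc at hQ
    by_cases ha : Q.a = 0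
    · have hb : Q.b ≠ 0 := by
        intro hb
        simp only [ha, hb] at hQ
        nlinarith
      refine ⟨1, one_ne_zero, fun v => (v.2, Q.b * v.1 + Q.c * v.2), ?_, ?_⟩
      · rintro ⟨x, y⟩ ⟨x', y'⟩ h
        simp only [Prod.mk.injEq] at h ⊢
        obtain ⟨h1, h2⟩ := h
        subst h1
        exact ⟨mul_left_cancel₀ hb (by linarith), rfl⟩
      · intro v
        simp only [BinForm.eval, ha]; ring
    · -- `4a Q(x, y) = (2ax + (b + n)y) (2ax + (b - n)y)`
      refine ⟨4 * Q.a, by omega, fun v => (2 * Q.a * v.1 + (Q.b + n) * v.2,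
        2 * Q.a * v.1 + (Q.b - n) * v.2), ?_, ?_⟩
      · rintro ⟨x, y⟩ ⟨x', y'⟩ h
        simp only [Prod.mk.injEq] at h ⊢
        obtain ⟨h1, h2⟩ := h
        have hy : y = y' := mul_left_cancel₀ (two_ne_zero.symm.symm : (2 : ℤ) ≠ 0)
          (mul_left_cancel₀ hn.ne' (by linarith))
        subst hy
        exact ⟨mul_left_cancel₀ ha (by linarith), rfl⟩
      · intro v
        simp only [BinForm.eval]; linear_combination v.2 ^ 2 * (-hQ)
  have h1 := Real.summable_abs_int_rpow hσ
  have h2 : Summable fun p : ℤ × ℤ => |(p.1 : ℝ)| ^ (-σ) * |(p.2 : ℝ)| ^ (-σ) :=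
    h1.mul_of_nonneg h1 (fun _ => by positivity) (fun _ => by positivity)
  have h3 := (h2.comp_injective hL).mul_left (|(k : ℝ)| ^ σ)
  refine h3.congr fun v => ?_
  have hk' : 0 < |(k : ℝ)| := by positivity
  have e : |(k : ℝ)| * |(Q.eval v.1 v.2 : ℝ)| = |((L v).1 : ℝ)| * |((L v).2 : ℝ)| := by
    rw [← abs_mul, ← abs_mul]
    exact_mod_cast congrArg (fun z : ℤ => |(z : ℝ)|) (hQL v)
  simp only [Function.comp_apply]
  rw [← Real.mul_rpow (abs_nonneg _) (abs_nonneg _), ← e,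
    Real.mul_rpow (abs_nonneg _) (abs_nonneg _), ← mul_assoc, ← Real.rpow_add hk']
  simp

/-! ### The genus character -/

theorem kroneckerSymbol_neg_right {D : ℤ} (hD : 0 < D) (r : ℤ) :
    kroneckerSymbol D (-r) = kroneckerSymbol D r := by
  simp [kroneckerSymbol, hD.not_gt]

/-- Quadratic reciprocity for the Kronecker symbol, with `2` and the sign of `r` included. -/
theorem kroneckerSymbol_eq_jacobiSym {D : ℕ} (hD : D % 4 = 1) {r : ℤ} (hr : r ≠ 0) :
    kroneckerSymbol D r = jacobiSym r D := by
  have hodd : Odd D := by rw [Nat.odd_iff]; omega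
  have habs : jacobiSym r D = jacobiSym (r.natAbs : ℤ) D := by
    rcases Int.natAbs_eq r with h | h
    · rw [← h]
    · conv_lhs => rw [h, jacobiSym.neg _ hodd, ZMod.χ₄_nat_one_mod_four hD, one_mul]
  have hN : r.natAbs ≠ 0 := by simpa using hr
  have h2 : Odd (r.natAbs / 2 ^ r.natAbs.factorization 2) := by
    rw [← Nat.not_even_iff_odd, even_iff_two_dvd]
    exact Nat.not_dvd_ordCompl Nat.prime_two hN
  have hdec : (r.natAbs : ℤ) = 2 ^ r.natAbs.factorization 2 *
      ((r.natAbs / 2 ^ r.natAbs.factorization 2 : ℕ) : ℤ) := by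
    exact_mod_cast (Nat.ordProj_mul_ordCompl_eq_self r.natAbs 2).symm
  rw [habs, hdec, jacobiSym.mul_left, jacobiSym.pow_left, jacobiSym.at_two hodd,
    ← jacobiSym.quadratic_reciprocity_one_mod_four hD h2]
  simp [kroneckerSymbol, hr]

/-- If `N` is `x²` modulo `4k` then `(k / |N|) = 1`, by periodicity of the Jacobi symbol in the
lower argument. -/
theorem jacobiSym_natAbs_eq_one_of_sq {k : ℕ} (hk : 0 < k) {N x t : ℤ} (hN : N = x ^ 2 - 4 * k * t)
    (hodd : N % 2 = 1) (hc : IsCoprime x (k : ℤ)) : jacobiSym k N.natAbs = 1 := by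
  have hxodd : Odd x := by
    rw [← Int.not_even_iff_odd]
    rintro ⟨y, rfl⟩
    have : N = 2 * (2 * y ^ 2 - 2 * k * t) := by rw [hN]; ring
    omega
  have hx' : Odd x.natAbs := Int.natAbs_odd.mpr hxodd
  have hNodd : Odd N.natAbs := by
    rw [Int.natAbs_odd, Int.odd_iff]; exact hodd
  have hg : Int.gcd (k : ℤ) (x.natAbs : ℤ) = 1 := by
    rw [Int.gcd_comm]
    have := Int.isCoprime_iff_gcd_eq_one.mp hc
    simpa [Int.gcd, Int.natAbs_abs] using this
  have hJ : jacobiSym k (x.natAbs ^ 2) = 1 := by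
    rw [jacobiSym.pow_right, jacobiSym.sq_one hg]
  rw [jacobiSym.mod_right' k hNodd]
  have hmod : (4 * (k : ℤ)) ∣ N - x ^ 2 := ⟨-t, by rw [hN]; ring⟩
  rcases Int.natAbs_eq N with h | h
  · have e : N.natAbs % (4 * k) = x.natAbs ^ 2 % (4 * k) := by
      zify
      rw [sq_abs]
      apply Int.emod_emod_of_dvd _ (dvd_refl _) |>.symm.trans
      rw [Int.emod_emod_of_dvd _ (dvd_refl _)]
      apply Int.ModEq.symm
      rw [Int.modEq_iff_dvd, ← Int.natCast_natAbs, ← h]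
      exact hmod
    rw [e, ← jacobiSym.mod_right' k hx'.pow, hJ]
  · -- for negative `N` compare `|N| ≡ -x²` with `(4k - 1) x²`
    have h4 : Odd (4 * k - 1) := by rw [Nat.odd_iff]; omega
    have e : N.natAbs % (4 * k) = ((4 * k - 1) * x.natAbs ^ 2) % (4 * k) := by
      have hc : ((4 * k - 1 : ℕ) : ℤ) = 4 * k - 1 := by omega
      zify
      rw [hc, sq_abs]
      apply Int.ModEq.symm
      rw [Int.modEq_iff_dvd, ← Int.natCast_natAbs]
      have : (N.natAbs : ℤ) = -N := by omega
      rw [this]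
      obtain ⟨y, hy⟩ := hmod
      exact ⟨-y - x ^ 2, by linear_combination -hy⟩
    have h1 : jacobiSym k (4 * k - 1) = 1 := by
      have h41 := jacobiSym.at_four h4
      have : jacobiSym (4 * k) (4 * k - 1) = 1 := by
        rw [jacobiSym.mod_left' (a₂ := 1), jacobiSym.one_left]
        have hc : ((4 * k - 1 : ℕ) : ℤ) = 4 * k - 1 := by omega
        rw [hc]
        apply Int.ModEq.symm
        rw [Int.modEq_iff_dvd]
      rwa [jacobiSym.mul_left, h41, one_mul] at this
    rw [e, ← jacobiSym.mod_right' k (h4.mul hx'.pow), jacobiSym.mul_right' _ (by omega)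
      (pow_ne_zero _ (by have := hx'.pos; omega)), h1, hJ, one_mul]

/-- A product of two values of `Q` is, up to the factor `4`, a value of the norm form `X² - ΔY²`. -/
theorem four_mul_eval_mul_eval (Q : BinForm) (x y z w : ℤ) :
    4 * (Q.eval x y * Q.eval z w) =
      (2 * Q.a * x * z + Q.b * (x * w + z * y) + 2 * Q.c * y * w) ^ 2 -
        Q.disc * (x * w - z * y) ^ 2 := by
  simp only [BinForm.eval, BinForm.disc]; ring

theorem isCoprime_of_gcd {r D : ℤ} (h : Int.gcd r D = 1) : IsCoprime r D :=
  Int.isCoprime_iff_gcd_eq_one.mpr h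

/-- `(D / r)` takes the same value for all `r` prime to `D` represented by a form of
discriminant `dD`: by composition of forms `4rr' = X² - dDY²`, which makes `(D / rr') = 1` by
quadratic reciprocity. -/
theorem kroneckerSymbol_eq_of_mem {d D : ℤ} (hd4 : d % 4 = 0 ∨ d % 4 = 1)
    (hD : 0 < D) (hDfund : IsFundamentalDiscriminant D) (hsq : IsSquare (d * D))
    {Q : BinForm} (hQ : Q.disc = d * D) {r r' : ℤ} (hr : r ∈ coprimeValues D Q)
    (hr' : r' ∈ coprimeValues D Q) : kroneckerSymbol D r = kroneckerSymbol D r' := by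
  obtain ⟨hrD, x, y, hxy⟩ := hr
  obtain ⟨hrD', z, w, hzw⟩ := hr'
  have hid := four_mul_eval_mul_eval Q x y z w
  rw [hxy, hzw, hQ] at hid
  set X := 2 * Q.a * x * z + Q.b * (x * w + z * y) + 2 * Q.c * y * w
  set Y := x * w - z * y
  lift D to ℕ using hD.le
  have hco := isCoprime_of_gcd hrD
  have hco' := isCoprime_of_gcd hrD'
  by_cases hD1 : D = 1
  · subst hD1
    have : ∀ t : ℤ, kroneckerSymbol ((1 : ℕ) : ℤ) t = 1 := by
      intro t
      by_cases ht : t = 0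
      · simp [kroneckerSymbol, ht]
      · rw [kroneckerSymbol_eq_jacobiSym (by norm_num) ht]; simp
    rw [this, this]
  have hne : ∀ t : ℤ, Int.gcd t D = 1 → t ≠ 0 := by
    rintro t ht rfl
    simp at ht
    exact hD1 (by simpa using ht)
  have hr0 := hne r hrD
  have hr0' := hne r' hrD'
  suffices h : kroneckerSymbol D r * kroneckerSymbol D r' = 1 by
    rcases Int.mul_eq_one_iff_eq_one_or_neg_one.mp h with ⟨h0, h1⟩ | ⟨h0, h1⟩ <;> rw [h0, h1]
  rcases hDfund with ⟨h1, -⟩ | ⟨k, hk, -, hk4⟩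
  · -- odd `D`: modulo `D`, `4rr'` is the square of `X`
    have h1' : D % 4 = 1 := by omega
    have hodd : Odd D := by rw [Nat.odd_iff]; omega
    rw [kroneckerSymbol_eq_jacobiSym h1' hr0, kroneckerSymbol_eq_jacobiSym h1' hr0',
      ← jacobiSym.mul_left]
    have h4 : jacobiSym (4 * (r * r')) D = jacobiSym (X ^ 2) D := by
      apply jacobiSym.mod_left'
      apply Int.ModEq.symm
      rw [Int.modEq_iff_dvd, hid]
      exact ⟨-d * Y ^ 2, by ring⟩
    have h41 : jacobiSym 4 D = 1 := jacobiSym.at_four hodd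
    have hg : IsCoprime (X ^ 2) (D : ℤ) := by
      have h2 : IsCoprime (4 * (r * r')) (D : ℤ) := by
        refine IsCoprime.mul_left ?_ (hco.mul_left hco')
        have : IsCoprime (2 : ℤ) (D : ℤ) := by
          rw [Int.isCoprime_iff_gcd_eq_one]
          have : Nat.Coprime 2 D := Nat.coprime_two_left.mpr hodd
          exact_mod_cast this
        have h22 := this.mul_left this
        norm_num at h22
        exact h22
      have e : X ^ 2 = 4 * (r * r') + (d * Y ^ 2) * D := by rw [hid]; ring
      rw [e]
      exact h2.add_mul_right_left _
    have hg' : Int.gcd X D = 1 := Int.isCoprime_iff_gcd_eq_one.mp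
      (hg.of_isCoprime_of_dvd_left (dvd_pow_self X two_ne_zero))
    rw [jacobiSym.mul_left, h41, one_mul, jacobiSym.sq_one' hg'] at h4
    exact h4
  · obtain ⟨n, hn⟩ := hsq
    have hkpos : 0 < k := by omega
    lift k to ℕ using hkpos.le
    -- as `dD` is a square and `D/4` is `2` or `3` modulo `4`, the factor `d` is divisible by `4`
    have hd0 : d % 4 = 0 := by
      rcases hd4 with h | h
      · exact h
      · exfalso
        have hn2 : Even n := by
          have : Even (n * n) := by rw [← hn, hk]; exact ⟨2 * d * k, by ring⟩
          rcases Int.even_mul.mp this with h | h <;> exact h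
        obtain ⟨m, rfl⟩ := hn2
        have hm : d * k = m * m := by rw [hk] at hn; linarith
        have hm4 := congrArg (· % 4) hm
        simp only [Int.mul_emod d, h, one_mul] at hm4
        have : m % 4 = 0 ∨ m % 4 = 1 ∨ m % 4 = 2 ∨ m % 4 = 3 := by omega
        rcases this with h' | h' | h' | h' <;> simp [Int.mul_emod m, h'] at hm4 <;> omega
    obtain ⟨e, rfl⟩ : ∃ e, d = 4 * e := ⟨d / 4, by omega⟩
    have hoddD : ∀ t : ℤ, IsCoprime t (D : ℤ) → t % 2 = 1 := by
      intro t ht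
      by_contra hc
      have h2 : (2 : ℤ) ∣ t := by omega
      have h2' : (2 : ℤ) ∣ D := by rw [hk]; exact ⟨2 * k, by ring⟩
      have := ht.isUnit_of_dvd' h2 h2'
      rw [Int.isUnit_iff] at this
      omega
    have ho := hoddD r hco
    have ho' := hoddD r' hco'
    have hX2 : Even X := by
      have : Even (X ^ 2) := by
        have : X ^ 2 = 4 * (r * r') + 4 * e * D * Y ^ 2 := by linarith
        rw [this]; exact ⟨2 * (r * r') + 2 * e * D * Y ^ 2, by ring⟩
      rwa [Int.even_pow' two_ne_zero] at this
    obtain ⟨u, hu⟩ := hX2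
    -- with `X = 2u` the composition identity becomes `rr' ≡ u²` modulo `4k`, where `D = 4k`
    have hN : r * r' = u ^ 2 - 4 * k * (e * Y ^ 2) := by
      rw [hu, hk] at hid
      linarith
    have hNodd : (r * r') % 2 = 1 := by simp [Int.mul_emod, ho, ho']
    have hcu : IsCoprime u (k : ℤ) := by
      have h2 : IsCoprime (r * r') (k : ℤ) := (hco.mul_left hco').of_isCoprime_of_dvd_right
        ⟨4, by rw [hk]; ring⟩
      have h3 : IsCoprime (u ^ 2) (k : ℤ) := by
        have e' : u ^ 2 = r * r' + (4 * (e * Y ^ 2)) * k := by rw [hN]; ring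
        rw [e']
        exact h2.add_mul_right_left _
      exact h3.of_isCoprime_of_dvd_left (dvd_pow_self u two_ne_zero)
    have key := jacobiSym_natAbs_eq_one_of_sq (by omega) hN hNodd hcu
    -- for odd `t` the factor `4` of `D = 4k` does not contribute
    have hK : ∀ t : ℤ, t % 2 = 1 → kroneckerSymbol D t = jacobiSym k t.natAbs := by
      intro t ht
      have hto : Odd t.natAbs := by rw [Int.natAbs_odd, Int.odd_iff]; exact ht
      have ht0 : t ≠ 0 := by rintro rfl; simp at ht
      have hf : t.natAbs.factorization 2 = 0 :=
        Nat.factorization_eq_zero_of_not_dvd (by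
          rw [← even_iff_two_dvd, Nat.not_even_iff_odd]; exact hto)
      have h4 : jacobiSym 4 t.natAbs = 1 := jacobiSym.at_four hto
      simp only [kroneckerSymbol, ht0, if_false, hf, pow_zero, Nat.div_one, mul_one]
      rw [hk, jacobiSym.mul_left, h4, if_neg (by omega)]
      ring
    rw [hK r ho, hK r' ho', ← jacobiSym.mul_right' _ (by omega) (by omega), ← Int.natAbs_mul]
    exact key

theorem coprimeValues_act (D : ℤ) (γ : SL(2, ℤ)) (Q : BinForm) :
    coprimeValues D (BinForm.act γ Q) = coprimeValues D Q := by
  have key : ∀ (γ : SL(2, ℤ)) (Q : BinForm),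
      coprimeValues D (BinForm.act γ Q) ⊆ coprimeValues D Q := by
    rintro γ Q r ⟨h, x, y, hxy⟩
    exact ⟨h, _, _, (BinForm.eval_act γ Q x y).symm.trans hxy⟩
  refine (key γ Q).antisymm ?_
  have := key γ⁻¹ (BinForm.act γ Q)
  rwa [BinForm.act_inv_act] at this

theorem gcd_coeff_eq_one_iff (D : ℤ) (Q : BinForm) :
    Int.gcd Q.a (Int.gcd Q.b (Int.gcd Q.c D)) = 1 ↔
      ∀ g : ℤ, g ∣ Q.a → g ∣ Q.b → g ∣ Q.c → g ∣ D → IsUnit g := by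
  constructor
  · intro h g h1 h2 h3 h4
    have : g ∣ (Int.gcd Q.a (Int.gcd Q.b (Int.gcd Q.c D)) : ℤ) :=
      Int.dvd_coe_gcd h1 (Int.dvd_coe_gcd h2 (Int.dvd_coe_gcd h3 h4))
    rw [h] at this
    exact isUnit_of_dvd_one (by exact_mod_cast this)
  · intro h
    have h1 := h (Int.gcd Q.a (Int.gcd Q.b (Int.gcd Q.c D)) : ℤ) (Int.gcd_dvd_left ..)
      ((Int.gcd_dvd_right ..).trans (Int.gcd_dvd_left ..))
      ((Int.gcd_dvd_right ..).trans ((Int.gcd_dvd_right ..).trans (Int.gcd_dvd_left ..)))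
      ((Int.gcd_dvd_right ..).trans ((Int.gcd_dvd_right ..).trans (Int.gcd_dvd_right ..)))
    rw [Int.isUnit_iff] at h1
    omega

theorem gcd_coeff_act (D : ℤ) (γ : SL(2, ℤ)) (Q : BinForm) :
    Int.gcd (BinForm.act γ Q).a (Int.gcd (BinForm.act γ Q).b (Int.gcd (BinForm.act γ Q).c D)) = 1 ↔
      Int.gcd Q.a (Int.gcd Q.b (Int.gcd Q.c D)) = 1 := by
  have key : ∀ (γ : SL(2, ℤ)) (Q : BinForm) (g : ℤ), g ∣ Q.a → g ∣ Q.b → g ∣ Q.c →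
      g ∣ (BinForm.act γ Q).a ∧ g ∣ (BinForm.act γ Q).b ∧ g ∣ (BinForm.act γ Q).c := by
    rintro γ ⟨a, b, c⟩ g ⟨a', rfl⟩ ⟨b', rfl⟩ ⟨c', rfl⟩
    refine ⟨⟨(BinForm.act γ ⟨a', b', c'⟩).a, ?_⟩, ⟨(BinForm.act γ ⟨a', b', c'⟩).b, ?_⟩,
      ⟨(BinForm.act γ ⟨a', b', c'⟩).c, ?_⟩⟩ <;> simp only [BinForm.act] <;> ring
  rw [gcd_coeff_eq_one_iff, gcd_coeff_eq_one_iff]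
  constructor
  · intro h g h1 h2 h3 h4
    obtain ⟨k1, k2, k3⟩ := key γ Q g h1 h2 h3
    exact h g k1 k2 k3 h4
  · intro h g h1 h2 h3 h4
    obtain ⟨k1, k2, k3⟩ := key γ⁻¹ _ g h1 h2 h3
    rw [BinForm.act_inv_act] at k1 k2 k3
    exact h g k1 k2 k3 h4

/-- The definition of `χ_D` chooses one of the represented values; since `Q` and `γQ` represent the
same integers, it makes the same choice for both. -/
theorem chi_act (D : ℤ) (γ : SL(2, ℤ)) (Q : BinForm) : chi D (BinForm.act γ Q) = chi D Q := by
  have h1 := coprimeValues_act D γ Q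
  have h2 := gcd_coeff_act D γ Q
  by_cases h : Int.gcd Q.a (Int.gcd Q.b (Int.gcd Q.c D)) = 1 ∧ (coprimeValues D Q).Nonempty
  · have h' := h
    rw [← h2, ← h1] at h'
    unfold chi
    rw [dif_pos h, dif_pos h']
    congr 2
  · have h' := h
    rw [← h2, ← h1] at h'
    unfold chi
    rw [dif_neg h, dif_neg h']

/-- `-Q` represents `-r` when `Q` represents `r`, and `(D / -r) = (D / r)` because `D > 0`. -/
theorem chi_neg {d D : ℤ} (hd4 : d % 4 = 0 ∨ d % 4 = 1)
    (hD : 0 < D) (hDfund : IsFundamentalDiscriminant D) (hsq : IsSquare (d * D))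
    {Q : BinForm} (hQ : Q.disc = d * D) : chi D ⟨-Q.a, -Q.b, -Q.c⟩ = chi D Q := by
  have hmem : ∀ (Q : BinForm) (r : ℤ), r ∈ coprimeValues D ⟨-Q.a, -Q.b, -Q.c⟩ →
      -r ∈ coprimeValues D Q := by
    rintro Q r ⟨h, x, y, rfl⟩
    refine ⟨by rwa [Int.neg_gcd] , x, y, ?_⟩
    simp only [BinForm.eval]; ring
  have hne : (coprimeValues D ⟨-Q.a, -Q.b, -Q.c⟩).Nonempty ↔ (coprimeValues D Q).Nonempty := by
    constructor
    · rintro ⟨r, hr⟩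
      exact ⟨_, hmem Q r hr⟩
    · rintro ⟨r, hr⟩
      refine ⟨-r, hmem ⟨-Q.a, -Q.b, -Q.c⟩ r ?_⟩
      simpa using hr
  by_cases h : Int.gcd Q.a (Int.gcd Q.b (Int.gcd Q.c D)) = 1 ∧ (coprimeValues D Q).Nonempty
  · have h' : Int.gcd (-Q.a) (Int.gcd (-Q.b) (Int.gcd (-Q.c) D)) = 1 ∧
        (coprimeValues D ⟨-Q.a, -Q.b, -Q.c⟩).Nonempty := by
      simpa [Int.neg_gcd, hne] using h
    unfold chi
    rw [dif_pos h, dif_pos h', ← kroneckerSymbol_neg_right hD]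
    exact kroneckerSymbol_eq_of_mem hd4 hD hDfund hsq hQ (hmem Q _ h'.2.some_mem) h.2.some_mem
  · have h' : ¬ (Int.gcd (-Q.a) (Int.gcd (-Q.b) (Int.gcd (-Q.c) D)) = 1 ∧
        (coprimeValues D ⟨-Q.a, -Q.b, -Q.c⟩).Nonempty) := by
      simpa [Int.neg_gcd, hne] using h
    unfold chi
    rw [dif_neg h, dif_neg h']

open MeasureTheory Set Filter Topology

/-! ### Trigonometric Beta integrals and the Chu–Vandermonde identity -/

theorem ofReal_cpow_eq_exp {x : ℝ} (hx : 0 < x) (z : ℂ) :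
    (x : ℂ) ^ z = Complex.exp (Real.log x * z) := by
  rw [Complex.cpow_def_of_ne_zero (by exact_mod_cast hx.ne'), Complex.ofReal_log hx.le]

/-- The substitution `x = sin² θ` in the Beta integral. -/
theorem integral_sin_cpow_mul_cos_pow_half {w : ℂ} (j : ℕ) :
    2 * ∫ θ in Ioo 0 (Real.pi / 2), (Real.sin θ : ℂ) ^ (w - 1) * (Real.cos θ : ℂ) ^ (2 * j) =
      Complex.betaIntegral (w / 2) (j + 1 / 2) := by
  have himg : (fun θ => Real.sin θ ^ 2) '' Ioo 0 (Real.pi / 2) = Ioo (0 : ℝ) 1 := by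
    ext x
    constructor
    · rintro ⟨θ, ⟨h0, h1⟩, rfl⟩
      have hs : 0 < Real.sin θ := Real.sin_pos_of_pos_of_lt_pi h0 (by linarith [Real.pi_pos])
      have hc : 0 < Real.cos θ := Real.cos_pos_of_mem_Ioo ⟨by linarith, h1⟩
      have := Real.sin_sq_add_cos_sq θ
      exact ⟨by positivity, by nlinarith⟩
    · rintro ⟨h0, h1⟩
      have hs0 : 0 < √x := Real.sqrt_pos.mpr h0
      have hs1 : √x < 1 := by rw [Real.sqrt_lt' one_pos]; simpa using h1
      refine ⟨Real.arcsin (√x), ⟨Real.arcsin_pos.mpr hs0, Real.arcsin_lt_pi_div_two.mpr hs1⟩, ?_⟩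
      change Real.sin _ ^ 2 = x
      rw [Real.sin_arcsin (by linarith) hs1.le, Real.sq_sqrt h0.le]
  have hinj : InjOn (fun θ => Real.sin θ ^ 2) (Ioo 0 (Real.pi / 2)) := by
    rintro a ⟨ha0, ha1⟩ b ⟨hb0, hb1⟩ h
    have hsa : 0 < Real.sin a := Real.sin_pos_of_pos_of_lt_pi ha0 (by linarith)
    have hsb : 0 < Real.sin b := Real.sin_pos_of_pos_of_lt_pi hb0 (by linarith)
    have := (pow_left_inj₀ hsa.le hsb.le two_ne_zero).mp h
    exact Real.injOn_sin ⟨by linarith, ha1.le⟩ ⟨by linarith, hb1.le⟩ this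
  rw [Complex.betaIntegral, intervalIntegral.integral_of_le zero_le_one,
    integral_Ioc_eq_integral_Ioo, ← himg,
    integral_image_eq_integral_abs_deriv_smul (f' := fun θ => 2 * Real.sin θ * Real.cos θ)
      measurableSet_Ioo _ hinj, ← integral_const_mul]
  · refine setIntegral_congr_fun measurableSet_Ioo ?_
    rintro θ ⟨h0, h1⟩
    have hs : 0 < Real.sin θ := Real.sin_pos_of_pos_of_lt_pi h0 (by linarith)
    have hc : 0 < Real.cos θ := Real.cos_pos_of_mem_Ioo ⟨by linarith, h1⟩
    have e1 : (1 - ((Real.sin θ ^ 2 : ℝ) : ℂ)) = ((Real.cos θ ^ 2 : ℝ) : ℂ) := by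
      rw [← Complex.ofReal_one, ← Complex.ofReal_sub]
      congr 1
      linarith [Real.sin_sq_add_cos_sq θ]
    have e2 : (Real.cos θ : ℂ) ^ (2 * j) = Complex.exp (Real.log (Real.cos θ) * (2 * j)) := by
      rw [← ofReal_cpow_eq_exp hc, ← Complex.cpow_natCast]; push_cast; rfl
    have e3 : (Real.cos θ : ℂ) = Complex.exp (Real.log (Real.cos θ)) := by
      rw [← Complex.ofReal_exp, Real.exp_log hc]
    have e4 : (Real.sin θ : ℂ) = Complex.exp (Real.log (Real.sin θ)) := by
      rw [← Complex.ofReal_exp, Real.exp_log hs]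
    beta_reduce
    rw [e1, ofReal_cpow_eq_exp (by positivity), ofReal_cpow_eq_exp (by positivity),
      ofReal_cpow_eq_exp (by positivity), e2, abs_of_pos (by positivity), Real.log_pow, Real.log_pow,
      Complex.real_smul]
    push_cast [e3, e4]
    simp only [mul_assoc, ← Complex.exp_add]
    congr 2
    ring
  · intro θ _
    have := ((Real.hasDerivAt_sin θ).fun_pow 2).hasDerivWithinAt (s := Ioo 0 (Real.pi / 2))
    simpa using this

theorem continuous_sin_cpow_mul_cos_pow {w : ℂ} (hw : 1 < w.re) (j : ℕ) :
    Continuous fun θ : ℝ => (Real.sin θ : ℂ) ^ (w - 1) * (Real.cos θ : ℂ) ^ (2 * j) := by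
  have h1 : Continuous fun x : ℝ => (x : ℂ) ^ (w - 1) :=
    Complex.continuous_ofReal_cpow_const (by simpa using hw)
  exact (h1.comp Real.continuous_sin).mul
    ((Complex.continuous_ofReal.comp Real.continuous_cos).pow _)

theorem integral_sin_cpow_mul_cos_pow {w : ℂ} (hw : 1 < w.re) (j : ℕ) :
    ∫ θ in Ioo 0 Real.pi, (Real.sin θ : ℂ) ^ (w - 1) * (Real.cos θ : ℂ) ^ (2 * j) =
      Complex.betaIntegral (w / 2) (j + 1 / 2) := by
  have hcont := continuous_sin_cpow_mul_cos_pow hw j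
  rw [← integral_sin_cpow_mul_cos_pow_half, ← integral_Ioc_eq_integral_Ioo,
    ← integral_Ioc_eq_integral_Ioo, ← intervalIntegral.integral_of_le Real.pi_pos.le,
    ← intervalIntegral.integral_of_le (by linarith [Real.pi_pos]),
    ← intervalIntegral.integral_add_adjacent_intervals (hcont.intervalIntegrable 0 (Real.pi / 2))
      (hcont.intervalIntegrable (Real.pi / 2) Real.pi)]
  refine Eq.trans ?_ (two_mul _).symm
  congr 1
  have h := intervalIntegral.integral_comp_sub_left (a := 0) (b := Real.pi / 2)
    (fun θ : ℝ => (Real.sin θ : ℂ) ^ (w - 1) * (Real.cos θ : ℂ) ^ (2 * j)) Real.pi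
  rw [show Real.pi - Real.pi / 2 = Real.pi / 2 by ring, sub_zero] at h
  rw [← h]
  congr 1
  ext θ
  rw [Real.sin_pi_sub, Real.cos_pi_sub]
  push_cast
  rw [Even.neg_pow (even_two_mul j)]

/-- The Chu–Vandermonde identity, as a formula for an iterated difference of a quotient of Gamma
functions. -/
theorem fwdDiff_iter_Gamma_div_Gamma {a c : ℂ} (ha : 0 < a.re) (hc : 0 < (c - a).re) (N : ℕ) :
    (fwdDiff 1)^[N] (fun k : ℕ => Complex.Gamma (a + k) / Complex.Gamma (c + k)) =
      fun k : ℕ => (-1) ^ N * Complex.Gamma (a + k) * Complex.Gamma (c - a + N) /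
        (Complex.Gamma (c + k + N) * Complex.Gamma (c - a)) := by
  have hca : Complex.Gamma (c - a) ≠ 0 := Complex.Gamma_ne_zero_of_re_pos hc
  have hcre : 0 < c.re := by
    have : c.re = (c - a).re + a.re := by simp
    rw [this]; positivity
  induction N with
  | zero =>
    ext k
    simp only [Function.iterate_zero, id, Nat.cast_zero, add_zero, pow_zero, one_mul]
    rw [mul_div_mul_right _ _ hca]
  | succ N ih =>
    rw [Function.iterate_succ_apply', ih]
    ext k
    have pos : ∀ (z : ℂ) (l : ℕ), 0 < z.re → z + l ≠ 0 ∧ Complex.Gamma (z + l) ≠ 0 := by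
      intro z l hz
      have h : 0 < (z + l).re := by simp; positivity
      exact ⟨fun h0 => by simp [h0] at h, Complex.Gamma_ne_zero_of_re_pos h⟩
    have g1 : Complex.Gamma (a + (k + 1 : ℕ)) = (a + k) * Complex.Gamma (a + k) := by
      rw [← Complex.Gamma_add_one _ (pos a k ha).1]; push_cast; ring_nf
    have g2 : Complex.Gamma (c - a + (N + 1 : ℕ)) =
        (c - a + N) * Complex.Gamma (c - a + N) := by
      rw [← Complex.Gamma_add_one _ (pos _ N hc).1]; push_cast; ring_nf
    have e3 : c + k + N = c + (k + N : ℕ) := by push_cast; ring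
    have g3 : Complex.Gamma (c + k + (N + 1 : ℕ)) =
        (c + k + N) * Complex.Gamma (c + k + N) := by
      rw [e3, ← Complex.Gamma_add_one _ (pos c (k + N) hcre).1]; push_cast; ring_nf
    have g4 : c + (k + 1 : ℕ) + N = c + k + (N + 1 : ℕ) := by push_cast; ring
    have n1 := (pos c (k + N) hcre).1
    have n2 := (pos c (k + N) hcre).2
    rw [← e3] at n1 n2
    simp only [fwdDiff]
    rw [g4, g1, g2, g3]
    field_simp
    ring

/-- The Chu–Vandermonde identity in the form in which it sums the terms of one degree in a product of
two power series. -/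
theorem sum_antidiagonal_Gamma_div_Gamma {a c : ℂ} (ha : 0 < a.re) (hc : 0 < (c - a).re) (N : ℕ) :
    ∑ p ∈ Finset.HasAntidiagonal.antidiagonal N, (-1 : ℂ) ^ p.2 / ((p.1.factorial : ℂ) * p.2.factorial) *
        (Complex.Gamma (a + p.1) / Complex.Gamma (c + p.1)) =
      (-1) ^ N / N.factorial * (Complex.Gamma a * Complex.Gamma (c - a + N) /
        (Complex.Gamma (c + N) * Complex.Gamma (c - a))) := by
  have h := congrFun (fwdDiff_iter_Gamma_div_Gamma ha hc N) 0
  rw [fwdDiff_iter_eq_sum_shift] at h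
  rw [Finset.Nat.sum_antidiagonal_eq_sum_range_succ (fun k j => (-1 : ℂ) ^ j /
    ((k.factorial : ℂ) * j.factorial) * (Complex.Gamma (a + k) / Complex.Gamma (c + k)))]
  simp only [Nat.cast_zero, add_zero, zero_add, smul_eq_mul, mul_one] at h
  have hN : (N.factorial : ℂ) ≠ 0 := by exact_mod_cast N.factorial_ne_zero
  calc _ = (1 / (N.factorial : ℂ)) * ∑ k ∈ Finset.range (N + 1), ((-1 : ℤ) ^ (N - k) * (N.choose k : ℤ)) •
        (Complex.Gamma (a + k) / Complex.Gamma (c + k)) := by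
        rw [Finset.mul_sum]
        refine Finset.sum_congr rfl fun k hk => ?_
        have hk' : k ≤ N := Nat.lt_succ_iff.mp (Finset.mem_range.mp hk)
        rw [zsmul_eq_mul]
        push_cast
        rw [Nat.cast_choose ℂ hk']
        field_simp
    _ = _ := by
        rw [h]; ring

/-- `Γ(j + 1/2) = (2j)! √π / (4^j j!)`. -/
theorem Gamma_natCast_add_half (j : ℕ) :
    Complex.Gamma (j + 1 / 2) * (4 ^ j * j.factorial) =
      ((2 * j).factorial : ℂ) * (√Real.pi : ℝ) := by
  induction j with
  | zero =>
    simp only [Nat.cast_zero, zero_add, pow_zero, Nat.factorial_zero, Nat.cast_one, mul_one,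
      mul_zero, one_mul]
    rw [Complex.Gamma_one_half_eq, Real.sqrt_eq_rpow, Complex.ofReal_cpow Real.pi_pos.le]
    norm_num
  | succ j ih =>
    have hne : (j + 1 / 2 : ℂ) ≠ 0 := by
      have h : (((j : ℝ) + 1 / 2 : ℝ) : ℂ) ≠ 0 := Complex.ofReal_ne_zero.mpr (by positivity)
      push_cast at h
      exact h
    have e : ((j + 1 : ℕ) : ℂ) + 1 / 2 = (j + 1 / 2) + 1 := by push_cast; ring
    rw [e, Complex.Gamma_add_one _ hne, Nat.factorial_succ,
      show 2 * (j + 1) = (2 * j + 1) + 1 by ring, Nat.factorial_succ, Nat.factorial_succ]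
    push_cast
    linear_combination (2 * (j : ℂ) + 1) * (2 * j + 2) * ih

/-! ### The function `φ_{m,s}` -/

/-- The coefficients of the expansion `φ_{m,s}(y) = ∑ A_k y^{s + 2k}`. -/
def phiCoeff (m : ℕ) (s : ℂ) (k : ℕ) : ℂ :=
  if m = 0 then (if k = 0 then 1 else 0)
  else 2 * Real.pi * (Real.sqrt m : ℂ) * ((Real.pi * m : ℝ) : ℂ) ^ (s - 1 / 2) *
    (1 / ((k.factorial : ℂ) * Complex.Gamma (s - 1 / 2 + k + 1)) *
      ((Real.pi * m : ℝ) : ℂ) ^ (2 * k))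

theorem norm_Gamma_le_norm_Gamma_add_nat {z : ℂ} (hz : 1 ≤ z.re) (k : ℕ) :
    ‖Complex.Gamma z‖ ≤ ‖Complex.Gamma (z + k)‖ := by
  induction k with
  | zero => simp
  | succ k ih =>
    have hre : 1 ≤ (z + k).re := by
      have : (0 : ℝ) ≤ k := Nat.cast_nonneg k
      simp; linarith
    have hne : z + k ≠ 0 := fun h => by rw [h] at hre; norm_num at hre
    push_cast
    rw [← add_assoc, Complex.Gamma_add_one _ hne, norm_mul]
    have h1 : 1 ≤ ‖z + k‖ := hre.trans (Complex.re_le_norm _)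
    calc _ ≤ ‖Complex.Gamma (z + k)‖ := ih
      _ ≤ _ := le_mul_of_one_le_left (norm_nonneg _) h1

/-- The Bessel series converge absolutely for `Re ν > -1`, here with `Re ν ≥ 0`. -/
theorem summable_norm_bessel {ν : ℂ} (hν : 0 ≤ ν.re) (x : ℝ) :
    Summable fun k : ℕ => ‖(1 / ((k.factorial : ℂ) * Complex.Gamma (ν + k + 1)) *
      (x : ℂ) ^ (2 * k))‖ := by
  have h1 := (Real.summable_pow_div_factorial (x ^ 2)).mul_left (‖Complex.Gamma (ν + 1)‖⁻¹)
  refine Summable.of_nonneg_of_le (fun _ => norm_nonneg _) (fun k => ?_) h1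
  have hG : 0 < ‖Complex.Gamma (ν + 1)‖ :=
    norm_pos_iff.mpr (Complex.Gamma_ne_zero_of_re_pos (by simp; linarith))
  have h2 := norm_Gamma_le_norm_Gamma_add_nat (z := ν + 1) (by simp; linarith) k
  rw [show ν + 1 + k = ν + k + 1 by ring] at h2
  rw [norm_mul, norm_div, norm_mul, norm_one, norm_pow, Complex.norm_real, pow_mul,
    Real.norm_eq_abs, sq_abs, Complex.norm_natCast]
  have hf : (0 : ℝ) < k.factorial := by exact_mod_cast k.factorial_pos
  calc 1 / ((k.factorial : ℝ) * ‖Complex.Gamma (ν + k + 1)‖) * (x ^ 2) ^ k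
      ≤ 1 / ((k.factorial : ℝ) * ‖Complex.Gamma (ν + 1)‖) * (x ^ 2) ^ k := by gcongr
    _ = _ := by field_simp

theorem summable_norm_phiCoeff (m : ℕ) {s : ℂ} (hs : 1 < s.re) (y : ℝ) :
    Summable fun k : ℕ => ‖phiCoeff m s k * (y : ℂ) ^ (2 * k)‖ := by
  by_cases hm : m = 0
  · refine summable_of_ne_finset_zero (s := {0}) fun k hk => ?_
    have : k ≠ 0 := by simpa using hk
    simp [phiCoeff, hm, this]
  · have h := (summable_norm_bessel (ν := s - 1 / 2) (by simp; linarith) (Real.pi * m * y)).mul_left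
      ‖2 * Real.pi * (Real.sqrt m : ℂ) * ((Real.pi * m : ℝ) : ℂ) ^ (s - 1 / 2)‖
    refine h.congr fun k => ?_
    rw [← norm_mul]
    congr 1
    simp only [phiCoeff, hm, if_false]
    push_cast
    ring

theorem phi_eq_tsum (m : ℕ) (s : ℂ) {y : ℝ} (hy : 0 < y) :
    phi m s y = (y : ℂ) ^ s * ∑' k : ℕ, phiCoeff m s k * (y : ℂ) ^ (2 * k) := by
  by_cases hm : m = 0
  · have : ∑' k : ℕ, phiCoeff m s k * (y : ℂ) ^ (2 * k) = 1 := by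
      rw [tsum_eq_single 0 fun k hk => by simp [phiCoeff, hm, hk]]
      simp [phiCoeff, hm]
    rw [this]
    simp [phi, hm]
  · have hm' : (0 : ℝ) < m := by exact_mod_cast Nat.pos_of_ne_zero hm
    have e0 : ((2 * Real.pi * m * y : ℝ) : ℂ) / 2 = ((Real.pi * m : ℝ) : ℂ) * (y : ℝ) := by
      push_cast; ring
    have e1 : (Real.sqrt y : ℂ) * (y : ℂ) ^ (s - 1 / 2) = (y : ℂ) ^ s := by
      rw [Real.sqrt_eq_rpow, Complex.ofReal_cpow hy.le,
        ← Complex.cpow_add _ _ (by exact_mod_cast hy.ne')]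
      congr 1; push_cast; ring
    simp only [phi, besselI, phiCoeff, hm, if_false]
    rw [e0, Complex.mul_cpow_ofReal_nonneg (by positivity) hy.le, ← e1, ← tsum_mul_left,
      ← tsum_mul_left, ← tsum_mul_left]
    congr 1
    ext k
    rw [mul_pow]
    ring

/-- `φ_{m,s}(y) = O(y^{Re s})`, uniformly for `0 < y ≤ Y`. -/
theorem norm_phi_le (m : ℕ) {s : ℂ} (hs : 1 < s.re) (Y : ℝ) :
    ∃ K : ℝ, 0 ≤ K ∧ ∀ y : ℝ, 0 < y → y ≤ Y → ‖phi m s y‖ ≤ K * y ^ s.re := by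
  refine ⟨∑' k : ℕ, ‖phiCoeff m s k * (Y : ℂ) ^ (2 * k)‖, tsum_nonneg fun _ => norm_nonneg _,
    fun y hy hyY => ?_⟩
  rw [phi_eq_tsum m s hy, norm_mul, Complex.norm_cpow_eq_rpow_re_of_pos hy, mul_comm]
  gcongr
  refine (norm_tsum_le_tsum_norm (summable_norm_phiCoeff m hs y)).trans ?_
  refine (summable_norm_phiCoeff m hs y).tsum_le_tsum (fun k => ?_) (summable_norm_phiCoeff m hs Y)
  rw [norm_mul, norm_mul, norm_pow, norm_pow, Complex.norm_real, Complex.norm_real,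
    Real.norm_of_nonneg hy.le, Real.norm_of_nonneg (hy.le.trans hyY)]
  gcongr

theorem continuousOn_phi (m : ℕ) {s : ℂ} (hs : 1 < s.re) : ContinuousOn (phi m s) (Ioi 0) := by
  intro y0 hy0
  have hy0' : (0 : ℝ) < y0 := hy0
  have h1 : ContinuousOn (fun y : ℝ => ∑' k : ℕ, phiCoeff m s k * (y : ℂ) ^ (2 * k))
      (Ioo 0 (y0 + 1)) := by
    refine continuousOn_tsum (fun k => ?_) (summable_norm_phiCoeff m hs (y0 + 1)) ?_
    · exact (continuous_const.mul (Complex.continuous_ofReal.pow _)).continuousOn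
    · rintro k y ⟨h0, h1⟩
      rw [norm_mul, norm_mul, norm_pow, norm_pow, Complex.norm_real, Complex.norm_real,
        Real.norm_of_nonneg h0.le, Real.norm_of_nonneg (h0.le.trans h1.le)]
      gcongr
  have h2 : Continuous fun y : ℝ => (y : ℂ) ^ s :=
    Complex.continuous_ofReal_cpow_const (by linarith)
  have h3 : ContinuousOn (phi m s) (Ioo 0 (y0 + 1)) :=
    (h2.continuousOn.mul h1).congr fun y hy => phi_eq_tsum m s hy.1
  exact (h3.continuousAt (Ioo_mem_nhds hy0' (by linarith))).continuousWithinAt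

/-! ### The integral over a semicircle centred at the origin -/

/-- The integral of `e(-m Re τ) φ_{m,s}(Im τ)` against hyperbolic arc length along the semicircle
of radius `r` centred at the origin. -/
def angularIntegral (m : ℕ) (s : ℂ) (r : ℝ) : ℂ :=
  ∫ θ in Ioo 0 Real.pi, expTwoPiI (-(m : ℝ) * (r * Real.cos θ)) * phi m s (r * Real.sin θ) /
    (Real.sin θ : ℂ)

theorem norm_expTwoPiI (x : ℝ) : ‖expTwoPiI x‖ = 1 := by
  rw [expTwoPiI, show 2 * (Real.pi : ℂ) * Complex.I * x = ((2 * Real.pi * x : ℝ) : ℂ) * Complex.I by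
    push_cast; ring, Complex.norm_exp_ofReal_mul_I]

theorem continuous_expTwoPiI : Continuous expTwoPiI := by
  unfold expTwoPiI
  fun_prop

/-- Since `Re s > 1`, the factor `sin θ ^ (Re s)` from `φ_{m,s}` absorbs the pole of the arc length
`dθ / sin θ` at the cusps. -/
theorem norm_angular_integrand_le (m : ℕ) {s : ℂ} (hs : 1 < s.re) (Y : ℝ) :
    ∃ K : ℝ, 0 ≤ K ∧ ∀ r : ℝ, 0 < r → r ≤ Y → ∀ θ ∈ Ioo 0 Real.pi,
      ‖phi m s (r * Real.sin θ) / (Real.sin θ : ℂ)‖ ≤ K * r ^ s.re := by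
  obtain ⟨K, hK, h⟩ := norm_phi_le m hs Y
  refine ⟨K, hK, fun r hr hrY θ hθ => ?_⟩
  have hsin : 0 < Real.sin θ := Real.sin_pos_of_mem_Ioo hθ
  have h1 := h (r * Real.sin θ) (by positivity)
    ((mul_le_of_le_one_right hr.le (Real.sin_le_one θ)).trans hrY)
  rw [norm_div, Complex.norm_real, Real.norm_of_nonneg hsin.le, div_le_iff₀ hsin]
  refine h1.trans ?_
  rw [Real.mul_rpow hr.le hsin.le, mul_assoc]
  gcongr
  calc Real.sin θ ^ s.re ≤ Real.sin θ ^ (1 : ℝ) :=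
        Real.rpow_le_rpow_of_exponent_ge hsin (Real.sin_le_one θ) hs.le
    _ = Real.sin θ := Real.rpow_one _

theorem integrableOn_angular (m : ℕ) {s : ℂ} (hs : 1 < s.re) {r : ℝ} (hr : 0 < r) (t : ℝ) :
    IntegrableOn (fun θ => expTwoPiI (t * (r * Real.cos θ)) * phi m s (r * Real.sin θ) /
      (Real.sin θ : ℂ)) (Ioo 0 Real.pi) := by
  obtain ⟨K, -, hK⟩ := norm_angular_integrand_le m hs r
  refine IntegrableOn.of_bound (by simp) ?_ (K * r ^ s.re) ?_
  · refine ContinuousOn.aestronglyMeasurable ?_ measurableSet_Ioo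
    refine ContinuousOn.div (ContinuousOn.mul ?_ ?_) ?_ ?_
    · exact (continuous_expTwoPiI.comp (by fun_prop)).continuousOn
    · exact (continuousOn_phi m hs).comp (by fun_prop)
        fun θ hθ => mul_pos hr (Real.sin_pos_of_mem_Ioo hθ)
    · exact (Complex.continuous_ofReal.comp Real.continuous_sin).continuousOn
    · intro θ hθ
      exact_mod_cast (Real.sin_pos_of_mem_Ioo hθ).ne'
  · refine (ae_restrict_iff' measurableSet_Ioo).mpr (Eventually.of_forall fun θ hθ => ?_)
    rw [mul_div_assoc, norm_mul, norm_expTwoPiI, one_mul]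
    exact hK r hr le_rfl θ hθ

theorem integral_Ioo_pi_comp_sub (g : ℝ → ℂ) :
    ∫ θ in Ioo 0 Real.pi, g (Real.pi - θ) = ∫ θ in Ioo 0 Real.pi, g θ := by
  rw [← integral_Ioc_eq_integral_Ioo, ← integral_Ioc_eq_integral_Ioo,
    ← intervalIntegral.integral_of_le Real.pi_pos.le,
    ← intervalIntegral.integral_of_le Real.pi_pos.le, intervalIntegral.integral_comp_sub_left]
  simp

/-- The reflection `θ ↦ π - θ` changes the sign of the frequency: the integral does not depend on the
orientation of the semicircle. -/
theorem angularIntegral_eq_pos (m : ℕ) (s : ℂ) (r : ℝ) :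
    ∫ θ in Ioo 0 Real.pi, expTwoPiI ((m : ℝ) * (r * Real.cos θ)) * phi m s (r * Real.sin θ) /
      (Real.sin θ : ℂ) = angularIntegral m s r := by
  rw [angularIntegral, ← integral_Ioo_pi_comp_sub]
  congr 1
  ext θ
  rw [Real.cos_pi_sub, Real.sin_pi_sub]
  congr 3
  ring

theorem angularIntegral_eq_cos (m : ℕ) {s : ℂ} (hs : 1 < s.re) {r : ℝ} (hr : 0 < r) :
    angularIntegral m s r = ∫ θ in Ioo 0 Real.pi,
      Complex.cos ((2 * Real.pi * m * r : ℝ) * Real.cos θ) *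
        (phi m s (r * Real.sin θ) / (Real.sin θ : ℂ)) := by
  have h1 := integrableOn_angular m hs hr (m : ℝ)
  have h2 := integrableOn_angular m hs hr (-(m : ℝ))
  have e := integral_add h1 h2
  rw [angularIntegral_eq_pos, ← angularIntegral, ← two_mul] at e
  refine mul_left_cancel₀ (two_ne_zero' ℂ) ?_
  rw [← e, ← integral_const_mul]
  congr 1
  ext θ
  rw [← mul_assoc (2 : ℂ), Complex.two_cos, mul_div_assoc, mul_div_assoc, ← add_mul]
  congr 1
  simp only [expTwoPiI]
  congr 2 <;> push_cast <;> ring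

/-- Expansion of the integral over the semicircle as an absolutely convergent double series. -/
theorem hasSum_angularIntegral (m : ℕ) {s : ℂ} (hs : 1 < s.re) {r : ℝ} (hr : 0 < r) :
    HasSum (fun p : ℕ × ℕ => (r : ℂ) ^ s * (phiCoeff m s p.1 * (r : ℂ) ^ (2 * p.1)) *
        ((-1) ^ p.2 * ((2 * Real.pi * m * r : ℝ) : ℂ) ^ (2 * p.2) / (2 * p.2).factorial) *
        Complex.betaIntegral (s / 2 + p.1) (p.2 + 1 / 2)) (angularIntegral m s r) := by
  set u : ℝ := 2 * Real.pi * m * r with hu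
  have hw : ∀ k : ℕ, 1 < (s + 2 * k).re := by
    intro k
    have : (0 : ℝ) ≤ k := Nat.cast_nonneg k
    simp; linarith
  -- the product of the `p.1`-th term of `φ_{m,s}` and the `p.2`-th term of the cosine series
  let F : ℕ × ℕ → ℝ → ℂ := fun p θ =>
    ((r : ℂ) ^ s * (phiCoeff m s p.1 * (r : ℂ) ^ (2 * p.1)) *
      ((-1) ^ p.2 * (u : ℂ) ^ (2 * p.2) / (2 * p.2).factorial)) *
      ((Real.sin θ : ℂ) ^ (s + 2 * p.1 - 1) * (Real.cos θ : ℂ) ^ (2 * p.2))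
  have hsinpow : ∀ (k : ℕ) (θ : ℝ), θ ∈ Ioo 0 Real.pi → (Real.sin θ : ℂ) ^ (s + 2 * k - 1) =
      (Real.sin θ : ℂ) ^ s / Real.sin θ * (Real.sin θ : ℂ) ^ (2 * k) := by
    intro k θ hθ
    have hsin : (Real.sin θ : ℂ) ≠ 0 := by exact_mod_cast (Real.sin_pos_of_mem_Ioo hθ).ne'
    rw [show s + 2 * k - 1 = s - 1 + ((2 * k : ℕ) : ℂ) by push_cast; ring,
      Complex.cpow_add _ _ hsin, Complex.cpow_natCast, Complex.cpow_sub _ _ hsin, Complex.cpow_one]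
  have hint : ∀ p, Integrable (F p) (volume.restrict (Ioo 0 Real.pi)) := by
    intro p
    have : Continuous (F p) := continuous_const.mul (continuous_sin_cpow_mul_cos_pow (hw p.1) p.2)
    exact (this.integrableOn_Icc (a := 0) (b := Real.pi)).mono_set Ioo_subset_Icc_self
  have hsA := summable_norm_phiCoeff m hs r
  have hsC : Summable fun j : ℕ => ‖((-1) ^ j * (u : ℂ) ^ (2 * j) / ((2 * j).factorial : ℂ))‖ :=
    (Complex.hasSum_cos (u : ℂ)).summable.norm
  have hsum : Summable fun p => ∫ θ in Ioo 0 Real.pi, ‖F p θ‖ := by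
    have h1 : Summable fun p : ℕ × ℕ => ‖(r : ℂ) ^ s‖ * (‖phiCoeff m s p.1 * (r : ℂ) ^ (2 * p.1)‖ *
        ‖((-1) ^ p.2 * (u : ℂ) ^ (2 * p.2) / ((2 * p.2).factorial : ℂ))‖) * Real.pi :=
      ((hsA.mul_of_nonneg hsC (fun _ => norm_nonneg _) (fun _ => norm_nonneg _)).mul_left _).mul_right _
    refine Summable.of_nonneg_of_le (fun p => integral_nonneg fun _ => norm_nonneg _)
      (fun p => ?_) h1
    have hbd : ∀ θ ∈ Ioo 0 Real.pi, ‖(‖F p θ‖)‖ ≤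
        ‖(r : ℂ) ^ s‖ * (‖phiCoeff m s p.1 * (r : ℂ) ^ (2 * p.1)‖ *
        ‖((-1) ^ p.2 * (u : ℂ) ^ (2 * p.2) / ((2 * p.2).factorial : ℂ))‖) := by
      intro θ hθ
      have hsin := Real.sin_pos_of_mem_Ioo hθ
      rw [norm_norm, norm_mul, norm_mul, norm_mul, mul_assoc ‖(r : ℂ) ^ s‖]
      refine mul_le_of_le_one_right (by positivity) ?_
      rw [norm_mul, Complex.norm_cpow_eq_rpow_re_of_pos hsin, norm_pow, Complex.norm_real,
        Real.norm_eq_abs]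
      refine mul_le_one₀ ?_ (by positivity) ?_
      · refine Real.rpow_le_one hsin.le (Real.sin_le_one θ) ?_
        have := hw p.1
        rw [Complex.sub_re, Complex.one_re]
        linarith
      · exact pow_le_one₀ (abs_nonneg _) (Real.abs_cos_le_one θ)
    have h2 := norm_setIntegral_le_of_norm_le_const (μ := volume) (by simp) hbd
    refine (le_abs_self _).trans (h2.trans_eq ?_)
    simp [Real.pi_pos.le]
  have key := hasSum_integral_of_summable_integral_norm hint hsum
  have e1 : (∫ θ in Ioo 0 Real.pi, ∑' p, F p θ) = angularIntegral m s r := by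
    rw [angularIntegral_eq_cos m hs hr]
    refine setIntegral_congr_fun measurableSet_Ioo fun θ hθ => ?_
    have hsin := Real.sin_pos_of_mem_Ioo hθ
    have hcos := Complex.hasSum_cos ((u : ℂ) * Real.cos θ)
    change ∑' p, F p θ = _
    rw [phi_eq_tsum m s (by positivity : 0 < r * Real.sin θ), ← hcos.tsum_eq]
    have t := tsum_mul_tsum_of_summable_norm (summable_norm_phiCoeff m hs (r * Real.sin θ))
      hcos.summable.norm
    rw [mul_comm, mul_div_right_comm, mul_assoc, t, ← tsum_mul_left]
    congr 1
    ext p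
    simp only [F]
    rw [hsinpow p.1 θ hθ]
    push_cast
    rw [← Complex.ofReal_sin, Complex.mul_cpow_ofReal_nonneg hr.le hsin.le, mul_pow, mul_pow]
    ring
  rw [e1] at key
  refine Eq.subst (motive := fun f => HasSum f _) (funext fun p => ?_) key
  change ∫ θ in Ioo 0 Real.pi, _ * _ = _
  rw [integral_const_mul, integral_sin_cpow_mul_cos_pow (hw p.1)]
  congr 2
  ring

theorem B_ne_zero {s : ℂ} (hs : 1 < s.re) : B s ≠ 0 := by
  have h1 : Complex.Gamma (s / 2) ≠ 0 := Complex.Gamma_ne_zero_of_re_pos (by simp; linarith)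
  have h2 : Complex.Gamma s ≠ 0 := Complex.Gamma_ne_zero_of_re_pos (by linarith)
  have h3 : (2 : ℂ) ^ s ≠ 0 := by simp [Complex.cpow_eq_zero_iff]
  unfold B
  positivity

/-- The constant `B(s)` comes from Legendre's duplication formula. -/
theorem sqrt_pi_mul_Gamma_div {s : ℂ} (hs : 1 < s.re) :
    (√Real.pi : ℝ) * Complex.Gamma (s / 2) / Complex.Gamma (s / 2 + 1 / 2) = B s / 2 := by
  have h1 : Complex.Gamma (s / 2 + 1 / 2) ≠ 0 :=
    Complex.Gamma_ne_zero_of_re_pos (by simp; linarith)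
  have h2 : Complex.Gamma s ≠ 0 := Complex.Gamma_ne_zero_of_re_pos (by linarith)
  have h := Complex.Gamma_mul_Gamma_add_half (s / 2)
  rw [show 2 * (s / 2) = s by ring] at h
  have h3 : (2 : ℂ) ^ s * 2 ^ (1 - s) = 2 := by
    rw [← Complex.cpow_add _ _ two_ne_zero]; simp
  unfold B
  generalize Complex.Gamma (s / 2 + 1 / 2) = G at h h1 ⊢
  field_simp
  linear_combination (-(2 : ℂ) ^ s * Complex.Gamma (s / 2)) * h -
    Complex.Gamma (s / 2) * Complex.Gamma s * (√Real.pi : ℝ) * h3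

/-- For `m = 0` only the term `(0, 0)` of the double series is non-zero. -/
theorem angularIntegral_zero {s : ℂ} (hs : 1 < s.re) {r : ℝ} (hr : 0 < r) :
    angularIntegral 0 s r = B s / 2 * (r : ℂ) ^ s := by
  have h := hasSum_angularIntegral 0 hs hr
  have h0 := hasSum_single (f := fun p : ℕ × ℕ =>
    (r : ℂ) ^ s * (phiCoeff 0 s p.1 * (r : ℂ) ^ (2 * p.1)) *
        ((-1) ^ p.2 * ((2 * Real.pi * (0 : ℕ) * r : ℝ) : ℂ) ^ (2 * p.2) / (2 * p.2).factorial) *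
        Complex.betaIntegral (s / 2 + p.1) (p.2 + 1 / 2)) (0, 0) (by
      rintro ⟨k, j⟩ hkj
      by_cases hk : k = 0
      · have hj : j ≠ 0 := by rintro rfl; exact hkj (by rw [hk])
        simp [hj]
      · simp [phiCoeff, hk])
  rw [h.unique h0]
  have hβ := Complex.Gamma_mul_Gamma_eq_betaIntegral (s := s / 2) (t := 1 / 2)
    (by simp; linarith) (by norm_num)
  have hG : Complex.Gamma (s / 2 + 1 / 2) ≠ 0 :=
    Complex.Gamma_ne_zero_of_re_pos (by simp; linarith)
  have hh := Gamma_natCast_add_half 0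
  simp only [Nat.cast_zero, zero_add, pow_zero, Nat.factorial_zero, Nat.cast_one, mul_one,
      mul_zero, one_mul] at hh
  rw [← sqrt_pi_mul_Gamma_div hs, ← hh, mul_comm (Complex.Gamma (1 / 2)), hβ]
  generalize Complex.Gamma (s / 2 + 1 / 2) = G at hG ⊢
  simp [phiCoeff]
  field_simp

/-- For `m > 0` the integral is a `J`-Bessel function: in the double series the terms of a given
degree in `r` are summed by the Chu–Vandermonde identity. -/
theorem angularIntegral_pos {m : ℕ} (hm : 0 < m) {s : ℂ} (hs : 1 < s.re) {r : ℝ} (hr : 0 < r) :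
    angularIntegral m s r = B s / 2 * (2 * Real.pi * (√m : ℝ) * (√r : ℝ)) *
      besselJ (s - 1 / 2) ((2 * Real.pi * m * r : ℝ) : ℂ) := by
  have h := hasSum_angularIntegral m hs hr
  have hm' : (0 : ℝ) < m := by exact_mod_cast hm
  have h' := (Finset.HasAntidiagonal.sigmaAntidiagonalEquivProd (A := ℕ)).hasSum_iff.mpr h
  have h'' := h'.sigma fun N => hasSum_fintype _
  have hx : ((2 * Real.pi * m * r : ℝ) : ℂ) / 2 = ((Real.pi * m : ℝ) : ℂ) * (r : ℝ) := by
    push_cast; ring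
  have e1 : (√r : ℂ) * (r : ℂ) ^ (s - 1 / 2) = (r : ℂ) ^ s := by
    rw [Real.sqrt_eq_rpow, Complex.ofReal_cpow hr.le,
      ← Complex.cpow_add _ _ (by exact_mod_cast hr.ne')]
    congr 1; push_cast; ring
  rw [← h''.tsum_eq, besselJ, hx, Complex.mul_cpow_ofReal_nonneg (by positivity) hr.le,
    ← mul_assoc, ← tsum_mul_left]
  congr 1
  ext N
  -- the terms of degree `s + 2N` in `r`
  have hcv := sum_antidiagonal_Gamma_div_Gamma (a := s / 2) (c := s + 1 / 2)
    (by simp; linarith) (by simp; linarith) N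
  have hG : ∀ N : ℕ, Complex.Gamma (s / 2 + 1 / 2 + N) ≠ 0 := fun N =>
    Complex.Gamma_ne_zero_of_re_pos (by
      have : (0 : ℝ) ≤ N := Nat.cast_nonneg N
      simp; linarith)
  have hG0 := hG 0
  rw [Nat.cast_zero, add_zero] at hG0
  rw [show s + 1 / 2 - s / 2 = s / 2 + 1 / 2 by ring] at hcv
  set C : ℂ := 2 * Real.pi * (√m : ℂ) * ((Real.pi * m : ℝ) : ℂ) ^ (s - 1 / 2) * (r : ℂ) ^ s *
    (√Real.pi : ℝ) * (((Real.pi * m : ℝ) : ℂ) * r) ^ (2 * N) / Complex.Gamma (s / 2 + 1 / 2 + N)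
    with hC
  have hterm : ∀ p ∈ Finset.HasAntidiagonal.antidiagonal N,
      (r : ℂ) ^ s * (phiCoeff m s p.1 * (r : ℂ) ^ (2 * p.1)) *
        ((-1) ^ p.2 * ((2 * Real.pi * m * r : ℝ) : ℂ) ^ (2 * p.2) / (2 * p.2).factorial) *
        Complex.betaIntegral (s / 2 + p.1) (p.2 + 1 / 2) =
      C * ((-1 : ℂ) ^ p.2 / ((p.1.factorial : ℂ) * p.2.factorial) *
        (Complex.Gamma (s / 2 + p.1) / Complex.Gamma (s + 1 / 2 + p.1))) := by
    rintro ⟨k, j⟩ hp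
    have hN : k + j = N := Finset.HasAntidiagonal.mem_antidiagonal.mp hp
    have hβ := Complex.Gamma_mul_Gamma_eq_betaIntegral (s := s / 2 + k) (t := j + 1 / 2)
      (by have : (0 : ℝ) ≤ k := Nat.cast_nonneg k
          simp; linarith) (by have : (0 : ℝ) ≤ j := Nat.cast_nonneg j
                              simp; linarith)
    have eN : s / 2 + k + (j + 1 / 2) = s / 2 + 1 / 2 + N := by rw [← hN]; push_cast; ring
    rw [eN] at hβ
    have hβ' : Complex.betaIntegral (s / 2 + k) (j + 1 / 2) = Complex.Gamma (s / 2 + k) *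
        Complex.Gamma (j + 1 / 2) / Complex.Gamma (s / 2 + 1 / 2 + N) := by
      rw [eq_div_iff (hG N), hβ]; ring
    have hj := Gamma_natCast_add_half j
    have hfj : (j.factorial : ℂ) ≠ 0 := by exact_mod_cast j.factorial_ne_zero
    have hf2j : ((2 * j).factorial : ℂ) ≠ 0 := by exact_mod_cast (2 * j).factorial_ne_zero
    have hj' : Complex.Gamma (j + 1 / 2) =
        ((2 * j).factorial : ℂ) * (√Real.pi : ℝ) / (4 ^ j * j.factorial) := by
      rw [← hj]; field_simp
    have ex : ((2 * Real.pi * m * r : ℝ) : ℂ) ^ (2 * j) =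
        4 ^ j * (((Real.pi * m : ℝ) : ℂ) * r) ^ (2 * j) := by
      rw [show ((2 * Real.pi * m * r : ℝ) : ℂ) = 2 * (((Real.pi * m : ℝ) : ℂ) * r) by
        push_cast; ring, mul_pow, pow_mul 2]
      norm_num
    simp only [phiCoeff, hm.ne', if_false]
    rw [hβ', hj', hC, ex, ← hN, show s - 1 / 2 + k + 1 = s + 1 / 2 + k by ring, mul_add 2 k j,
      pow_add, mul_pow _ (r : ℂ) (2 * k)]
    have h4 : (4 : ℂ) ^ j * (4 ^ j)⁻¹ = 1 := mul_inv_cancel₀ (by simp)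
    have h2j := mul_inv_cancel₀ hf2j
    -- apart from the two cancellations in `hone` the identity holds in a commutative ring
    generalize (4 : ℂ) ^ j = F at h4 ⊢
    generalize ((2 * j).factorial : ℂ) = f2 at h2j ⊢
    generalize ((Real.pi * m : ℝ) : ℂ) ^ (s - 1 / 2) = x1
    generalize (((Real.pi * m : ℝ) : ℂ) * r) ^ (2 * j) = x2
    generalize ((Real.pi * m : ℝ) : ℂ) ^ (2 * k) = x3
    have hone : ∀ Y : ℂ, F * F⁻¹ * (f2 * f2⁻¹) * Y = Y := fun Y => by
      rw [h4, h2j, one_mul, one_mul]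
    refine Eq.trans ?_ (hone _)
    ring
  have hsumF : ∑ p : Finset.HasAntidiagonal.antidiagonal N,
      (r : ℂ) ^ s * (phiCoeff m s p.1.1 * (r : ℂ) ^ (2 * p.1.1)) *
        ((-1) ^ p.1.2 * ((2 * Real.pi * m * r : ℝ) : ℂ) ^ (2 * p.1.2) / (2 * p.1.2).factorial) *
        Complex.betaIntegral (s / 2 + p.1.1) (p.1.2 + 1 / 2) =
      C * ((-1) ^ N / N.factorial * (Complex.Gamma (s / 2) * Complex.Gamma (s / 2 + 1 / 2 + N) /
        (Complex.Gamma (s + 1 / 2 + N) * Complex.Gamma (s / 2 + 1 / 2)))) := by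
    rw [← hcv, Finset.mul_sum, ← Finset.sum_congr rfl hterm]
    exact Finset.sum_coe_sort (Finset.HasAntidiagonal.antidiagonal N) fun p : ℕ × ℕ =>
      (r : ℂ) ^ s * (phiCoeff m s p.1 * (r : ℂ) ^ (2 * p.1)) *
        ((-1) ^ p.2 * ((2 * Real.pi * m * r : ℝ) : ℂ) ^ (2 * p.2) / (2 * p.2).factorial) *
        Complex.betaIntegral (s / 2 + p.1) (p.2 + 1 / 2)
  refine hsumF.trans ?_
  have hGN := mul_inv_cancel₀ (hG N)
  rw [hC, ← sqrt_pi_mul_Gamma_div hs, ← e1, show s - 1 / 2 + N + 1 = s + 1 / 2 + N by ring]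
  generalize Complex.Gamma (s / 2 + 1 / 2 + N) = x1 at hGN ⊢
  generalize (((Real.pi * m : ℝ) : ℂ) * r) ^ (2 * N) = x4
  generalize ((Real.pi * m : ℝ) : ℂ) ^ (s - 1 / 2) = x5
  generalize (r : ℂ) ^ (s - 1 / 2) = x6
  have hone : ∀ Y : ℂ, x1 * x1⁻¹ * Y = Y := fun Y => by rw [hGN, one_mul]
  refine Eq.trans ?_ (hone _)
  ring

/-! ### Frames: parametrizing the geodesic of a form by the imaginary axis -/

/-- A real matrix `M = (x₁ x₂; y₁ y₂)` of positive determinant which transports the form `n X Y`,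
whose geodesic is the imaginary axis oriented upwards, to `Q`. -/
structure IsFrame (Q : BinForm) (n x₁ x₂ y₁ y₂ : ℝ) : Prop where
  det_pos : 0 < x₁ * y₂ - x₂ * y₁
  a_eq : (x₁ * y₂ - x₂ * y₁) * Q.a = -n * (y₁ * y₂)
  b_eq : (x₁ * y₂ - x₂ * y₁) * Q.b = n * (x₁ * y₂ + x₂ * y₁)
  c_eq : (x₁ * y₂ - x₂ * y₁) * Q.c = -n * (x₁ * x₂)

/-- The point `M(iu)` for `M = (x₁ x₂; y₁ y₂)`. -/
def framePoint (x₁ x₂ y₁ y₂ u : ℝ) : ℂ :=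
  (x₁ * (Complex.I * u) + x₂) / (y₁ * (Complex.I * u) + y₂)

/-- The integrand of `∫ f(M(iu)) du / u`. -/
def frameIntegrand (f : ℍ → ℂ) (x₁ x₂ y₁ y₂ u : ℝ) : ℂ :=
  f (UpperHalfPlane.ofComplex (framePoint x₁ x₂ y₁ y₂ u)) * (u : ℂ)⁻¹

theorem frame_denom_ne_zero {x₁ x₂ y₁ y₂ u : ℝ} (h : 0 < x₁ * y₂ - x₂ * y₁) (hu : 0 < u) :
    (y₁ * (Complex.I * u) + y₂ : ℂ) ≠ 0 := by
  intro h0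
  have hre := congrArg Complex.re h0
  have him := congrArg Complex.im h0
  simp at hre him
  rcases him with h1 | h1
  · rw [hre, h1] at h; simp at h
  · exact hu.ne' h1

theorem framePoint_im_pos {x₁ x₂ y₁ y₂ u : ℝ} (h : 0 < x₁ * y₂ - x₂ * y₁) (hu : 0 < u) :
    0 < (framePoint x₁ x₂ y₁ y₂ u).im := by
  have hne := frame_denom_ne_zero h hu
  have hN := Complex.normSq_pos.mpr hne
  rw [framePoint, Complex.div_im]
  have : (x₁ * (Complex.I * u) + x₂ : ℂ).im * (y₁ * (Complex.I * u) + y₂ : ℂ).re -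
      (x₁ * (Complex.I * u) + x₂ : ℂ).re * (y₁ * (Complex.I * u) + y₂ : ℂ).im =
      (x₁ * y₂ - x₂ * y₁) * u := by
    simp; ring
  rw [← sub_div, this]
  positivity

theorem smul_ofComplex_framePoint (γ : SL(2, ℤ)) {x₁ x₂ y₁ y₂ u : ℝ} (h : 0 < x₁ * y₂ - x₂ * y₁)
    (hu : 0 < u) :
    γ • UpperHalfPlane.ofComplex (framePoint x₁ x₂ y₁ y₂ u) =
      UpperHalfPlane.ofComplex (framePoint (γ 0 0 * x₁ + γ 0 1 * y₁) (γ 0 0 * x₂ + γ 0 1 * y₂)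
        (γ 1 0 * x₁ + γ 1 1 * y₁) (γ 1 0 * x₂ + γ 1 1 * y₂) u) := by
  have hdet : (γ 0 0 * γ 1 1 - γ 0 1 * γ 1 0 : ℝ) = 1 := by exact_mod_cast det_eq_one γ
  have h' : 0 < (γ 0 0 * x₁ + γ 0 1 * y₁) * (γ 1 0 * x₂ + γ 1 1 * y₂) -
      (γ 0 0 * x₂ + γ 0 1 * y₂) * (γ 1 0 * x₁ + γ 1 1 * y₁) := by
    have : (γ 0 0 * x₁ + γ 0 1 * y₁) * (γ 1 0 * x₂ + γ 1 1 * y₂) -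
      (γ 0 0 * x₂ + γ 0 1 * y₂) * (γ 1 0 * x₁ + γ 1 1 * y₁) = x₁ * y₂ - x₂ * y₁ := by
      linear_combination (x₁ * y₂ - x₂ * y₁) * hdet
    rwa [this]
  have hne := frame_denom_ne_zero h hu
  have hne' := frame_denom_ne_zero h' hu
  apply UpperHalfPlane.ext
  rw [UpperHalfPlane.specialLinearGroup_apply,
    UpperHalfPlane.ofComplex_apply_of_im_pos (framePoint_im_pos h hu),
    UpperHalfPlane.ofComplex_apply_of_im_pos (framePoint_im_pos h' hu)]
  simp only [framePoint, eq_intCast, Complex.ofReal_intCast]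
  push_cast at hne' ⊢
  rw [mul_div_assoc', mul_div_assoc', div_add' _ _ _ hne, div_add' _ _ _ hne,
    div_div_div_cancel_right₀ hne]
  congr 1 <;> ring

theorem IsFrame.act {Q : BinForm} {n x₁ x₂ y₁ y₂ : ℝ} (h : IsFrame Q n x₁ x₂ y₁ y₂)
    (γ : SL(2, ℤ)) :
    IsFrame (BinForm.act γ Q) n (γ 0 0 * x₁ + γ 0 1 * y₁) (γ 0 0 * x₂ + γ 0 1 * y₂)
        (γ 1 0 * x₁ + γ 1 1 * y₁) (γ 1 0 * x₂ + γ 1 1 * y₂) := by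
  have hdet : (γ 0 0 * γ 1 1 - γ 0 1 * γ 1 0 : ℝ) = 1 := by exact_mod_cast det_eq_one γ
  have e : (γ 0 0 * x₁ + γ 0 1 * y₁) * (γ 1 0 * x₂ + γ 1 1 * y₂) -
      (γ 0 0 * x₂ + γ 0 1 * y₂) * (γ 1 0 * x₁ + γ 1 1 * y₁) = x₁ * y₂ - x₂ * y₁ := by
    linear_combination (x₁ * y₂ - x₂ * y₁) * hdet
  have ha := h.a_eq
  have hb := h.b_eq
  have hc := h.c_eq
  refine ⟨by rw [e]; exact h.det_pos, ?_, ?_, ?_⟩ <;> rw [e] <;> simp only [BinForm.act] <;>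
    push_cast
  · linear_combination (γ 1 1 : ℝ) ^ 2 * ha - (γ 1 1 : ℝ) * γ 1 0 * hb + (γ 1 0 : ℝ) ^ 2 * hc
  · linear_combination (-2 * (γ 1 1 : ℝ) * γ 0 1) * ha +
      ((γ 0 0 : ℝ) * γ 1 1 + γ 0 1 * γ 1 0) * hb - 2 * (γ 1 0 : ℝ) * γ 0 0 * hc
  · linear_combination (γ 0 1 : ℝ) ^ 2 * ha - (γ 0 1 : ℝ) * γ 0 0 * hb + (γ 0 0 : ℝ) ^ 2 * hc

/-- Two frames of the same form differ by a diagonal matrix, since the stabilizer of `X Y` in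
`GL₂⁺(ℝ)` consists of diagonal matrices. -/
theorem IsFrame.exists_scale {Q : BinForm} {n x₁ x₂ y₁ y₂ z₁ z₂ w₁ w₂ : ℝ} (hn : 0 < n)
    (h : IsFrame Q n x₁ x₂ y₁ y₂) (h' : IsFrame Q n z₁ z₂ w₁ w₂) :
    ∃ t : ℝ, 0 < t ∧ ∀ u : ℝ, framePoint z₁ z₂ w₁ w₂ u = framePoint x₁ x₂ y₁ y₂ (t * u) := by
  have hδ := h.det_pos
  have hδ' := h'.det_pos
  have val : ∀ {x₁ x₂ y₁ y₂ : ℝ}, IsFrame Q n x₁ x₂ y₁ y₂ → ∀ x y x' y' : ℝ,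
      (x₁ * y₂ - x₂ * y₁) * (2 * Q.a * x * x' + Q.b * (x * y' + x' * y) + 2 * Q.c * y * y') =
        n * ((y₂ * x - x₂ * y) * (x₁ * y' - y₁ * x') + (y₂ * x' - x₂ * y') * (x₁ * y - y₁ * x)) := by
    intro x₁ x₂ y₁ y₂ h x y x' y'
    linear_combination 2 * x * x' * h.a_eq + (x * y' + x' * y) * h.b_eq + 2 * y * y' * h.c_eq
  set δ := x₁ * y₂ - x₂ * y₁ with hδdef
  set δ' := z₁ * w₂ - z₂ * w₁ with hδdef'
  set p := y₂ * z₁ - x₂ * w₁ with hp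
  set q := y₂ * z₂ - x₂ * w₂ with hq
  set r := x₁ * w₁ - y₁ * z₁ with hr
  set v := x₁ * w₂ - y₁ * z₂ with hv
  -- `(p q; r v)` is the adjugate of the first frame times the second one; the values of
  -- `Q` at the columns of the second frame, computed in both frames, show that it preserves `X Y`
  -- up to a scalar
  have e1 : p * r = 0 := by
    have a1 := val h z₁ w₁ z₁ w₁
    have a2 := val h' z₁ w₁ z₁ w₁
    have : δ' * (n * 2 * (p * r)) = 0 := by linear_combination (-δ') * a1 + δ * a2
    have h3 := (mul_eq_zero.mp this).resolve_left hδ'.ne'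
    exact (mul_eq_zero.mp h3).resolve_left (by positivity)
  have e2 : p * v + q * r = δ * δ' := by
    have a1 := val h z₁ w₁ z₂ w₂
    have a2 := val h' z₁ w₁ z₂ w₂
    have : (n * δ') * (p * v + q * r - δ * δ') = 0 := by
      rw [hδdef, hδdef', hp, hq, hr, hv]
      linear_combination (-(z₁ * w₂ - z₂ * w₁)) * a1 + (x₁ * y₂ - x₂ * y₁) * a2
    have h3 := (mul_eq_zero.mp this).resolve_left (by positivity)
    linarith
  have e3 : p * v - q * r = δ * δ' := by
    rw [hδdef, hδdef', hp, hq, hr, hv]; ring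
  have hpv : p * v = δ * δ' := by linarith
  have hpv0 : 0 < p * v := by rw [hpv]; positivity
  have hp0 : p ≠ 0 := fun h0 => by rw [h0] at hpv0; simp at hpv0
  have hv0 : v ≠ 0 := fun h0 => by rw [h0] at hpv0; simp at hpv0
  have hr0 : r = 0 := (mul_eq_zero.mp e1).resolve_left hp0
  have hq0 : q = 0 := by
    have e4 : q * v = 0 := by
      have a1 := val h z₂ w₂ z₂ w₂
      have a2 := val h' z₂ w₂ z₂ w₂
      have : δ' * (n * 2 * (q * v)) = 0 := by linear_combination (-δ') * a1 + δ * a2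
      have h3 := (mul_eq_zero.mp this).resolve_left hδ'.ne'
      exact (mul_eq_zero.mp h3).resolve_left (by positivity)
    exact (mul_eq_zero.mp e4).resolve_right hv0
  have f1 : δ * z₁ = p * x₁ := by linear_combination x₂ * hr0 + x₂ * hr - x₂ * hr
  have f2 : δ * w₁ = p * y₁ := by linear_combination y₂ * hr0
  have f3 : δ * z₂ = v * x₂ := by linear_combination x₁ * hq0
  have f4 : δ * w₂ = v * y₂ := by linear_combination y₁ * hq0
  have ht : 0 < p / v := by
    have : p / v = p * v / v ^ 2 := by field_simp
    rw [this]; positivity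
  refine ⟨p / v, ht, fun u => ?_⟩
  have hδc : (δ : ℂ) ≠ 0 := by exact_mod_cast hδ.ne'
  have hvc : (v : ℂ) ≠ 0 := by exact_mod_cast hv0
  have g1 : (δ : ℂ) * z₁ = p * x₁ := by exact_mod_cast f1
  have g2 : (δ : ℂ) * w₁ = p * y₁ := by exact_mod_cast f2
  have g3 : (δ : ℂ) * z₂ = v * x₂ := by exact_mod_cast f3
  have g4 : (δ : ℂ) * w₂ = v * y₂ := by exact_mod_cast f4
  have k1 : (δ : ℂ) * (z₁ * (Complex.I * u) + z₂) =
      v * (x₁ * (Complex.I * ((p / v * u : ℝ) : ℂ)) + x₂) := by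
    push_cast
    field_simp
    linear_combination Complex.I * u * g1 + g3
  have k2 : (δ : ℂ) * (w₁ * (Complex.I * u) + w₂) =
      v * (y₁ * (Complex.I * ((p / v * u : ℝ) : ℂ)) + y₂) := by
    push_cast
    field_simp
    linear_combination Complex.I * u * g2 + g4
  rw [framePoint, framePoint, ← mul_div_mul_left _ _ hδc, k1, k2, mul_div_mul_left _ _ hvc]

/-- Scaling invariance of the measure `du / u`; see also `integral_comp_mul_mul_inv`. -/
theorem integrableOn_comp_mul_mul_inv {g : ℝ → ℂ} {t : ℝ} (ht : 0 < t) :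
    IntegrableOn (fun u : ℝ => g (t * u) * (u : ℂ)⁻¹) (Ioi 0) ↔
      IntegrableOn (fun u : ℝ => g u * (u : ℂ)⁻¹) (Ioi 0) := by
  have h := integrableOn_Ioi_comp_mul_left_iff (fun u : ℝ => g u * (u : ℂ)⁻¹) 0 ht
  rw [mul_zero] at h
  rw [← h]
  have htc : (t : ℂ) ≠ 0 := by exact_mod_cast ht.ne'
  have e : (fun u : ℝ => g (t * u) * (u : ℂ)⁻¹) =
      fun u : ℝ => (t : ℂ) * (g (t * u) * ((t * u : ℝ) : ℂ)⁻¹) := by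
    ext u; push_cast; rw [mul_inv]; field_simp
  rw [e]
  exact integrable_const_mul_iff (isUnit_iff_ne_zero.mpr htc) _

theorem integral_comp_mul_mul_inv {g : ℝ → ℂ} {t : ℝ} (ht : 0 < t) :
    ∫ u in Ioi (0 : ℝ), g (t * u) * (u : ℂ)⁻¹ = ∫ u in Ioi (0 : ℝ), g u * (u : ℂ)⁻¹ := by
  have h := integral_comp_mul_left_Ioi (fun u : ℝ => g u * (u : ℂ)⁻¹) 0 ht
  rw [mul_zero] at h
  have htc : (t : ℂ) ≠ 0 := by exact_mod_cast ht.ne'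
  have e : (fun u : ℝ => g (t * u) * (u : ℂ)⁻¹) =
      fun u : ℝ => (t : ℂ) * (g (t * u) * ((t * u : ℝ) : ℂ)⁻¹) := by
    ext u; push_cast; rw [mul_inv]; field_simp
  rw [e, integral_const_mul, h, Complex.real_smul]
  push_cast
  field_simp

/-! ### The parametrizations `cycleParam` -/

/-- The density of `dτ_Q` with respect to the parameter of `cycleParam`. -/
def cycleWeight (Q : BinForm) (t : ℝ) : ℝ := if Q.a = 0 then t⁻¹ else (Real.sin t)⁻¹

theorem measurableSet_cycleDomain (Q : BinForm) : MeasurableSet (cycleDomain Q) := by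
  unfold cycleDomain
  split_ifs
  · exact measurableSet_Ioi
  · exact measurableSet_Ioo

theorem cycleWeight_pos {Q : BinForm} {t : ℝ} (ht : t ∈ cycleDomain Q) : 0 < cycleWeight Q t := by
  unfold cycleDomain at ht
  unfold cycleWeight
  split_ifs at ht ⊢
  · exact inv_pos.mpr ht
  · exact inv_pos.mpr (Real.sin_pos_of_mem_Ioo ht)

theorem sqrt_disc {Q : BinForm} {n : ℝ} (hn : 0 < n) (hQ : (Q.disc : ℝ) = n ^ 2) :
    √(Q.disc : ℝ) = n := by
  rw [hQ, Real.sqrt_sq hn.le]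

/-- For `a ≠ 0`, with `ε` the sign of `a`, the semicircle is `(-b + n e^{iεθ}) / 2a`. -/
theorem cycleParam_of_a_ne_zero {Q : BinForm} {n : ℝ} (hn : 0 < n) (hQ : (Q.disc : ℝ) = n ^ 2)
    (ha : Q.a ≠ 0) : ∃ ε : ℝ, (ε = 1 ∨ ε = -1) ∧ ε * Q.a = |(Q.a : ℝ)| ∧ ∀ t : ℝ,
      cycleParam Q t = -(Q.b : ℂ) / (2 * Q.a) +
        (n : ℂ) / (2 * Q.a) * Complex.exp (ε * (Complex.I * t)) := by
  rcases lt_or_gt_of_ne ha with h | h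
  · have h' : (Q.a : ℝ) < 0 := by exact_mod_cast h
    refine ⟨-1, Or.inr rfl, by rw [abs_of_neg h']; ring, fun t => ?_⟩
    simp only [cycleParam, h.not_gt, h, if_false, if_true, sqrt_disc hn hQ, abs_of_neg h']
    push_cast
    rw [neg_one_mul, mul_neg, div_neg]
    ring
  · have h' : (0 : ℝ) < Q.a := by exact_mod_cast h
    refine ⟨1, Or.inl rfl, by rw [abs_of_pos h']; ring, fun t => ?_⟩
    simp only [cycleParam, h, if_true, sqrt_disc hn hQ, abs_of_pos h']
    push_cast
    rw [one_mul]

theorem exp_sign_mul {ε : ℝ} (hε : ε = 1 ∨ ε = -1) (t : ℝ) :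
    Complex.exp (ε * (Complex.I * t)) =
      (Real.cos t : ℂ) + (ε * Real.sin t : ℝ) * Complex.I := by
  have : (ε * (Complex.I * t) : ℂ) = ((ε * t : ℝ) : ℂ) * Complex.I := by push_cast; ring
  rw [this, Complex.exp_mul_I, ← Complex.ofReal_cos, ← Complex.ofReal_sin]
  rcases hε with rfl | rfl <;> simp

/-- On the parameter domain `dτ_Q` is the positive hyperbolic arc length. -/
theorem cycleIntegrand_eq {Q : BinForm} {n : ℝ} (hn : 0 < n) (hQ : (Q.disc : ℝ) = n ^ 2)
    (f : ℍ → ℂ) {t : ℝ} (ht : t ∈ cycleDomain Q) :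
    cycleIntegrand Q f t = f (UpperHalfPlane.ofComplex (cycleParam Q t)) * (cycleWeight Q t : ℂ) := by
  have hnc : (n : ℂ) ≠ 0 := by exact_mod_cast hn.ne'
  rw [cycleIntegrand, sqrt_disc hn hQ]
  congr 1
  have hdisc : (Q.b : ℂ) ^ 2 - 4 * Q.a * Q.c = n ^ 2 := by
    have : ((Q.disc : ℝ) : ℂ) = ((n ^ 2 : ℝ) : ℂ) := by rw [hQ]
    simpa [BinForm.disc] using this
  by_cases ha : Q.a = 0
  · have ht0 : 0 < t := by simpa [cycleDomain, ha] using ht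
    have htc : (t : ℂ) ≠ 0 := by exact_mod_cast ht0.ne'
    have hb0 : Q.b ≠ 0 := by
      intro hb
      simp only [ha, hb, Int.cast_zero] at hdisc
      apply hnc
      have : (n : ℂ) ^ 2 = 0 := by linear_combination -hdisc
      exact pow_eq_zero_iff two_ne_zero |>.mp this
    have hbc : (Q.b : ℂ) ≠ 0 := by exact_mod_cast hb0
    have hb2 : (Q.b : ℝ) ^ 2 = n ^ 2 := by
      rw [← hQ]; simp [BinForm.disc, ha]
    rcases lt_or_gt_of_ne hb0 with hb | hb
    · have hbn : (Q.b : ℂ) = -n := by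
        have hb' : (Q.b : ℝ) < 0 := by exact_mod_cast hb
        rcases sq_eq_sq_iff_eq_or_eq_neg.mp hb2 with h | h
        · linarith
        · exact_mod_cast congrArg Complex.ofReal h
      have hfun : cycleParam Q = fun t : ℝ => -(Q.c : ℂ) / Q.b + Complex.I * (t : ℂ)⁻¹ := by
        ext t; simp [cycleParam, ha, hb.not_gt]
      have hd : HasDerivAt (cycleParam Q) (Complex.I * (-(t ^ 2 : ℂ)⁻¹)) t := by
        rw [hfun]
        have h1 := ((hasDerivAt_inv htc).comp_ofReal).const_mul Complex.I
        exact h1.const_add _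
      rw [hd.deriv, hfun]
      simp only [BinForm.evalC, cycleWeight, ha, if_true, Int.cast_zero, zero_mul, zero_add]
      rw [hbn]
      push_cast
      field_simp
      ring
    · have hbn : (Q.b : ℂ) = n := by
        have hb' : (0 : ℝ) < Q.b := by exact_mod_cast hb
        rcases sq_eq_sq_iff_eq_or_eq_neg.mp hb2 with h | h
        · exact_mod_cast congrArg Complex.ofReal h
        · linarith
      have hfun : cycleParam Q = fun t : ℝ => -(Q.c : ℂ) / Q.b + Complex.I * t := by
        ext t; simp [cycleParam, ha, hb]
      have hd : HasDerivAt (cycleParam Q) (Complex.I * 1) t := by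
        rw [hfun]
        have h1 := ((hasDerivAt_id (t : ℂ)).comp_ofReal).const_mul Complex.I
        exact h1.const_add _
      rw [hd.deriv, hfun]
      simp only [BinForm.evalC, cycleWeight, ha, if_true, Int.cast_zero, zero_mul, zero_add]
      have e : (n : ℂ) * (-Q.c / n + Complex.I * t) + Q.c = n * (Complex.I * t) := by
        field_simp; ring
      rw [hbn, e]
      push_cast
      field_simp
  · have ht' : t ∈ Ioo 0 Real.pi := by simpa [cycleDomain, ha] using ht
    have hac : (Q.a : ℂ) ≠ 0 := by exact_mod_cast ha
    have hsin := Real.sin_pos_of_mem_Ioo ht'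
    have hsc : (Real.sin t : ℂ) ≠ 0 := by exact_mod_cast hsin.ne'
    obtain ⟨ε, hε, -, hpar⟩ := cycleParam_of_a_ne_zero hn hQ ha
    have hd : HasDerivAt (cycleParam Q) ((n : ℂ) / (2 * Q.a) *
        (Complex.exp (ε * (Complex.I * t)) * (ε * Complex.I))) t := by
      have hfun : cycleParam Q = fun t : ℝ => -(Q.b : ℂ) / (2 * Q.a) +
        (n : ℂ) / (2 * Q.a) * Complex.exp (ε * (Complex.I * t)) := funext hpar
      rw [hfun]
      have h0 : HasDerivAt (fun z : ℂ => (ε : ℂ) * (Complex.I * z)) (ε * (Complex.I * 1)) (t : ℂ) :=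
        ((hasDerivAt_id (t : ℂ)).const_mul Complex.I).const_mul (ε : ℂ)
      rw [mul_one] at h0
      exact ((h0.cexp.comp_ofReal).const_mul _).const_add _
    rw [hd.deriv, hpar]
    set X := Complex.exp (ε * (Complex.I * t)) with hX
    have hX0 : X ≠ 0 := Complex.exp_ne_zero _
    have hX2 : X ^ 2 - 1 = 2 * (ε * Complex.I) * Real.sin t * X := by
      have h2 : (ε : ℂ) ^ 2 = 1 := by rcases hε with rfl | rfl <;> simp
      have h1 : (Real.sin t : ℂ) ^ 2 + (Real.cos t : ℂ) ^ 2 = 1 := by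
        exact_mod_cast Real.sin_sq_add_cos_sq t
      rw [hX, exp_sign_mul hε, Complex.ofReal_mul]
      linear_combination h1 - (Complex.I ^ 2 * (Complex.ofReal (Real.sin t)) ^ 2) * h2 -
        (Complex.ofReal (Real.sin t)) ^ 2 * Complex.I_sq
    have hεc : (ε : ℂ) ≠ 0 := by rcases hε with rfl | rfl <;> simp
    have hev : BinForm.evalC Q (-(Q.b : ℂ) / (2 * Q.a) + (n : ℂ) / (2 * Q.a) * X) =
        n ^ 2 / (4 * Q.a) * (2 * (ε * Complex.I) * Real.sin t * X) := by
      rw [← hX2, BinForm.evalC]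
      field_simp
      linear_combination (-4 : ℂ) * hdisc
    rw [hev]
    simp only [cycleWeight, ha, if_false]
    rw [Complex.ofReal_inv]
    field_simp
    norm_num

theorem half_angle {t : ℝ} (ht : t ∈ Ioo 0 Real.pi) :
    0 < Real.tan (t / 2) ∧ Real.cos t + Real.sin t * Real.tan (t / 2) = 1 ∧
      Real.sin t = Real.tan (t / 2) * (1 + Real.cos t) := by
  have hC : 0 < Real.cos (t / 2) :=
    Real.cos_pos_of_mem_Ioo ⟨by linarith [ht.1, Real.pi_pos], by linarith [ht.2]⟩
  have h1 : Real.cos t = 2 * Real.cos (t / 2) ^ 2 - 1 := by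
    rw [← Real.cos_two_mul]; congr 1; ring
  have h2 : Real.sin t = 2 * Real.sin (t / 2) * Real.cos (t / 2) := by
    rw [← Real.sin_two_mul]; congr 1; ring
  refine ⟨Real.tan_pos_of_pos_of_lt_pi_div_two (by linarith [ht.1]) (by linarith [ht.2]), ?_, ?_⟩
  · rw [h1, h2, Real.tan_eq_sin_div_cos]
    field_simp
    linear_combination 2 * Real.sin_sq_add_cos_sq (t / 2)
  · rw [h1, h2, Real.tan_eq_sin_div_cos]
    field_simp
    ring

theorem image_tan_half : (fun t => Real.tan (t / 2)) '' Ioo 0 Real.pi = Ioi (0 : ℝ) := by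
  ext u
  constructor
  · rintro ⟨t, ht, rfl⟩
    exact (half_angle ht).1
  · intro hu
    refine ⟨2 * Real.arctan u, ⟨?_, ?_⟩, ?_⟩
    · have := Real.arctan_pos.mpr hu
      linarith
    · linarith [Real.arctan_lt_pi_div_two u]
    · simp only [mul_div_cancel_left₀ _ (two_ne_zero' ℝ), Real.tan_arctan]

theorem injOn_tan_half : InjOn (fun t => Real.tan (t / 2)) (Ioo 0 Real.pi) := by
  intro a ha b hb h
  have := Real.injOn_tan (x₁ := a / 2) (x₂ := b / 2)
    ⟨by linarith [ha.1, Real.pi_pos], by linarith [ha.2]⟩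
    ⟨by linarith [hb.1, Real.pi_pos], by linarith [hb.2]⟩ h
  linarith

theorem hasDerivWithinAt_tan_half {t : ℝ} (ht : t ∈ Ioo 0 Real.pi) :
    HasDerivWithinAt (fun t => Real.tan (t / 2)) (Real.tan (t / 2) * (Real.sin t)⁻¹)
      (Ioo 0 Real.pi) t := by
  have hC : 0 < Real.cos (t / 2) :=
    Real.cos_pos_of_mem_Ioo ⟨by linarith [ht.1, Real.pi_pos], by linarith [ht.2]⟩
  have hS := Real.sin_pos_of_mem_Ioo ht
  have h2 : Real.sin t = 2 * Real.sin (t / 2) * Real.cos (t / 2) := by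
    rw [← Real.sin_two_mul]; congr 1; ring
  have hS2 : Real.sin (t / 2) ≠ 0 := fun h => by rw [h2, h] at hS; simp at hS
  have h := ((Real.hasDerivAt_tan hC.ne').comp t ((hasDerivAt_id t).div_const 2))
  have e : 1 / Real.cos (t / 2) ^ 2 * (1 / 2) = Real.tan (t / 2) * (Real.sin t)⁻¹ := by
    rw [h2, Real.tan_eq_sin_div_cos]; field_simp
  rw [← e]
  exact h.hasDerivWithinAt

/-- The substitution `u = tan (t / 2)` carries `dt / sin t` to `du / u`. -/
theorem tan_half_subst (g : ℝ → ℂ) :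
    (IntegrableOn (fun t : ℝ => g (Real.tan (t / 2)) * ((Real.sin t)⁻¹ : ℝ)) (Ioo 0 Real.pi) ↔
      IntegrableOn (fun u : ℝ => g u * (u : ℂ)⁻¹) (Ioi 0)) ∧
    ∫ t in Ioo 0 Real.pi, g (Real.tan (t / 2)) * (((Real.sin t)⁻¹ : ℝ) : ℂ) =
      ∫ u in Ioi (0 : ℝ), g u * (u : ℂ)⁻¹ := by
  have e : ∀ t ∈ Ioo 0 Real.pi, |Real.tan (t / 2) * (Real.sin t)⁻¹| •
      (g (Real.tan (t / 2)) * ((Real.tan (t / 2) : ℝ) : ℂ)⁻¹) =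
      g (Real.tan (t / 2)) * (((Real.sin t)⁻¹ : ℝ) : ℂ) := by
    intro t ht
    have h1 := (half_angle ht).1
    have h2 := Real.sin_pos_of_mem_Ioo ht
    have h3 : ((Real.tan (t / 2) : ℝ) : ℂ) ≠ 0 := by exact_mod_cast h1.ne'
    rw [abs_of_pos (by positivity), Complex.real_smul, Complex.ofReal_mul]
    field_simp
  rw [← image_tan_half]
  constructor
  · rw [integrableOn_image_iff_integrableOn_abs_deriv_smul measurableSet_Ioo
      (fun t ht => hasDerivWithinAt_tan_half ht) injOn_tan_half]
    exact (integrableOn_congr_fun e measurableSet_Ioo).symm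
  · rw [integral_image_eq_integral_abs_deriv_smul measurableSet_Ioo
      (fun t ht => hasDerivWithinAt_tan_half ht) injOn_tan_half]
    exact (setIntegral_congr_fun measurableSet_Ioo e).symm

/-- Every form of discriminant `n² > 0` has a frame that computes its cycle integrals. -/
theorem exists_isFrame {Q : BinForm} {n : ℝ} (hn : 0 < n) (hQ : (Q.disc : ℝ) = n ^ 2) :
    ∃ x₁ x₂ y₁ y₂ : ℝ, IsFrame Q n x₁ x₂ y₁ y₂ ∧ ∀ f : ℍ → ℂ,
      (CycleIntegrable Q f ↔ IntegrableOn (frameIntegrand f x₁ x₂ y₁ y₂) (Ioi 0)) ∧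
      cycleIntegral Q f = ∫ u in Ioi (0 : ℝ), frameIntegrand f x₁ x₂ y₁ y₂ u := by
  have hdisc : (Q.b : ℝ) ^ 2 - 4 * Q.a * Q.c = n ^ 2 := by
    rw [← hQ]; simp [BinForm.disc]
  by_cases ha : Q.a = 0
  · have hdom : cycleDomain Q = Ioi 0 := by simp [cycleDomain, ha]
    have hb2 : (Q.b : ℝ) ^ 2 = n ^ 2 := by rw [← hdisc]; simp [ha]
    -- it suffices to exhibit the parametrization as that of a frame
    suffices h : ∃ x₁ x₂ y₁ y₂ : ℝ, IsFrame Q n x₁ x₂ y₁ y₂ ∧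
        ∀ t : ℝ, 0 < t → cycleParam Q t = framePoint x₁ x₂ y₁ y₂ t by
      obtain ⟨x₁, x₂, y₁, y₂, hF, hpar⟩ := h
      refine ⟨x₁, x₂, y₁, y₂, hF, fun f => ?_⟩
      have e : ∀ t ∈ Ioi (0 : ℝ), cycleIntegrand Q f t = frameIntegrand f x₁ x₂ y₁ y₂ t := by
        intro t ht
        rw [cycleIntegrand_eq hn hQ f (by rwa [hdom]), hpar t ht, frameIntegrand]
        simp [cycleWeight, ha]
      rw [CycleIntegrable, cycleIntegral, hdom]
      exact ⟨integrableOn_congr_fun e measurableSet_Ioi,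
        setIntegral_congr_fun measurableSet_Ioi e⟩
    have hb0 : (Q.b : ℝ) ≠ 0 := by
      intro h
      rw [h] at hb2
      have : 0 < n ^ 2 := by positivity
      rw [← hb2] at this
      simp at this
    have hbz : Q.b ≠ 0 := by exact_mod_cast hb0
    have hbc : (Q.b : ℂ) ≠ 0 := by exact_mod_cast hbz
    rcases lt_or_gt_of_ne hbz with hb | hb
    · have hb' : (Q.b : ℝ) < 0 := by exact_mod_cast hb
      have hbn : (Q.b : ℝ) = -n := by
        rcases sq_eq_sq_iff_eq_or_eq_neg.mp hb2 with h | h <;> linarith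
      -- the frame contains the inversion `τ ↦ -1/τ`, which reverses the orientation
      refine ⟨-(Q.c : ℝ) / Q.b, -1, 1, 0, ⟨by norm_num, ?_, ?_, ?_⟩, fun t ht => ?_⟩
      · simp [ha]
      · rw [hbn]; ring
      · rw [hbn]; field_simp; ring
      · have htc : (t : ℂ) ≠ 0 := by exact_mod_cast ht.ne'
        simp only [cycleParam, framePoint, ha, lt_irrefl, if_false, hb.not_gt]
        push_cast
        field_simp
        linear_combination (t * Q.b : ℂ) * Complex.I_sq
    · have hb' : (0 : ℝ) < Q.b := by exact_mod_cast hb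
      have hbn : (Q.b : ℝ) = n := by
        rcases sq_eq_sq_iff_eq_or_eq_neg.mp hb2 with h | h <;> linarith
      refine ⟨1, -(Q.c : ℝ) / Q.b, 0, 1, ⟨by norm_num, ?_, ?_, ?_⟩, fun t ht => ?_⟩
      · simp [ha]
      · rw [hbn]; ring
      · rw [hbn]; field_simp; ring
      · simp only [cycleParam, framePoint, ha, lt_irrefl, if_false, hb, if_true]
        push_cast
        field_simp
        ring
  · have hdom : cycleDomain Q = Ioo 0 Real.pi := by simp [cycleDomain, ha]
    obtain ⟨ε, hε, hεa, hpar⟩ := cycleParam_of_a_ne_zero hn hQ ha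
    have ha' : (Q.a : ℝ) ≠ 0 := by exact_mod_cast ha
    have hac : (Q.a : ℂ) ≠ 0 := by exact_mod_cast ha
    have hε2 : ε ^ 2 = 1 := by rcases hε with rfl | rfl <;> norm_num
    have hdet : ε * (n + Q.b) * (2 * Q.a) - (n - Q.b) * (-2 * Q.a * ε) = 4 * n * |(Q.a : ℝ)| := by
      rw [← hεa]; ring
    have hdet0 : 0 < ε * (n + Q.b) * (2 * Q.a) - (n - Q.b) * (-2 * Q.a * ε) := by
      rw [hdet]; positivity
    -- this frame sends `0` and `∞` to the two roots `(-b ± n) / 2a`, and the substitution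
    -- `u = tan (t / 2)` turns its parameter into the angle on the semicircle
    refine ⟨ε * (n + Q.b), n - Q.b, -2 * Q.a * ε, 2 * Q.a, ⟨hdet0, by ring, by ring, ?_⟩, ?_⟩
    · linear_combination (n * ε) * (-hdisc)
    · intro f
      have e : ∀ t ∈ Ioo 0 Real.pi, cycleIntegrand Q f t =
          f (UpperHalfPlane.ofComplex (framePoint (ε * (n + Q.b)) (n - Q.b) (-2 * Q.a * ε) (2 * Q.a)
            (Real.tan (t / 2)))) * (((Real.sin t)⁻¹ : ℝ) : ℂ) := by
        intro t ht
        rw [cycleIntegrand_eq hn hQ f (by rwa [hdom])]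
        simp only [cycleWeight, ha, if_false]
        congr 3
        obtain ⟨h0, h1, h2⟩ := half_angle ht
        have hne := frame_denom_ne_zero hdet0 h0
        rw [hpar, exp_sign_mul hε, framePoint, eq_div_iff hne]
        have h1' : (Real.cos t : ℂ) + Real.sin t * Real.tan (t / 2) = 1 := by exact_mod_cast h1
        have h2' : (Real.sin t : ℂ) = Real.tan (t / 2) * (1 + Real.cos t) := by exact_mod_cast h2
        have hε2' : (ε : ℂ) ^ 2 = 1 := by exact_mod_cast hε2
        generalize Real.tan (t / 2) = u at *
        generalize Real.sin t = S at *
        generalize Real.cos t = C at *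
        push_cast
        field_simp
        linear_combination (n : ℂ) * h1' + (n * ε * Complex.I : ℂ) * h2' +
          (n * S * u : ℂ) * hε2' - (n * S * u * ε ^ 2 : ℂ) * Complex.I_sq
      have hs := tan_half_subst fun u => f (UpperHalfPlane.ofComplex
        (framePoint (ε * (n + Q.b)) (n - Q.b) (-2 * Q.a * ε) (2 * Q.a) u))
      rw [CycleIntegrable, cycleIntegral, hdom]
      exact ⟨(integrableOn_congr_fun e measurableSet_Ioo).trans hs.1,
        (setIntegral_congr_fun measurableSet_Ioo e).trans hs.2⟩

/-- Invariance of cycle integrals: `∫_{C_Q} f(γτ) dτ_Q = ∫_{C_{γQ}} f(τ) dτ_{γQ}`. -/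
theorem cycle_comp_smul {Q : BinForm} {n : ℝ} (hn : 0 < n) (hQ : (Q.disc : ℝ) = n ^ 2)
    (γ : SL(2, ℤ)) (f : ℍ → ℂ) :
    (CycleIntegrable Q (fun τ => f (γ • τ)) ↔ CycleIntegrable (BinForm.act γ Q) f) ∧
      cycleIntegral Q (fun τ => f (γ • τ)) = cycleIntegral (BinForm.act γ Q) f := by
  obtain ⟨x₁, x₂, y₁, y₂, hF, hint⟩ := exists_isFrame hn hQ
  obtain ⟨z₁, z₂, w₁, w₂, hF', hint'⟩ := exists_isFrame (Q := BinForm.act γ Q) hn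
    (by rw [BinForm.disc_act, hQ])
  obtain ⟨t, ht, hscale⟩ := hF'.exists_scale hn (hF.act γ)
  have e : ∀ u ∈ Ioi (0 : ℝ), frameIntegrand (fun τ => f (γ • τ)) x₁ x₂ y₁ y₂ u =
      f (UpperHalfPlane.ofComplex (framePoint z₁ z₂ w₁ w₂ (t * u))) * (u : ℂ)⁻¹ := by
    intro u hu
    rw [frameIntegrand, smul_ofComplex_framePoint γ hF.det_pos hu, hscale]
  rw [(hint _).1, (hint _).2, (hint' _).1, (hint' _).2,
    integrableOn_congr_fun e measurableSet_Ioi, setIntegral_congr_fun measurableSet_Ioi e]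
  exact ⟨integrableOn_comp_mul_mul_inv
      (g := fun u => f (UpperHalfPlane.ofComplex (framePoint z₁ z₂ w₁ w₂ u))) ht,
    integral_comp_mul_mul_inv
      (g := fun u => f (UpperHalfPlane.ofComplex (framePoint z₁ z₂ w₁ w₂ u))) ht⟩

/-! ### Cycle integrals of a single summand -/

/-- The function `e(-m Re τ) φ(Im τ)`, whose translates are the summands of a Poincaré series. -/
def seedFunction (m : ℕ) (φ : ℝ → ℂ) (τ : ℍ) : ℂ := expTwoPiI (-(m : ℝ) * τ.re) * φ τ.im

theorem expTwoPiI_add (x y : ℝ) : expTwoPiI (x + y) = expTwoPiI x * expTwoPiI y := by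
  simp only [expTwoPiI, ← Complex.exp_add]
  congr 1
  push_cast
  ring

/-- The geodesic of a form with `a ≠ 0` in polar coordinates around its centre. -/
theorem cycleParam_re_im {Q : BinForm} {n : ℝ} (hn : 0 < n) (hQ : (Q.disc : ℝ) = n ^ 2)
    (ha : Q.a ≠ 0) : ∃ ε : ℝ, (ε = 1 ∨ ε = -1) ∧ ∀ t ∈ Ioo 0 Real.pi,
      (UpperHalfPlane.ofComplex (cycleParam Q t)).re =
        -(Q.b : ℝ) / (2 * Q.a) + ε * (n / (2 * |(Q.a : ℝ)|) * Real.cos t) ∧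
      (UpperHalfPlane.ofComplex (cycleParam Q t)).im = n / (2 * |(Q.a : ℝ)|) * Real.sin t := by
  obtain ⟨ε, hε, hεa, hpar⟩ := cycleParam_of_a_ne_zero hn hQ ha
  have hε2 : ε ^ 2 = 1 := by rcases hε with rfl | rfl <;> norm_num
  have ha' : (Q.a : ℝ) ≠ 0 := by exact_mod_cast ha
  have hinv : n / (2 * |(Q.a : ℝ)|) = ε * (n / (2 * Q.a)) := by
    have hε0 : ε ≠ 0 := by rintro rfl; norm_num at hε2
    rw [← hεa]
    field_simp
    rw [hε2]
  refine ⟨ε, hε, fun t ht => ?_⟩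
  have hp : cycleParam Q t = ((-(Q.b : ℝ) / (2 * Q.a) + ε * (n / (2 * |(Q.a : ℝ)|) * Real.cos t) : ℝ) : ℂ)
      + ((n / (2 * |(Q.a : ℝ)|) * Real.sin t : ℝ) : ℂ) * Complex.I := by
    have e : ε * (n / (2 * |(Q.a : ℝ)|) * Real.cos t) = n / (2 * Q.a) * Real.cos t := by
      rw [hinv]; linear_combination (n / (2 * Q.a) * Real.cos t) * hε2
    rw [e, hinv, hpar, exp_sign_mul hε]
    push_cast
    ring
  have him : 0 < (cycleParam Q t).im := by
    have hs := Real.sin_pos_of_mem_Ioo ht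
    rw [hp, Complex.add_im, Complex.ofReal_im, Complex.im_ofReal_mul, Complex.I_im, zero_add,
      mul_one]
    positivity
  rw [UpperHalfPlane.ofComplex_apply_of_im_pos him]
  constructor
  · change (cycleParam Q t).re = _
    rw [hp, Complex.add_re, Complex.ofReal_re, Complex.re_ofReal_mul, Complex.I_re]
    ring
  · change (cycleParam Q t).im = _
    rw [hp, Complex.add_im, Complex.ofReal_im, Complex.im_ofReal_mul, Complex.I_im]
    ring

/-- Translating the centre `-b/2a` of the semicircle to the origin produces the exponential factor. -/
theorem cycle_seedFunction {Q : BinForm} {n : ℝ} (hn : 0 < n) (hQ : (Q.disc : ℝ) = n ^ 2)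
    (ha : Q.a ≠ 0) (m : ℕ) {s : ℂ} (hs : 1 < s.re) :
    CycleIntegrable Q (seedFunction m (phi m s)) ∧
      cycleIntegral Q (seedFunction m (phi m s)) =
        expTwoPiI (m * (Q.b / (2 * Q.a))) * angularIntegral m s (n / (2 * |(Q.a : ℝ)|)) := by
  have hdom : cycleDomain Q = Ioo 0 Real.pi := by simp [cycleDomain, ha]
  have ha' : (Q.a : ℝ) ≠ 0 := by exact_mod_cast ha
  have hr : 0 < n / (2 * |(Q.a : ℝ)|) := by positivity
  obtain ⟨ε, hε, hpar⟩ := cycleParam_re_im hn hQ ha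
  set r := n / (2 * |(Q.a : ℝ)|)
  have e : ∀ t ∈ Ioo 0 Real.pi, cycleIntegrand Q (seedFunction m (phi m s)) t =
      expTwoPiI (m * (Q.b / (2 * Q.a))) * (expTwoPiI ((-ε * m) * (r * Real.cos t)) *
        phi m s (r * Real.sin t) / (Real.sin t : ℂ)) := by
    intro t ht
    obtain ⟨hre, him⟩ := hpar t ht
    rw [cycleIntegrand_eq hn hQ _ (by rwa [hdom]), seedFunction, hre, him,
      show -(m : ℝ) * (-(Q.b : ℝ) / (2 * Q.a) + ε * (r * Real.cos t)) =
        m * (Q.b / (2 * Q.a)) + (-ε * m) * (r * Real.cos t) by ring, expTwoPiI_add]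
    simp only [cycleWeight, ha, if_false]
    rw [Complex.ofReal_inv]
    ring
  have hint := integrableOn_angular m hs hr (-ε * m)
  rw [CycleIntegrable, cycleIntegral, hdom]
  refine ⟨(integrableOn_congr_fun e measurableSet_Ioo).mpr (hint.const_mul _), ?_⟩
  rw [setIntegral_congr_fun measurableSet_Ioo e, integral_const_mul]
  congr 1
  rcases hε with rfl | rfl
  · rw [angularIntegral]
    simp only [neg_mul, one_mul]
  · rw [← angularIntegral_eq_pos]
    simp only [neg_neg, one_mul]

/-- The `L¹`-norm along `C_Q` is itself a cycle integral, so that the invariance of cycle integrals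
applies to it. -/
theorem integral_norm_cycleIntegrand {Q : BinForm} {n : ℝ} (hn : 0 < n)
    (hQ : (Q.disc : ℝ) = n ^ 2) (f : ℍ → ℂ) :
    ∫ t in cycleDomain Q, ‖cycleIntegrand Q f t‖ =
      ‖cycleIntegral Q (fun τ => ((‖f τ‖ : ℝ) : ℂ))‖ := by
  have e : ∀ t ∈ cycleDomain Q, cycleIntegrand Q (fun τ => ((‖f τ‖ : ℝ) : ℂ)) t =
      ((‖cycleIntegrand Q f t‖ : ℝ) : ℂ) := by
    intro t ht
    rw [cycleIntegrand_eq hn hQ _ ht, cycleIntegrand_eq hn hQ _ ht, norm_mul, Complex.norm_real,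
      Real.norm_of_nonneg (cycleWeight_pos ht).le]
    push_cast
    rfl
  rw [cycleIntegral, setIntegral_congr_fun (measurableSet_cycleDomain Q) e,
    integral_complex_ofReal]
  exact (Complex.norm_of_nonneg (integral_nonneg fun _ => norm_nonneg _)).symm

/-- The semicircle of a form with `a ≠ 0` has radius `n / 2|a|`, and the `L¹`-norm of the seed function
along it is at most a constant times the power `Re s` of the radius. -/
theorem norm_cycleIntegral_norm_seedFunction_le {n : ℝ} (hn : 0 < n) (m : ℕ) {s : ℂ}
    (hs : 1 < s.re) : ∃ K : ℝ, ∀ Q : BinForm, (Q.disc : ℝ) = n ^ 2 → Q.a ≠ 0 →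
      ‖cycleIntegral Q (fun τ => ((‖seedFunction m (phi m s) τ‖ : ℝ) : ℂ))‖ ≤
        K * |(Q.a : ℝ)| ^ (-s.re) := by
  obtain ⟨K, hK, hbd⟩ := norm_angular_integrand_le m hs n
  refine ⟨K * (n / 2) ^ s.re * Real.pi, fun Q hQ ha => ?_⟩
  have hdom : cycleDomain Q = Ioo 0 Real.pi := by simp [cycleDomain, ha]
  have ha' : (Q.a : ℝ) ≠ 0 := by exact_mod_cast ha
  have ha1 : (1 : ℝ) ≤ |(Q.a : ℝ)| := by exact_mod_cast Int.one_le_abs ha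
  have hr : 0 < n / (2 * |(Q.a : ℝ)|) := by positivity
  have hrn : n / (2 * |(Q.a : ℝ)|) ≤ n := div_le_self hn.le (by linarith)
  obtain ⟨ε, hε, hpar⟩ := cycleParam_re_im hn hQ ha
  set r := n / (2 * |(Q.a : ℝ)|) with hrdef
  have hb : ∀ t ∈ Ioo 0 Real.pi,
      ‖cycleIntegrand Q (fun τ => ((‖seedFunction m (phi m s) τ‖ : ℝ) : ℂ)) t‖ ≤ K * r ^ s.re := by
    intro t ht
    obtain ⟨hre, him⟩ := hpar t ht
    have h := hbd r hr hrn t ht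
    rw [cycleIntegrand_eq hn hQ _ (by rwa [hdom]), norm_mul, Complex.norm_real, norm_norm,
      seedFunction, norm_mul, norm_expTwoPiI, one_mul, him]
    simp only [cycleWeight, ha, if_false]
    rwa [Complex.ofReal_inv, norm_inv, ← div_eq_mul_inv, ← norm_div]
  rw [cycleIntegral, hdom]
  refine (norm_setIntegral_le_of_norm_le_const (by simp) hb).trans_eq ?_
  have hrs : r ^ s.re = (n / 2) ^ s.re * |(Q.a : ℝ)| ^ (-s.re) := by
    rw [hrdef, ← div_div, Real.div_rpow (by positivity) (by positivity),
      Real.rpow_neg (by positivity)]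
    rfl
  rw [hrs]
  simp [Real.pi_pos.le]
  ring

/-! ### Cosets of `Γ_∞` and the modified Poincaré series -/

theorem mul_inv_mem_gammaInf {γ δ : SL(2, ℤ)} (h0 : γ 1 0 = δ 1 0) (h1 : γ 1 1 = δ 1 1) :
    δ * γ⁻¹ ∈ gammaInf := by
  change (δ * γ⁻¹) 1 0 = 0
  rw [Matrix.SpecialLinearGroup.coe_mul, Matrix.mul_apply, Fin.sum_univ_two]
  simp [Matrix.SpecialLinearGroup.SL2_inv_expl, h0, h1]
  ring

theorem coset_eq_iff {γ δ : SL(2, ℤ)} :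
    (Quotient.mk _ γ : CuspCosets) = Quotient.mk _ δ ↔ δ * γ⁻¹ ∈ gammaInf := by
  rw [← QuotientGroup.rightRel_apply]
  exact Quotient.eq

/-- A coset in `Γ_∞ \ Γ` is determined by the bottom row of a representative. -/
theorem injective_bottomRow :
    Function.Injective fun κ : CuspCosets => (κ.out 1 1, -κ.out 1 0) := by
  intro κ κ' h
  simp only [Prod.mk.injEq, neg_inj] at h
  have := coset_eq_iff.mpr (mul_inv_mem_gammaInf h.2 h.1)
  simpa using this

instance : Countable CuspCosets := injective_bottomRow.countable

theorem norm_bottomRow_pos (γ : SL(2, ℤ)) : 1 ≤ ‖![γ 1 0, γ 1 1]‖ := by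
  have hdet := det_eq_one γ
  have h : γ 1 0 ≠ 0 ∨ γ 1 1 ≠ 0 := by
    by_contra hc
    push Not at hc
    rw [hc.1, hc.2] at hdet
    simp at hdet
  have key : ∀ z : ℤ, z ≠ 0 → 1 ≤ ‖z‖ := fun z hz => by
    rw [Int.norm_eq_abs]; exact_mod_cast Int.one_le_abs hz
  rcases h with h | h
  · exact (key _ h).trans (norm_le_pi_norm ![γ 1 0, γ 1 1] 0)
  · exact (key _ h).trans (norm_le_pi_norm ![γ 1 0, γ 1 1] 1)

theorem im_smul_rpow_le (γ : SL(2, ℤ)) (τ : ℍ) {k : ℝ} (hk : 0 ≤ k) :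
    (γ • τ).im ^ k ≤ τ.im ^ k * EisensteinSeries.r τ ^ (-(2 * k)) * ‖![γ 1 0, γ 1 1]‖ ^ (-(2 * k)) := by
  have h := EisensteinSeries.summand_bound τ (k := 2 * k) (by positivity) ![γ 1 0, γ 1 1]
  have him : (γ • τ).im = τ.im / ‖(γ 1 0 : ℂ) * τ + γ 1 1‖ ^ 2 := by
    rw [ModularGroup.im_smul_eq_div_normSq, ModularGroup.denom_apply, Complex.normSq_eq_norm_sq]
  have hτ := τ.im_pos
  rw [him, Real.div_rpow hτ.le (by positivity), div_eq_mul_inv, mul_assoc]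
  gcongr
  rw [← Real.rpow_natCast, ← Real.rpow_mul (norm_nonneg _), ← Real.rpow_neg (norm_nonneg _)]
  simpa using h

/-- Comparison with the Eisenstein series of weight `2 Re s > 2`. -/
theorem summable_cosetSummand (m : ℕ) {s : ℂ} (hs : 1 < s.re) (τ : ℍ) :
    Summable (cosetSummand m (phi m s) τ) := by
  have hr := EisensteinSeries.r_pos τ
  obtain ⟨K, hK, hbd⟩ := norm_phi_le m hs (τ.im * EisensteinSeries.r τ ^ (-2 : ℝ))
  have h1 := (EisensteinSeries.summable_one_div_norm_rpow (k := 2 * s.re) (by linarith)).mul_left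
    (K * (τ.im ^ s.re * EisensteinSeries.r τ ^ (-(2 * s.re))))
  have hinj : Function.Injective fun κ : CuspCosets => ![κ.out 1 0, κ.out 1 1] := by
    intro κ κ' h
    have e0 := congrFun h 0
    have e1 := congrFun h 1
    simp at e0 e1
    exact injective_bottomRow (by simp [e0, e1])
  refine Summable.of_norm_bounded (h1.comp_injective hinj) fun κ => ?_
  have hout : cosetSummand m (phi m s) τ κ = seedFunction m (phi m s) (κ.out • τ) := by
    conv_lhs => rw [← Quotient.out_eq κ]
    rfl
  have h2 := im_smul_rpow_le κ.out τ (k := s.re) (by linarith)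
  have h3 := im_smul_rpow_le κ.out τ (k := 1) zero_le_one
  have h4 : (κ.out • τ).im ≤ τ.im * EisensteinSeries.r τ ^ (-2 : ℝ) := by
    rw [Real.rpow_one, Real.rpow_one, mul_one] at h3
    refine h3.trans (mul_le_of_le_one_right (mul_nonneg τ.im_pos.le (by positivity)) ?_)
    exact Real.rpow_le_one_of_one_le_of_nonpos (norm_bottomRow_pos κ.out) (by norm_num)
  rw [hout, seedFunction, norm_mul, norm_expTwoPiI, one_mul]
  refine (hbd _ (κ.out • τ).im_pos h4).trans ?_
  simp only [Function.comp_apply]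
  rw [mul_assoc K]
  gcongr

theorem act_a_eq_zero_of_isRootMatrix {Q : BinForm} {γ : SL(2, ℤ)} (h : IsRootMatrix Q γ) :
    (BinForm.act γ Q).a = 0 := by
  obtain ⟨r, s, -, hQ, h0, h1⟩ := h
  rw [BinForm.act_a, h0, h1, ← hQ]
  simp only [BinForm.eval]; ring

theorem isRootMatrix_of_act_a_eq_zero {Q : BinForm} {γ : SL(2, ℤ)}
    (h : (BinForm.act γ Q).a = 0) : IsRootMatrix Q γ := by
  refine ⟨-γ 1 1, γ 1 0, ⟨-γ 0 0, -γ 0 1, ?_⟩, ?_, rfl, by ring⟩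
  · linear_combination det_eq_one γ
  · rw [← h, BinForm.act_a]
    simp only [BinForm.eval]; ring

/-- The omitted cosets are those of the `γ` for which `γQ` has a root at `∞`. -/
theorem mk_mem_nonRootCosets_iff {Q : BinForm} {γ : SL(2, ℤ)} :
    (Quotient.mk _ γ : CuspCosets) ∈ nonRootCosets Q ↔ (BinForm.act γ Q).a ≠ 0 := by
  constructor
  · intro h ha
    exact h γ rfl (isRootMatrix_of_act_a_eq_zero ha)
  · intro ha δ hδ hroot
    apply ha
    have hmem := coset_eq_iff.mp hδ
    obtain ⟨k, h1, -⟩ := BinForm.act_translation hmem (BinForm.act δ Q)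
    rw [← BinForm.act_mul, inv_mul_cancel_right] at h1
    rw [h1, act_a_eq_zero_of_isRootMatrix hroot]

/-- The cycle integral of the summand of `γ` only depends on the form `γQ`. -/
theorem cycle_cosetSummand {Q : BinForm} {n : ℝ} (hn : 0 < n) (hQ : (Q.disc : ℝ) = n ^ 2)
    (m : ℕ) {s : ℂ} (hs : 1 < s.re) {γ : SL(2, ℤ)} (ha : (BinForm.act γ Q).a ≠ 0) :
    CycleIntegrable Q (fun τ => cosetSummand m (phi m s) τ (Quotient.mk _ γ)) ∧
      cycleIntegral Q (fun τ => cosetSummand m (phi m s) τ (Quotient.mk _ γ)) =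
        expTwoPiI (m * ((BinForm.act γ Q).b / (2 * (BinForm.act γ Q).a))) *
          angularIntegral m s (n / (2 * |((BinForm.act γ Q).a : ℝ)|)) := by
  have h := cycle_comp_smul hn hQ γ (seedFunction m (phi m s))
  have h' := cycle_seedFunction (Q := BinForm.act γ Q) hn (by rw [BinForm.disc_act, hQ]) ha m hs
  exact ⟨h.1.mpr h'.1, h.2.trans h'.2⟩

/-- The summands of the Poincaré series have summable `L¹`-norms along `C_Q`. -/
theorem summable_integral_norm_cosetSummand {Q : BinForm} {n : ℤ} (hn : 0 < n)
    (hQ : Q.disc = n ^ 2) (m : ℕ) {s : ℂ} (hs : 1 < s.re) :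
    Summable fun κ : nonRootCosets Q => ∫ t in cycleDomain Q,
      ‖cycleIntegrand Q (fun τ => cosetSummand m (phi m s) τ κ) t‖ := by
  have hn' : (0 : ℝ) < n := by exact_mod_cast hn
  have hQ' : (Q.disc : ℝ) = (n : ℝ) ^ 2 := by exact_mod_cast congrArg (Int.cast (R := ℝ)) hQ
  obtain ⟨K, hK⟩ := norm_cycleIntegral_norm_seedFunction_le hn' m hs
  have h1 := (summable_abs_eval_rpow hn hQ hs).mul_left K
  have h2 := h1.comp_injective (injective_bottomRow.comp Subtype.val_injective :
    Function.Injective fun κ : nonRootCosets Q => (κ.1.out 1 1, -κ.1.out 1 0))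
  refine Summable.of_nonneg_of_le (fun κ => integral_nonneg fun _ => norm_nonneg _)
    (fun κ => ?_) h2
  have hκ : (Quotient.mk _ κ.1.out : CuspCosets) = κ.1 := Quotient.out_eq _
  have ha : (BinForm.act κ.1.out Q).a ≠ 0 := by
    rw [← mk_mem_nonRootCosets_iff, hκ]; exact κ.2
  have h3 := cycle_comp_smul hn' hQ' κ.1.out
    (fun τ => ((‖seedFunction m (phi m s) τ‖ : ℝ) : ℂ))
  have h4 := hK (BinForm.act κ.1.out Q) (by rw [BinForm.disc_act, hQ']) ha
  rw [← h3.2, BinForm.act_a] at h4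
  rw [integral_norm_cycleIntegrand hn' hQ', ← hκ]
  exact h4

theorem integrable_tsum_of_summable_integral_norm {α ι : Type*} [Countable ι]
    {mα : MeasurableSpace α} {μ : Measure α} {F : ι → α → ℂ} (hF : ∀ i, Integrable (F i) μ)
    (hs : Summable fun i => ∫ a, ‖F i a‖ ∂μ) : Integrable (fun a => ∑' i, F i a) μ := by
  have hlt : ∫⁻ a, ∑' i, ‖F i a‖ₑ ∂μ < ⊤ := by
    rw [lintegral_tsum fun i => (hF i).1.enorm]
    have e : ∀ i, ∫⁻ a, ‖F i a‖ₑ ∂μ = (((∫ a, ‖F i a‖ ∂μ).toNNReal : NNReal) : ENNReal) :=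
      fun i => (ofReal_integral_norm_eq_lintegral_enorm (hF i)).symm
    simp_rw [e]
    rw [lt_top_iff_ne_top, ENNReal.tsum_coe_ne_top_iff_summable]
    exact hs.toNNReal
  have hae : ∀ᵐ a ∂μ, Summable fun i => F i a := by
    filter_upwards [ae_lt_top' (AEMeasurable.tsum fun i => (hF i).1.enorm) hlt.ne] with a ha
    have : Summable fun i => ‖F i a‖₊ := ENNReal.tsum_coe_ne_top_iff_summable.mp ha.ne
    exact Summable.of_norm (NNReal.summable_coe.mpr this)
  refine ⟨?_, ?_⟩
  · refine aestronglyMeasurable_of_tendsto_ae (atTop : Filter (Finset ι))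
      (f := fun S a => ∑ i ∈ S, F i a) (fun S => ?_) ?_
    · exact Finset.aestronglyMeasurable_fun_sum S fun i _ => (hF i).1
    · filter_upwards [hae] with a ha using ha.hasSum
  · rw [hasFiniteIntegral_iff_enorm]
    exact (lintegral_mono fun a => enorm_tsum_le_tsum_enorm).trans_lt hlt

/-- The modified Poincaré series may be integrated termwise along `C_Q`. -/
theorem cycle_modifiedPoincare {Q : BinForm} {n : ℤ} (hn : 0 < n)
    (hQ : Q.disc = n ^ 2) (m : ℕ) {s : ℂ} (hs : 1 < s.re) :
    CycleIntegrable Q (modifiedPoincare m Q s) ∧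
      HasSum (fun κ : nonRootCosets Q =>
        cycleIntegral Q (fun τ => cosetSummand m (phi m s) τ κ))
        (cycleIntegral Q (modifiedPoincare m Q s)) := by
  have hn' : (0 : ℝ) < n := by exact_mod_cast hn
  have hQ' : (Q.disc : ℝ) = (n : ℝ) ^ 2 := by exact_mod_cast congrArg (Int.cast (R := ℝ)) hQ
  have hint : ∀ κ : nonRootCosets Q, Integrable
      (cycleIntegrand Q (fun τ => cosetSummand m (phi m s) τ κ))
      (volume.restrict (cycleDomain Q)) := by
    intro κ
    have hκ : (Quotient.mk _ κ.1.out : CuspCosets) = κ.1 := Quotient.out_eq _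
    have ha : (BinForm.act κ.1.out Q).a ≠ 0 := by
      rw [← mk_mem_nonRootCosets_iff, hκ]; exact κ.2
    have := (cycle_cosetSummand hn' hQ' m hs ha).1
    rwa [hκ] at this
  have hsum := summable_integral_norm_cosetSummand hn hQ m hs
  have e : cycleIntegrand Q (modifiedPoincare m Q s) = fun t =>
      ∑' κ : nonRootCosets Q, cycleIntegrand Q (fun τ => cosetSummand m (phi m s) τ κ) t := by
    ext t
    simp only [cycleIntegrand, modifiedPoincare]
    rw [tsum_mul_right]
  rw [CycleIntegrable, cycleIntegral, e]
  exact ⟨integrable_tsum_of_summable_integral_norm hint hsum,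
    hasSum_integral_of_summable_integral_norm hint hsum⟩

/-! ### Representatives of forms with `a ≠ 0` modulo translations -/

/-- The residues `b` modulo `2c` with `b² ≡ Δ` modulo `4c`. -/
def sqrtResidues (Δ : ℤ) (c : ℕ+) : Finset ℤ :=
  (Finset.Ico (0 : ℤ) (2 * (c : ℤ))).filter fun b => b ^ 2 ≡ Δ [ZMOD 4 * (c : ℤ)]

/-- The form `[c, b, (b² - Δ) / 4c]`. -/
def residueForm (Δ : ℤ) (c : ℕ+) (b : ℤ) : BinForm := ⟨(c : ℤ), b, (b ^ 2 - Δ) / (4 * (c : ℤ))⟩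

theorem residueForm_disc {Δ : ℤ} {c : ℕ+} {b : ℤ} (h : b ^ 2 ≡ Δ [ZMOD 4 * (c : ℤ)]) :
    (residueForm Δ c b).disc = Δ := by
  have h1 : 4 * (c : ℤ) ∣ b ^ 2 - Δ := (Int.modEq_iff_dvd.mp h.symm)
  have h2 := Int.mul_ediv_cancel' h1
  simp only [BinForm.disc, residueForm]
  linear_combination -h2

/-- An index set for the forms of discriminant `Δ` with `a ≠ 0` modulo translations: `c = |a|`,
the residue of `±b` modulo `2c`, and the sign of `a`. -/
abbrev TranslationIndex (Δ : ℤ) : Type := Σ c : ℕ+, sqrtResidues Δ c × Bool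

/-- The form `± [c, b, (b² - Δ) / 4c]` attached to an index. -/
def indexForm {Δ : ℤ} : TranslationIndex Δ → FormsOfDisc Δ
  | ⟨c, (b, true)⟩ => ⟨residueForm Δ c b, residueForm_disc (Finset.mem_filter.mp b.2).2⟩
  | ⟨c, (b, false)⟩ => ⟨⟨-(residueForm Δ c b).a, -(residueForm Δ c b).b, -(residueForm Δ c b).c⟩,
      Eq.trans (by simp only [BinForm.disc]; ring)
        (residueForm_disc (Finset.mem_filter.mp b.2).2)⟩

theorem indexForm_a {Δ : ℤ} (c : ℕ+) (b : sqrtResidues Δ c) (ε : Bool) :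
    (indexForm ⟨c, (b, ε)⟩).1.a = if ε then (c : ℤ) else -(c : ℤ) := by
  cases ε <;> rfl

theorem indexForm_b {Δ : ℤ} (c : ℕ+) (b : sqrtResidues Δ c) (ε : Bool) :
    (indexForm ⟨c, (b, ε)⟩).1.b = if ε then (b : ℤ) else -(b : ℤ) := by
  cases ε <;> rfl

theorem indexForm_a_ne_zero {Δ : ℤ} (t : TranslationIndex Δ) : (indexForm t).1.a ≠ 0 := by
  obtain ⟨c, ⟨b, ε⟩⟩ := t
  have h : ((c : ℕ) : ℤ) ≠ 0 := by exact_mod_cast c.ne_zero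
  cases ε
  · exact neg_ne_zero.mpr h
  · exact h

theorem eq_of_modEq_of_mem_Ico {b b' k l : ℤ} (hb : b ∈ Finset.Ico 0 l) (hb' : b' ∈ Finset.Ico 0 l)
    (h : b' = b - l * k) : b = b' := by
  rw [Finset.mem_Ico] at hb hb'
  rw [← Int.emod_eq_of_lt hb.1 hb.2, ← Int.emod_eq_of_lt hb'.1 hb'.2, h, Int.sub_mul_emod_self_left]

/-- Distinct indices give forms that are not translates of each other. -/
theorem indexForm_injective_mod_gammaInf {Δ : ℤ} {t t' : TranslationIndex Δ} {h : SL(2, ℤ)}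
    (hh : h ∈ gammaInf) (he : BinForm.act h (indexForm t).1 = (indexForm t').1) : t = t' := by
  obtain ⟨k, ha, hb⟩ := BinForm.act_translation hh (indexForm t).1
  rw [he] at ha hb
  obtain ⟨c, ⟨⟨b, hbm⟩, ε⟩⟩ := t
  obtain ⟨c', ⟨⟨b', hbm'⟩, ε'⟩⟩ := t'
  have hc : 0 < ((c : ℕ) : ℤ) := by exact_mod_cast c.pos
  have hc' : 0 < ((c' : ℕ) : ℤ) := by exact_mod_cast c'.pos
  have hI := (Finset.mem_filter.mp hbm).1
  have hI' := (Finset.mem_filter.mp hbm').1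
  have hcc : c = c' ∧ ε = ε' := by
    rw [indexForm_a, indexForm_a] at ha
    cases ε <;> cases ε' <;> simp only [if_true, if_false, Bool.false_eq_true] at ha
    · exact ⟨PNat.eq (by exact_mod_cast (neg_inj.mp ha).symm), rfl⟩
    · omega
    · omega
    · exact ⟨PNat.eq (by exact_mod_cast ha.symm), rfl⟩
  obtain ⟨rfl, rfl⟩ := hcc
  have hbb : b = b' := by
    rw [indexForm_b, indexForm_b, indexForm_a] at hb
    cases ε <;> simp only [if_true, if_false, Bool.false_eq_true] at hb
    · exact eq_of_modEq_of_mem_Ico (k := k) hI hI' (by linear_combination -hb)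
    · exact eq_of_modEq_of_mem_Ico (k := k) hI hI' (by linear_combination hb)
  subst hbb
  rfl

/-- Every form with `a ≠ 0` is a translate of the form of an index: `b` is reduced modulo `2a`. -/
theorem exists_act_eq_indexForm {Δ : ℤ} {Q : BinForm} (hQ : Q.disc = Δ) (ha : Q.a ≠ 0) :
    ∃ h ∈ gammaInf, ∃ t : TranslationIndex Δ, BinForm.act h Q = (indexForm t).1 := by
  have main : ∀ k b : ℤ, ∀ ε : Bool, ∀ c : ℕ+, Q.a = (if ε then (c : ℤ) else -(c : ℤ)) →
      Q.b - 2 * Q.a * k = (if ε then b else -b) → b ∈ Finset.Ico (0 : ℤ) (2 * (c : ℤ)) →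
      ∃ h ∈ gammaInf, ∃ t : TranslationIndex Δ, BinForm.act h Q = (indexForm t).1 := by
    intro k b ε c h1 h2 h3
    have hact := BinForm.act_translation_eq k Q
    have hdisc : (BinForm.act (BinForm.translation k) Q).disc = Δ := by rw [BinForm.disc_act, hQ]
    have hmem : b ∈ sqrtResidues Δ c := by
      refine Finset.mem_filter.mpr ⟨h3, (Int.modEq_iff_dvd.mpr ?_).symm⟩
      rw [← hdisc, hact]
      simp only [BinForm.disc]
      have hb2 : b ^ 2 = (Q.b - 2 * Q.a * k) ^ 2 := by rw [h2]; cases ε <;> simp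
      rw [hb2, h1]
      cases ε
      · exact ⟨-(-(c : ℤ) * k ^ 2 - Q.b * k + Q.c), by simp; ring⟩
      · exact ⟨(c : ℤ) * k ^ 2 - Q.b * k + Q.c, by simp⟩
    refine ⟨BinForm.translation k, BinForm.translation_mem k, ⟨c, ⟨⟨b, hmem⟩, ε⟩⟩, ?_⟩
    refine BinForm.ext_of_disc_eq (by rw [hact]; exact ha) ?_ ?_ (by rw [hdisc]; exact (indexForm _).2.symm)
    · rw [hact, indexForm_a]; exact h1
    · rw [hact, indexForm_b]; exact h2
  have hdm := fun x l : ℤ => Int.emod_add_mul_ediv x l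
  rcases lt_or_gt_of_ne ha with hneg | hpos
  · have hc : 0 < (-Q.a).toNat := by omega
    obtain ⟨c, hcv⟩ : ∃ c : ℕ+, ((c : ℕ) : ℤ) = -Q.a :=
      ⟨⟨_, hc⟩, Int.toNat_of_nonneg (by omega)⟩
    refine main ((-Q.b) / (2 * -Q.a)) ((-Q.b) % (2 * -Q.a)) false c ?_ ?_ ?_
    · rw [hcv]; simp
    · have := hdm (-Q.b) (2 * -Q.a)
      simp only [Bool.false_eq_true, if_false]
      linear_combination this
    · rw [hcv, Finset.mem_Ico]
      exact ⟨Int.emod_nonneg _ (by omega), Int.emod_lt_of_pos _ (by omega)⟩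
  · have hc : 0 < Q.a.toNat := by omega
    obtain ⟨c, hcv⟩ : ∃ c : ℕ+, ((c : ℕ) : ℤ) = Q.a :=
      ⟨⟨_, hc⟩, Int.toNat_of_nonneg (by omega)⟩
    refine main (Q.b / (2 * Q.a)) (Q.b % (2 * Q.a)) true c ?_ ?_ ?_
    · rw [hcv]; simp
    · have := hdm Q.b (2 * Q.a)
      simp only [if_true]
      linear_combination -this
    · rw [hcv, Finset.mem_Ico]
      exact ⟨Int.emod_nonneg _ (by omega), Int.emod_lt_of_pos _ (by omega)⟩

/-- The pairs (class, coset) occurring in the twisted trace. -/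
abbrev UnfoldIndex {Δ : ℤ} (rep : FormClass Δ → FormsOfDisc Δ) : Type :=
  Σ q : FormClass Δ, nonRootCosets (rep q).1

/-- Unfolding: `(q, Γ_∞ γ) ↦ Γ_∞ γ (rep q)` is a bijection from pairs of a class and a coset of
non-root matrices to the forms with `a ≠ 0` modulo translations. Injectivity is the triviality of
stabilizers. -/
theorem exists_unfold_equiv {n : ℤ} (hn : 0 < n) {Δ : ℤ} (hΔ : Δ = n ^ 2)
    {rep : FormClass Δ → FormsOfDisc Δ} (hrep : IsRepSystem rep) :
    ∃ e : TranslationIndex Δ ≃ UnfoldIndex rep, ∀ t, ∃ γ : SL(2, ℤ),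
      ((e t).2 : CuspCosets) = Quotient.mk _ γ ∧
        BinForm.act γ (rep (e t).1).1 = (indexForm t).1 := by
  have hex : ∀ t : TranslationIndex Δ, ∃ γ : SL(2, ℤ),
      γ • rep (Quotient.mk _ (indexForm t)) = indexForm t := by
    intro t
    exact MulAction.orbitRel_apply.mp (Quotient.exact (hrep (Quotient.mk _ (indexForm t))).symm)
  choose γ hγ using hex
  have hγ' : ∀ t, BinForm.act (γ t) (rep (Quotient.mk _ (indexForm t))).1 = (indexForm t).1 :=
    fun t => congrArg Subtype.val (hγ t)
  let F : TranslationIndex Δ → UnfoldIndex rep := fun t =>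
    ⟨Quotient.mk _ (indexForm t), ⟨Quotient.mk _ (γ t), mk_mem_nonRootCosets_iff.mpr (by
      rw [hγ' t]; exact indexForm_a_ne_zero t)⟩⟩
  have hF : Function.Bijective F := by
    constructor
    · intro t t' h
      have h1 : (Quotient.mk _ (indexForm t) : FormClass Δ) = Quotient.mk _ (indexForm t') :=
        congrArg Sigma.fst h
      have h2 : (Quotient.mk _ (γ t) : CuspCosets) = Quotient.mk _ (γ t') :=
        congrArg (fun x : UnfoldIndex rep => (x.2 : CuspCosets)) h
      refine indexForm_injective_mod_gammaInf (coset_eq_iff.mp h2) ?_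
      rw [← hγ' t, ← BinForm.act_mul, inv_mul_cancel_right, h1, hγ' t']
    · have hext : ∀ x y : UnfoldIndex rep, x.1 = y.1 → (x.2 : CuspCosets) = y.2 → x = y := by
        rintro ⟨q, κ⟩ ⟨q', κ'⟩ h1 h2
        obtain rfl : q = q' := h1
        obtain rfl : κ = κ' := Subtype.ext h2
        rfl
      rintro ⟨q, κ, hκ⟩
      induction κ using Quotient.inductionOn with
      | h δ =>
        have ha := mk_mem_nonRootCosets_iff.mp hκ
        obtain ⟨h, hh, t, ht⟩ := exists_act_eq_indexForm
          ((BinForm.disc_act δ (rep q).1).trans (rep q).2) ha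
        rw [← BinForm.act_mul] at ht
        have hq : (Quotient.mk _ (indexForm t) : FormClass Δ) = q := by
          rw [← hrep q]
          apply Quotient.sound
          exact MulAction.orbitRel_apply.mpr ⟨h * δ, Subtype.ext ht⟩
        refine ⟨t, hext _ _ hq ?_⟩
        have h1 := hγ' t
        rw [hq, ← ht] at h1
        have h2 : BinForm.act ((h * δ)⁻¹ * γ t) (rep q).1 = (rep q).1 := by
          rw [BinForm.act_mul, h1, BinForm.act_inv_act]
        apply coset_eq_iff.mpr
        have hinv : h⁻¹ ∈ gammaInf := gammaInf.inv_mem hh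
        rcases BinForm.eq_one_or_neg_one_of_act_eq hn ((rep q).2.trans hΔ) h2 with h3 | h3
        · have : δ * (γ t)⁻¹ = h⁻¹ := by
            rw [inv_mul_eq_one.mp h3 |>.symm]; group
          rw [this]; exact hinv
        · have h4 : γ t = -(h * δ) := by
            rw [inv_mul_eq_iff_eq_mul] at h3
            rw [h3]; simp
          have h5 : (-1 : SL(2, ℤ)) ∈ gammaInf := by
            change (-1 : SL(2, ℤ)) 1 0 = 0
            simp
          have : δ * (γ t)⁻¹ = h⁻¹ * -1 := by
            rw [h4]
            have : (-(h * δ))⁻¹ = -(h * δ)⁻¹ := by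
              rw [inv_eq_iff_mul_eq_one]; simp
            rw [this]; simp
          rw [this]; exact gammaInf.mul_mem hinv h5
  exact ⟨Equiv.ofBijective F hF, fun t => ⟨γ t, rfl, hγ' t⟩⟩

/-! ### The exponential sums -/

theorem expTwoPiI_add_int (x : ℝ) (k : ℤ) : expTwoPiI (x + k) = expTwoPiI x := by
  rw [expTwoPiI, expTwoPiI, Complex.exp_eq_exp_iff_exists_int]
  exact ⟨k, by push_cast; ring⟩

theorem chi_residueForm_add (D Δ : ℤ) (c : ℕ+) (b : ℤ) :
    chi D (residueForm Δ c (b + 2 * c)) = chi D (residueForm Δ c b) := by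
  rw [← chi_act D (BinForm.translation (-1)) (residueForm Δ c b), BinForm.act_translation_eq]
  have hc : (4 * (c : ℤ)) ≠ 0 := by have := c.pos; positivity
  congr 1
  simp only [residueForm]
  ext
  · rfl
  · simp only; ring
  · simp only
    rw [show (b + 2 * (c : ℤ)) ^ 2 - Δ = (b ^ 2 - Δ) + 4 * (c : ℤ) * (b + c) by ring,
      Int.add_mul_ediv_left _ _ hc]
    ring

/-- The summand of `S_m(d, D; 4c)` only depends on `b` modulo `2c`. -/
theorem S_eq_two_mul (m : ℕ) (d D : ℤ) (c : ℕ+) :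
    S m d D c = 2 * ∑ b ∈ sqrtResidues (d * D) c,
      (chi D (residueForm (d * D) c b) : ℂ) * expTwoPiI (m * (b / (2 * (c : ℕ)))) := by
  set g : ℤ → ℂ := fun b => if b ^ 2 ≡ d * D [ZMOD 4 * (c : ℤ)] then
    (chi D (residueForm (d * D) c b) : ℂ) * expTwoPiI (m * (b / (2 * (c : ℕ)))) else 0 with hg
  have hc : (0 : ℤ) < c := by exact_mod_cast c.pos
  have hcR : ((c : ℕ) : ℝ) ≠ 0 := by exact_mod_cast c.ne_zero
  have hper : ∀ b, g (b + 2 * c) = g b := by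
    intro b
    have h1 : ((b + 2 * c) ^ 2 ≡ d * D [ZMOD 4 * (c : ℤ)]) ↔
        (b ^ 2 ≡ d * D [ZMOD 4 * (c : ℤ)]) := by
      have : (b + 2 * (c : ℤ)) ^ 2 ≡ b ^ 2 [ZMOD 4 * (c : ℤ)] :=
        (Int.modEq_iff_dvd.mpr ⟨b + c, by ring⟩).symm
      exact ⟨this.symm.trans, this.trans⟩
    have h2 : expTwoPiI (m * (((b + 2 * c : ℤ) : ℝ) / (2 * (c : ℕ)))) =
        expTwoPiI (m * (b / (2 * (c : ℕ)))) := by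
      rw [← expTwoPiI_add_int (m * (b / (2 * (c : ℕ)))) m]
      congr 1
      push_cast
      field_simp
    simp only [hg, h1, h2, chi_residueForm_add]
  have hS : S m d D c = ∑ b ∈ Finset.Ico (0 : ℤ) (4 * c), g b := by
    rw [S, Finset.sum_filter]
    refine Finset.sum_congr rfl fun b _ => ?_
    simp only [hg, residueForm, mul_div_assoc]
  have hF : ∑ b ∈ sqrtResidues (d * D) c,
      (chi D (residueForm (d * D) c b) : ℂ) * expTwoPiI (m * (b / (2 * (c : ℕ)))) =
      ∑ b ∈ Finset.Ico (0 : ℤ) (2 * c), g b := by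
    rw [sqrtResidues, Finset.sum_filter]
  have hsplit : Finset.Ico (0 : ℤ) (4 * c) =
      Finset.Ico 0 (2 * (c : ℤ)) ∪ (Finset.Ico 0 (2 * (c : ℤ))).map (addRightEmbedding (2 * (c : ℤ))) := by
    rw [Finset.map_add_right_Ico, zero_add, Finset.Ico_union_Ico_eq_Ico (by omega) (by omega)]
    congr 1
    ring
  have hdisj : Disjoint (Finset.Ico 0 (2 * (c : ℤ)))
      ((Finset.Ico 0 (2 * (c : ℤ))).map (addRightEmbedding (2 * (c : ℤ)))) := by
    rw [Finset.map_add_right_Ico, zero_add]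
    exact Finset.Ico_disjoint_Ico_consecutive _ _ _
  rw [hS, hF, hsplit, Finset.sum_union hdisj, Finset.sum_map]
  simp only [addRightEmbedding_apply, hper]
  ring

/-! ### The twisted trace -/

theorem hasSum_sigma_of_fintype {α : Type*} [Fintype α] {β : α → Type*} {f : (Σ a, β a) → ℂ}
    {g : α → ℂ} (h : ∀ a, HasSum (fun b => f ⟨a, b⟩) (g a)) : HasSum f (∑ a, g a) := by
  have hf : Summable f := by
    refine Summable.of_norm ((summable_sigma_of_nonneg fun _ => norm_nonneg _).mpr
      ⟨fun a => (h a).summable.norm, ?_⟩)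
    exact summable_of_hasFiniteSupport (Set.toFinite _)
  exact (hf.hasSum.sigma h).unique (hasSum_fintype _) ▸ hf.hasSum

/-- The twisted trace as an absolutely convergent sum over all pairs of a class and a coset. -/
theorem hasSum_twistedTrace_unfold {n : ℤ} (hn : 0 < n) {Δ : ℤ} (hΔ : Δ = n ^ 2) (D : ℤ) (m : ℕ)
    {s : ℂ} (hs : 1 < s.re) (rep : FormClass Δ → FormsOfDisc Δ) :
    HasSum (fun x : UnfoldIndex rep => (chi D (rep x.1).1 : ℂ) / B s *
      cycleIntegral (rep x.1).1 (fun τ => cosetSummand m (phi m s) τ x.2))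
      (twistedTrace D m s rep) := by
  have := finite_formClass hn hΔ
  have := Fintype.ofFinite (FormClass Δ)
  rw [twistedTrace, finsum_eq_sum_of_fintype]
  have h : ∀ q : FormClass Δ, HasSum (fun κ : nonRootCosets (rep q).1 =>
      (chi D (rep q).1 : ℂ) / B s *
        cycleIntegral (rep q).1 (fun τ => cosetSummand m (phi m s) τ κ))
      ((chi D (rep q).1 : ℂ) / B s * cycleIntegral (rep q).1 (modifiedPoincare m (rep q).1 s)) :=
    fun q => (cycle_modifiedPoincare hn ((rep q).2.trans hΔ) m hs).2.mul_left _
  exact hasSum_sigma_of_fintype (β := fun q => nonRootCosets (rep q).1)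
    (f := fun x : UnfoldIndex rep => (chi D (rep x.1).1 : ℂ) / B s *
      cycleIntegral (rep x.1).1 (fun τ => cosetSummand m (phi m s) τ x.2)) h

/-- The twisted trace as a series over `c = |a|`. -/
theorem hasSum_twistedTrace {d D n : ℤ} (hd4 : d % 4 = 0 ∨ d % 4 = 1) (hD : 0 < D)
    (hDfund : IsFundamentalDiscriminant D) (hn : 0 < n) (hΔ : d * D = n ^ 2) (m : ℕ)
    {s : ℂ} (hs : 1 < s.re) {rep : FormClass (d * D) → FormsOfDisc (d * D)}
    (hrep : IsRepSystem rep) :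
    HasSum (fun c : ℕ+ => S m d D c * (angularIntegral m s (n / (2 * (c : ℕ))) / B s))
      (twistedTrace D m s rep) := by
  have hsq : IsSquare (d * D) := ⟨n, by rw [hΔ, sq]⟩
  have hn' : (0 : ℝ) < n := by exact_mod_cast hn
  obtain ⟨e, he⟩ := exists_unfold_equiv hn hΔ hrep
  have h := (e.hasSum_iff.mpr (hasSum_twistedTrace_unfold hn hΔ D m hs rep))
  have hterm : ∀ t : TranslationIndex (d * D), ((fun x : UnfoldIndex rep =>
      (chi D (rep x.1).1 : ℂ) / B s *
      cycleIntegral (rep x.1).1 (fun τ => cosetSummand m (phi m s) τ x.2)) ∘ e) t =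
      (chi D (residueForm (d * D) t.1 t.2.1) : ℂ) *
        expTwoPiI (m * ((t.2.1 : ℤ) / (2 * (t.1 : ℕ)))) *
        (angularIntegral m s (n / (2 * (t.1 : ℕ))) / B s) := by
    intro t
    obtain ⟨γ, h1, h2⟩ := he t
    have hdisc : (((rep (e t).1).1.disc : ℤ) : ℝ) = (n : ℝ) ^ 2 := by
      rw [(rep (e t).1).2, hΔ]; push_cast; rfl
    have h3 := (cycle_cosetSummand hn' hdisc m hs (γ := γ)
      (by rw [h2]; exact indexForm_a_ne_zero t)).2
    have hchi : chi D (rep (e t).1).1 = chi D (residueForm (d * D) t.1 t.2.1) := by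
      rw [← chi_act D γ, h2]
      obtain ⟨c, ⟨b, ε⟩⟩ := t
      -- a negative `a` occurs for the negative of the form in `S_m`, with the same value of `χ_D`
      cases ε
      · exact chi_neg hd4 hD hDfund hsq (residueForm_disc (Finset.mem_filter.mp b.2).2)
      · rfl
    have hab : ((indexForm t).1.b : ℝ) / (2 * (indexForm t).1.a) =
        (t.2.1 : ℤ) / (2 * (t.1 : ℕ)) ∧ |((indexForm t).1.a : ℝ)| = (t.1 : ℕ) := by
      obtain ⟨c, ⟨b, ε⟩⟩ := t
      rw [indexForm_a, indexForm_b]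
      cases ε <;> simp [neg_div_neg_eq]
    simp only [Function.comp_apply]
    rw [h1, h3, h2, hchi, hab.1, hab.2]
    ring
  rw [funext hterm] at h
  -- for fixed `c` the two signs contribute equally, and the factor `2` is that of `S_eq_two_mul`
  refine h.sigma fun c => ?_
  have hfib : S m d D c * (angularIntegral m s (n / (2 * (c : ℕ))) / B s) =
      ∑ t : sqrtResidues (d * D) c × Bool, (chi D (residueForm (d * D) c t.1) : ℂ) *
        expTwoPiI (m * ((t.1 : ℤ) / (2 * (c : ℕ)))) *
        (angularIntegral m s (n / (2 * (c : ℕ))) / B s) := by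
    simp only [Fintype.sum_prod_type, Fintype.sum_bool]
    rw [S_eq_two_mul, ← Finset.sum_coe_sort, Finset.mul_sum, Finset.sum_mul]
    refine Finset.sum_congr rfl fun b _ => ?_
    ring
  rw [hfib]
  exact hasSum_fintype _

theorem summable_and_eq_of_hasSum_const_mul {ι : Type*} {f g : ι → ℂ} {T K : ℂ} (hK : K ≠ 0)
    (h : HasSum f T) (hfg : ∀ i, f i = K * g i) : Summable g ∧ T = K * ∑' i, g i := by
  obtain rfl : f = fun i => K * g i := funext hfg
  exact ⟨(summable_mul_left_iff hK).mp h.summable, by rw [← h.tsum_eq, tsum_mul_left]⟩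

theorem ofReal_sq_cpow {x : ℝ} (hx : 0 < x) (z : ℂ) : ((x ^ 2 : ℝ) : ℂ) ^ z = (x : ℂ) ^ (2 * z) := by
  rw [ofReal_cpow_eq_exp (by positivity), ofReal_cpow_eq_exp hx, Real.log_pow]
  congr 1
  push_cast
  ring

theorem ofReal_sqrt_eq_cpow {x : ℝ} (hx : 0 ≤ x) : ((√x : ℝ) : ℂ) = (x : ℂ) ^ (1 / 2 : ℂ) := by
  rw [Real.sqrt_eq_rpow, Complex.ofReal_cpow hx]
  norm_num

end

end SquareTrace

open SquareTrace in
theorem proposition3 (d D : ℤ) (hd : 0 < d) (hd4 : d % 4 = 0 ∨ d % 4 = 1)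
    (hD : 0 < D) (hDfund : SquareTrace.IsFundamentalDiscriminant D)
    (hsq : IsSquare (d * D)) (m : ℕ) (s : ℂ) (hs : 1 < s.re) :
    Finite (SquareTrace.FormClass (d * D)) ∧
    (∀ Q : SquareTrace.FormsOfDisc (d * D),
      (∀ τ : UpperHalfPlane, SquareTrace.PoincareConverges m Q.1 s τ) ∧
      SquareTrace.CycleIntegrable Q.1 (SquareTrace.modifiedPoincare m Q.1 s)) ∧
    (0 < m →
      Summable (fun c : ℕ+ => SquareTrace.S m d D c / (((c : ℕ) : ℂ) ^ (1 / 2 : ℂ)) *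
        SquareTrace.besselJ (s - 1 / 2)
          ((Real.pi * m * Real.sqrt ((d * D : ℤ) : ℝ) / (c : ℕ) : ℝ) : ℂ)) ∧
      ∀ rep : SquareTrace.FormClass (d * D) → SquareTrace.FormsOfDisc (d * D),
        SquareTrace.IsRepSystem rep →
        SquareTrace.twistedTrace D m s rep =
          (Real.pi : ℂ) / (Real.sqrt 2 : ℂ) * (m : ℂ) ^ (1 / 2 : ℂ) *
            ((d * D : ℤ) : ℂ) ^ (1 / 4 : ℂ) *
            ∑' c : ℕ+, SquareTrace.S m d D c / (((c : ℕ) : ℂ) ^ (1 / 2 : ℂ)) *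
              SquareTrace.besselJ (s - 1 / 2)
                ((Real.pi * m * Real.sqrt ((d * D : ℤ) : ℝ) / (c : ℕ) : ℝ) : ℂ)) ∧
    (m = 0 →
      Summable (fun c : ℕ+ => SquareTrace.S 0 d D c / (((c : ℕ) : ℂ) ^ s)) ∧
      ∀ rep : SquareTrace.FormClass (d * D) → SquareTrace.FormsOfDisc (d * D),
        SquareTrace.IsRepSystem rep →
        SquareTrace.twistedTrace D m s rep =
          (2 : ℂ) ^ (-s - 1) * ((d * D : ℤ) : ℂ) ^ (s / 2) *
            ∑' c : ℕ+, SquareTrace.S 0 d D c / (((c : ℕ) : ℂ) ^ s)) := by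
  have hΔpos : 0 < d * D := mul_pos hd hD
  obtain ⟨n, hn, hΔ⟩ : ∃ n : ℤ, 0 < n ∧ d * D = n ^ 2 := by
    obtain ⟨k, hk⟩ := hsq
    refine ⟨|k|, abs_pos.mpr ?_, by rw [hk, sq_abs, sq]⟩
    rintro rfl
    simp at hk
    omega
  have hn' : (0 : ℝ) < n := by exact_mod_cast hn
  have hΔR : ((d * D : ℤ) : ℝ) = (n : ℝ) ^ 2 := by rw [hΔ]; push_cast; rfl
  have hΔC : ((d * D : ℤ) : ℂ) = (((n : ℝ) ^ 2 : ℝ) : ℂ) := by rw [hΔ]; push_cast; rfl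
  have hsqrt : √((d * D : ℤ) : ℝ) = n := by rw [hΔR, Real.sqrt_sq hn'.le]
  have hB := B_ne_zero hs
  -- a system of representatives is needed even for the convergence of the series over `c`, which
  -- is read off from the unfolded trace
  have hout : IsRepSystem (fun q : FormClass (d * D) => q.out) := fun q => Quotient.out_eq q
  refine ⟨finite_formClass hn hΔ, fun Q => ⟨fun τ => ?_, ?_⟩, fun hm => ?_, fun hm => ?_⟩
  · exact (summable_cosetSummand m hs τ).comp_injective Subtype.val_injective
  · exact (cycle_modifiedPoincare hn (Q.2.trans hΔ) m hs).1
  · have hm' : (0 : ℝ) < m := by exact_mod_cast hm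
    have hK : (Real.pi : ℂ) / (√2 : ℝ) * (m : ℂ) ^ (1 / 2 : ℂ) *
        ((d * D : ℤ) : ℂ) ^ (1 / 4 : ℂ) ≠ 0 := by
      have h1 : (m : ℂ) ≠ 0 := by exact_mod_cast hm.ne'
      have h2 : ((d * D : ℤ) : ℂ) ≠ 0 := by exact_mod_cast hΔpos.ne'
      have h3 : ((√2 : ℝ) : ℂ) ≠ 0 := by simp
      have h4 : (Real.pi : ℂ) ≠ 0 := by simp [Real.pi_ne_zero]
      refine mul_ne_zero (mul_ne_zero (div_ne_zero h4 h3) ?_) ?_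
      · exact (Complex.cpow_ne_zero_iff_of_exponent_ne_zero (by norm_num)).mpr h1
      · exact (Complex.cpow_ne_zero_iff_of_exponent_ne_zero (by norm_num)).mpr h2
    have hterm : ∀ c : ℕ+, S m d D c * (angularIntegral m s (n / (2 * (c : ℕ))) / B s) =
        (Real.pi : ℂ) / (√2 : ℝ) * (m : ℂ) ^ (1 / 2 : ℂ) * ((d * D : ℤ) : ℂ) ^ (1 / 4 : ℂ) *
        (S m d D c / (((c : ℕ) : ℂ) ^ (1 / 2 : ℂ)) * besselJ (s - 1 / 2)
          ((Real.pi * m * √((d * D : ℤ) : ℝ) / (c : ℕ) : ℝ) : ℂ)) := by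
      intro c
      have hc : (0 : ℝ) < (c : ℕ) := by exact_mod_cast c.pos
      have h2 : ((√2 : ℝ) : ℂ) ≠ 0 := by simp
      have h22 : ((√2 : ℝ) : ℂ) ^ 2 = 2 := by
        rw [← Complex.ofReal_pow, Real.sq_sqrt zero_le_two]; simp
      have hsc : ((√((c : ℕ) : ℝ) : ℝ) : ℂ) ≠ 0 := by
        exact_mod_cast (Real.sqrt_pos.mpr hc).ne'
      have e1 : (m : ℂ) ^ (1 / 2 : ℂ) = ((√(m : ℝ) : ℝ) : ℂ) := by
        rw [ofReal_sqrt_eq_cpow hm'.le]; simp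
      have e2 : ((c : ℕ) : ℂ) ^ (1 / 2 : ℂ) = ((√((c : ℕ) : ℝ) : ℝ) : ℂ) := by
        rw [ofReal_sqrt_eq_cpow hc.le]; simp
      have e3 : ((d * D : ℤ) : ℂ) ^ (1 / 4 : ℂ) = ((√(n : ℝ) : ℝ) : ℂ) := by
        rw [hΔC, ofReal_sq_cpow hn', ofReal_sqrt_eq_cpow hn'.le]; congr 1; norm_num
      have e4 : √((n : ℝ) / (2 * (c : ℕ))) = √(n : ℝ) / (√2 * √((c : ℕ) : ℝ)) := by
        rw [Real.sqrt_div hn'.le, Real.sqrt_mul zero_le_two]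
      have e5 : 2 * Real.pi * m * ((n : ℝ) / (2 * (c : ℕ))) = Real.pi * m * n / (c : ℕ) := by
        field_simp
      rw [angularIntegral_pos hm hs (by positivity), hsqrt, e1, e2, e3, e4, e5]
      generalize besselJ (s - 1 / 2) _ = J
      push_cast
      field_simp
    refine ⟨(summable_and_eq_of_hasSum_const_mul hK
      (hasSum_twistedTrace hd4 hD hDfund hn hΔ m hs hout) hterm).1, fun rep hrep => ?_⟩
    exact (summable_and_eq_of_hasSum_const_mul hK
      (hasSum_twistedTrace hd4 hD hDfund hn hΔ m hs hrep) hterm).2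
  · subst hm
    have hK : (2 : ℂ) ^ (-s - 1) * ((d * D : ℤ) : ℂ) ^ (s / 2) ≠ 0 := by
      have h2 : ((d * D : ℤ) : ℂ) ≠ 0 := by exact_mod_cast hΔpos.ne'
      exact mul_ne_zero (by simp [Complex.cpow_eq_zero_iff]) (by
        rw [Complex.cpow_def_of_ne_zero h2]; exact Complex.exp_ne_zero _)
    have hterm : ∀ c : ℕ+, S 0 d D c * (angularIntegral 0 s (n / (2 * (c : ℕ))) / B s) =
        (2 : ℂ) ^ (-s - 1) * ((d * D : ℤ) : ℂ) ^ (s / 2) * (S 0 d D c / (((c : ℕ) : ℂ) ^ s)) := by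
      intro c
      have hc : (0 : ℝ) < (c : ℕ) := by exact_mod_cast c.pos
      have e1 : (((n : ℝ) / (2 * (c : ℕ)) : ℝ) : ℂ) ^ s =
          2 * ((2 : ℂ) ^ (-s - 1) * ((d * D : ℤ) : ℂ) ^ (s / 2) / (((c : ℕ) : ℂ) ^ s)) := by
        have e2 : ((c : ℕ) : ℂ) = (((c : ℕ) : ℝ) : ℂ) := by simp
        have e3 : (2 : ℂ) = ((2 : ℝ) : ℂ) := by simp
        rw [hΔC, ofReal_sq_cpow hn', e2, ofReal_cpow_eq_exp (by positivity),
          ofReal_cpow_eq_exp hn', ofReal_cpow_eq_exp hc, Real.log_div hn'.ne' (by positivity),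
          Real.log_mul two_ne_zero hc.ne', mul_div_assoc, ← Complex.exp_sub]
        have e4 : (2 : ℂ) * (2 : ℂ) ^ (-s - 1) = Complex.exp (-Real.log 2 * s) := by
          have := Complex.cpow_add (-s - 1) 1 (two_ne_zero' ℂ)
          rw [Complex.cpow_one, sub_add_cancel] at this
          rw [mul_comm, ← this]
          conv_lhs => rw [e3]
          rw [ofReal_cpow_eq_exp two_pos]
          congr 1; ring
        rw [← mul_assoc, e4, ← Complex.exp_add]
        congr 1
        push_cast
        ring
      rw [angularIntegral_zero hs (by positivity), e1]
      field_simp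
    refine ⟨(summable_and_eq_of_hasSum_const_mul hK
      (hasSum_twistedTrace hd4 hD hDfund hn hΔ 0 hs hout) hterm).1, fun rep hrep => ?_⟩
    exact (summable_and_eq_of_hasSum_const_mul hK
      (hasSum_twistedTrace hd4 hD hDfund hn hΔ 0 hs hrep) hterm).2
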